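/- Let $n\ge 2$, let $q$ be a prime power with $q\equiv 1 \bmod 4$, and read indices modulo $n+1$. Let $$Z(x_0,\dots,x_n)=\sum_{a_0,\dots,a_n\ge 0} c_{a_0,\dots,a_n}(q)\,x_0^{a_0}\cdots x_n^{a_n}$$ be a formal power series with complex coefficients such that (A) or (B) holds. (A) $Z$ is the quadratic $\tilde A_n$ multiple Dirichlet series given by the axioms. That is, there are polynomials $c_a\in\mathbb{C}[X]$ for $a\in\mathbb{Z}_{\ge0}^{n+1}$ and, for every finite field $\mathbb{F}_Q$ with $Q\equiv 1\bmod 4$, weights $H(f_0,\dots,f_n)\in\mathbb{C}$ for monic $f_i\in\mathbb{F}_Q[t]$, such that the $c_a(q)$ are the coefficients of $Z$, such that for all such $Q$ we have $c_a(Q)=\sum H(f_0,\dots,f_n)$ (sum over monic $f_i\in\mathbb{F}_Q[t]$ with $\deg f_i=a_i$), and such that, with $(\tfrac{\cdot}{\cdot})$ the quadratic residue symbol and $s=a_0+\dots+a_n$: 1. if $\gcd(f_0\cdots f_n,g_0\cdots g_n)=1$, then $H(f_0g_0,\dots,f_ng_n)=H(f_0,\dots,f_n)H(g_0,\dots,g_n)\prod_{i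 \bmod n+1}\left(\tfrac{f_i}{g_{i+1}}\right)\left(\tfrac{g_i}{f_{i+1}}\right)$; 2. $\deg c_a\le s$, and $H(p^{a_0},\dots,p^{a_n})=|p|^{s}c_a(|p|^{-1})$ for every monic irreducible $p$, where $|p|=Q^{\deg p}$; 3. if $s\ge 2$, then $c_a$ only has terms of degree greater than $\tfrac12(s+1)$; 4. $H(1,\dots,1,f_i,1,\dots,1)=1$ for all monic $f_i$, and $c_{0,\dots,0,a_i,0,\dots,0}=X^{a_i}$. (B) $Z$ satisfies, for every $i$ modulo $n+1$, the functional equations $$Z_{\mathrm{odd}}(\sigma_i x)=q^{1/2}x_iZ_{\mathrm{odd}}(x),\qquad (1-x_i^{-1})Z_{\mathrm{even}}(\sigma_i x)=(1-qx_i)Z_{\mathrm{even}}(x).$$ Here $\sigma_i$ sends $x_i\mapsto q^{-1}x_i^{-1}$ and $x_{i\pm1}\mapsto q^{1/2}x_ix_{i\pm1}$ and fixes the other variables, and $Z_{\mathrm{odd}}$, $Z_{\mathrm{even}}$ consist of the terms of $Z$ with $a_{i-1}+a_{i+1}$ odd, respectively even. These are identities of formal series, that is, recurrences for the coefficients. Fix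 all $a_j$ with $j\ne i$, put $d=a_{i-1}+a_{i+1}$, and write $c_k$ for the coefficient with $a_i=k$, where $c_k=0$ for $k<0$. Then for all $k\in\mathbb{Z}$ we have $c_k=q^{k-(d-1)/2}c_{d-1-k}$ if $d$ is odd, and $c_k-qc_{k-1}=q^{k-d/2}(c_{d-k}-qc_{d-k-1})$ if $d$ is even. Define the residue $R$, a formal power series in the variables $x_j$ with $0\le j\le n$ even, by $$R=(-q)^{(n+1)/2}\,\mathrm{Res}_{x_1=x_3=\cdots=x_n=q^{-1}}Z(x_0,\dots,x_n)\quad (n\text{ odd}),$$ $$R=(-q)^{n/2}\,\mathrm{Res}_{x_1=x_3=\cdots=x_{n-1}=q^{-1}}Z(q^{-1/4}x_0,x_1,\dots,x_{n-1},q^{-1/4}x_n)\quad (n\text{ even}).$$ This means: multiply the series by $\prod_{i\text{ odd}}(1-qx_i)$ and then put $x_i=q^{-1}$ for all odd $i\le n$. Then each coefficient of $R$ is a finite sum, so $R$ is well defined. For $n$ odd, the coefficient of $R$ at $x_0^{a_0}x_2^{a_2}\cdots x_{n-1}^{a_{n-1}}$ is $$q^{-2(a_0+a_2+\cdots+a_{n-1})}\,c_{a_0,\,a_0+a_2,\,a_2,\,a_2+a_4,\,\dots,\,a_{n-1},\,a_{n-1}+a_0}(q).$$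 For $n$ even, the coefficient of $R$ at $x_0^{a_0}x_2^{a_2}\cdots x_n^{a_n}$ is $$q^{3(a_0+a_n)/4-2(a_0+a_2+\cdots+a_n)}\,c_{a_0,\,a_0+a_2,\,a_2,\,a_2+a_4,\,\dots,\,a_{n-2}+a_n,\,a_n}(q).$$ In particular, if the coefficient of $R$ at $x_0^{a_0}x_2^{a_2}\cdots$ is nonzero, then the $a_i$ are all even or all odd. -/

import Mathlib

open scoped Classical in
/-- The quadratic residue symbol `(f / p)` for a prime (monic irreducible) `p ∈ F[t]`. -/
noncomputable def quadSymPrime {F : Type} [Field F] (f p : Polynomial F) : ℤ :=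
  if p ∣ f then 0 else if ∃ h : Polynomial F, p ∣ f - h ^ 2 then 1 else -1

open scoped Classical in
/-- The quadratic residue symbol `(f / g)` for monic `g`: the product of the symbols `(f / p)`
over the monic irreducible factors `p` of `g`, counted with multiplicity. -/
noncomputable def quadSym {F : Type} [Field F] (f g : Polynomial F) : ℤ :=
  ((UniqueFactorizationMonoid.normalizedFactors g).map (fun p => quadSymPrime f p)).prod

/-- Local weights: for every finite field `F`, a function of `n + 1` polynomials over `F`
(only its values on monic polynomials, for `|F| ≡ 1 mod 4`, matter). -/
abbrev LocalWeights (n : ℕ) : Type 1 :=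
  ∀ (F : Type) [Field F] [Finite F], (Fin (n + 1) → Polynomial F) → ℂ

/-- The `(n + 1)`-tuples of monic polynomials of prescribed degrees. -/
def monicTuples (F : Type) [Field F] {n : ℕ} (a : Fin (n + 1) → ℕ) :
    Set (Fin (n + 1) → Polynomial F) :=
  {f | ∀ i, (f i).Monic ∧ (f i).natDegree = a i}

/-- The four axioms for local weights `H` and global coefficients `c`, the latter being given as
polynomials in `q`.  Indices in `Fin (n + 1)` are added modulo `n + 1`. -/
structure SatisfiesAxioms (n : ℕ) (H : LocalWeights n)
    (c : (Fin (n + 1) → ℕ) → Polynomial ℂ) : Prop where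
  /-- `c_a(q)` is the sum of the weights over monic tuples of degrees `a` (a finite sum). -/
  global : ∀ (F : Type) [Field F] [Finite F], Nat.card F % 4 = 1 → ∀ a : Fin (n + 1) → ℕ,
    (c a).eval (Nat.card F : ℂ) = ∑ᶠ f ∈ monicTuples F a, H F f
  /-- Twisted multiplicativity. -/
  twisted_mult : ∀ (F : Type) [Field F] [Finite F], Nat.card F % 4 = 1 →
    ∀ f g : Fin (n + 1) → Polynomial F, (∀ i, (f i).Monic) → (∀ i, (g i).Monic) →
    IsCoprime (∏ i, f i) (∏ i, g i) →
    H F (fun i => f i * g i) =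
      H F f * H F g * ∏ i, ((quadSym (f i) (g (i + 1)) * quadSym (g i) (f (i + 1)) : ℤ) : ℂ)
  /-- Local-to-global principle, degree bound. -/
  degree_le : ∀ a : Fin (n + 1) → ℕ, (c a).natDegree ≤ ∑ i, a i
  /-- Local-to-global principle, `H(p^a) = |p|^(∑ a) c_a(1 / |p|)` with `|p| = q ^ deg p`. -/
  local_global : ∀ (F : Type) [Field F] [Finite F], Nat.card F % 4 = 1 →
    ∀ p : Polynomial F, p.Monic → Irreducible p → ∀ a : Fin (n + 1) → ℕ,
    H F (fun i => p ^ a i) =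
      ((Nat.card F : ℂ) ^ p.natDegree) ^ (∑ i, a i) *
        (c a).eval (((Nat.card F : ℂ) ^ p.natDegree)⁻¹)
  /-- Dominance principle: apart from `a = 0` and `a` a unit vector, `c_a` only has terms in
  degrees greater than `(∑ a + 1) / 2`. -/
  dominance : ∀ a : Fin (n + 1) → ℕ, 2 ≤ ∑ i, a i →
    ∀ k : ℕ, (c a).coeff k ≠ 0 → (∑ i, a i) + 1 < 2 * k
  /-- Initial conditions for the weights. -/
  initial_weight : ∀ (F : Type) [Field F] [Finite F], Nat.card F % 4 = 1 →
    ∀ (i : Fin (n + 1)) (f : Polynomial F), f.Monic →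
    H F (Function.update (fun _ => 1) i f) = 1
  /-- Initial conditions for the coefficients. -/
  initial_coeff : ∀ (i : Fin (n + 1)) (k : ℕ),
    c (Function.update (fun _ => 0) i k) = Polynomial.X ^ k

/-- `Z = ∑ c_a(q) x^a` is the series over `F_q[t]` attached to weights and coefficients that
satisfy the four axioms. -/
def IsAxiomaticSeries (n q : ℕ) (Z : MvPowerSeries (Fin (n + 1)) ℂ) : Prop :=
  ∃ (H : LocalWeights n) (c : (Fin (n + 1) → ℕ) → Polynomial ℂ), SatisfiesAxioms n H c ∧
    ∀ e : Fin (n + 1) →₀ ℕ, MvPowerSeries.coeff e Z = (c e).eval (q : ℂ)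

/-- The coefficient of `Z` whose `i`-th exponent is the integer `k` and whose other exponents are
those of `e`; it is `0` for negative `k`. -/
noncomputable def coeffAt {n : ℕ} (Z : MvPowerSeries (Fin (n + 1)) ℂ) (i : Fin (n + 1))
    (e : Fin (n + 1) →₀ ℕ) (k : ℤ) : ℂ :=
  if 0 ≤ k then MvPowerSeries.coeff (e.update i k.toNat) Z else 0

/-- The functional equations of `Z` under all `σ_i`
(`x_i ↦ 1 / (q x_i)`, `x_{i ± 1} ↦ q^{1/2} x_i x_{i ± 1}`), namely
`Z_odd (σ_i x) = q^{1/2} x_i Z_odd (x)` and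
`(1 - 1 / x_i) Z_even (σ_i x) = (1 - q x_i) Z_even (x)`,
where `Z_odd`, `Z_even` consist of the terms with `d = e_{i-1} + e_{i+1}` odd, resp. even.
They are identities of formal series, so both sides are compared coefficient by coefficient:
with `Λ(x) = ∑_k c_{…,k,…} x^k` they say `(q^{1/2} x)^{d-1} Λ(1/(q x)) = Λ(x)` for `d` odd and
`(q^{1/2} x)^d N(1/(q x)) = N(x)`, `N(x) = (1 - q x) Λ(x)`, for `d` even. -/
structure SatisfiesFunctionalEquations (n q : ℕ) (Z : MvPowerSeries (Fin (n + 1)) ℂ) : Prop where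
  odd_eq : ∀ (i : Fin (n + 1)) (e : Fin (n + 1) →₀ ℕ) (m : ℤ),
    (e (i - 1) : ℤ) + e (i + 1) = 2 * m + 1 → ∀ k : ℤ,
    coeffAt Z i e k = (q : ℂ) ^ (k - m) * coeffAt Z i e (2 * m - k)
  even_eq : ∀ (i : Fin (n + 1)) (e : Fin (n + 1) →₀ ℕ) (m : ℤ),
    (e (i - 1) : ℤ) + e (i + 1) = 2 * m → ∀ k : ℤ,
    coeffAt Z i e k - q * coeffAt Z i e (k - 1) =
      (q : ℂ) ^ (k - m) * (coeffAt Z i e (2 * m - k) - q * coeffAt Z i e (2 * m - k - 1))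

/-- The even indices `0, 2, 4, …` in `{0, …, n}`. -/
abbrev EvenIdx (n : ℕ) : Type := {i : Fin (n + 1) // Even (i : ℕ)}

/-- The series whose residue is taken: `Z` itself for `n` odd, and
`Z(q^{-1/4} x_0, x_1, …, x_{n-1}, q^{-1/4} x_n)` for `n` even. -/
noncomputable def preResidue {n : ℕ} (q : ℕ) (Z : MvPowerSeries (Fin (n + 1)) ℂ) :
    MvPowerSeries (Fin (n + 1)) ℂ :=
  if Even n then
    MvPowerSeries.rescale
      (fun i => if i = 0 ∨ i = Fin.last n then (((q : ℝ) ^ (-(1 / 4) : ℝ) : ℝ) : ℂ) else 1) Z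
  else Z

/-- `∏_{i odd} (1 - q x_i)` times the series above. -/
noncomputable def clearedSeries {n : ℕ} (q : ℕ) (Z : MvPowerSeries (Fin (n + 1)) ℂ) :
    MvPowerSeries (Fin (n + 1)) ℂ :=
  (∏ i ∈ Finset.univ.filter (fun i : Fin (n + 1) => Odd (i : ℕ)), (1 - MvPowerSeries.C (q : ℂ) * MvPowerSeries.X i)) *
    preResidue q Z

/-- The exponents whose even-numbered entries are those of `a`. -/
def exponentsOver {n : ℕ} (a : EvenIdx n →₀ ℕ) : Set (Fin (n + 1) →₀ ℕ) :=
  {e | ∀ i : EvenIdx n, e i = a i}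

/-- The residue `R`, a formal power series in the even-numbered variables: the operator
`-q Res_{x_i = 1/q}` multiplies by `1 - q x_i` and evaluates at `x_i = 1/q`, and it is applied
for all odd `i`.  Each coefficient is meant as a finite sum. -/
noncomputable def residueSeries {n : ℕ} (q : ℕ) (Z : MvPowerSeries (Fin (n + 1)) ℂ) :
    MvPowerSeries (EvenIdx n) ℂ :=
  fun a => ∑ᶠ e ∈ exponentsOver a, MvPowerSeries.coeff e (clearedSeries q Z) *
    ((q : ℂ)⁻¹) ^ (∑ i ∈ Finset.univ.filter (fun i : Fin (n + 1) => Odd (i : ℕ)), e i)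

/-- `a_i` for even `i`, and `0` for odd `i`. -/
def evenEntry {n : ℕ} (a : EvenIdx n →₀ ℕ) (i : Fin (n + 1)) : ℕ :=
  if h : Even (i : ℕ) then a ⟨i, h⟩ else 0

/-- The exponent `(a_0, a_0 + a_2, a_2, a_2 + a_4, …)`: it ends in `…, a_{n-1}, a_{n-1} + a_0` for
`n` odd and in `…, a_{n-2} + a_n, a_n` for `n` even. -/
noncomputable def interleaved {n : ℕ} (a : EvenIdx n →₀ ℕ) : Fin (n + 1) →₀ ℕ :=
  Finsupp.equivFunOnFinite.symm fun i =>
    if Even (i : ℕ) then evenEntry a i else evenEntry a (i - 1) + evenEntry a (i + 1)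

/-! Fix an odd index i and the other exponents, and let d be the sum of the two neighbouring
exponents. Reflection sends large exponents k of x_i to negative ones. So for d odd the coefficients
vanish for k ≥ d, and for d even c_{k+1} = q c_k for k ≥ d. Multiplication by 1 - q x_i therefore
leaves degree at most d in x_i, and evaluation at 1/q telescopes to q^{-d} c_d. The neighbours of an
odd index are even, so all odd variables can be treated at once, and only the coefficient at the
interleaved exponent survives (`sum_Icc_coeff_prod_mul`, `coeff_residueSeries`). The power of q
counts the odd-numbered exponents (`sum_odd_interleaved`). The parity claim is the vanishing at k =
d for d odd.

It remains to derive the functional equations from the axioms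
(`IsAxiomaticSeries.satisfiesFunctionalEquations`). Fix monic f_j for j ≠ i and sum the weights over
the i-th polynomial. Twisted multiplicativity splits off a local factor for each prime p
(`genSeries_twistedWeight`) and finally leaves the L-series of a quadratic character with squarefree
modulus E. That series has a functional equation without sign: reciprocity has no sign because -1 is
a square, and the Gauss sum modulo E is g^{deg E} with g^2 = Q (`polyGaussSum_eq`).

The local factors are given by the same unknown polynomials c_a, evaluated at 1/|p|. This allows an
induction on s, the sum of the exponents other than the i-th. A tuple of total degree s involves a
local factor of total exponent s only if it is (p^{v_j}) with p linear. There are Q such p, and each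
contributes exactly its local series, which is a reflected copy of the polynomials c_a. All other
tuples are covered by induction, so the series of c(Q) minus its reflected copy at 1/Q has the
functional equation (`SatisfiesAxioms.isReflexive_sub`). Dominance places the terms of c above the
middle degree and those of the copy below it. An identity valid for infinitely many Q therefore
holds for the two parts separately (`Polynomial.eq_zero_of_eval_inv_eq`). -/

/-! ### Clearing denominators and telescoping -/

open MvPowerSeries in
theorem coeff_one_sub_C_mul_X_mul {σ R : Type*} [DecidableEq σ] [CommRing R] (r : R) (i : σ)
    (W : MvPowerSeries σ R) (e : σ →₀ ℕ) :
    coeff e ((1 - C r * X i) * W) =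
      coeff e W - r * if 1 ≤ e i then coeff (e - Finsupp.single i 1) W else 0 := by
  rw [sub_mul, one_mul, map_sub, mul_assoc, coeff_C_mul, X, coeff_monomial_mul]
  simp [Finsupp.single_le_iff]

open MvPowerSeries in
theorem coeff_add_single_one_sub_C_mul_X_mul {σ R : Type*} [DecidableEq σ] [CommRing R] (r : R)
    (i : σ) (W : MvPowerSeries σ R) (e : σ →₀ ℕ) :
    coeff (e + Finsupp.single i 1) ((1 - C r * X i) * W) =
      coeff (e + Finsupp.single i 1) W - r * coeff e W := by
  rw [coeff_one_sub_C_mul_X_mul]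
  simp

/-- `W` is eventually geometric with ratio `r` in the variable `i`, from the exponent `D e` on. -/
def IsGeometricFrom {σ R : Type*} [CommRing R] (r : R) (i : σ) (D : (σ →₀ ℕ) → ℕ)
    (W : MvPowerSeries σ R) : Prop :=
  ∀ e : σ →₀ ℕ, D e ≤ e i →
    MvPowerSeries.coeff (e + Finsupp.single i 1) W = r * MvPowerSeries.coeff e W

-- Multiplication by 1 - r x_j combines coefficients that differ only in the exponent of j. Since D
-- does not see that exponent, the same relation in i holds for both of them.
open MvPowerSeries in
theorem IsGeometricFrom.one_sub_mul {σ R : Type*} [DecidableEq σ] [CommRing R] {r : R} {i j : σ}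
    {D : (σ →₀ ℕ) → ℕ} {W : MvPowerSeries σ R} (h : IsGeometricFrom r i D W) (hij : i ≠ j)
    (hD : ∀ e, D (e + Finsupp.single j 1) = D e) :
    IsGeometricFrom r i D ((1 - C r * X j) * W) := by
  intro e he
  by_cases hj : 1 ≤ e j
  · obtain ⟨e, rfl⟩ : ∃ e', e = e' + Finsupp.single j 1 :=
      ⟨e - Finsupp.single j 1, (tsub_add_cancel_of_le (by simpa using hj)).symm⟩
    rw [hD] at he
    have hi : D e ≤ e i := by simpa [Finsupp.single_apply, hij.symm] using he
    rw [add_right_comm, coeff_add_single_one_sub_C_mul_X_mul, coeff_add_single_one_sub_C_mul_X_mul,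
      add_right_comm, h e hi, h _ (by rw [hD]; exact he)]
    ring
  · rw [coeff_one_sub_C_mul_X_mul, coeff_one_sub_C_mul_X_mul, if_neg hj, if_neg, h e he]
    · ring
    · simpa [Finsupp.single_apply, hij] using hj

open MvPowerSeries in
theorem IsGeometricFrom.prod_mul {σ R : Type*} [DecidableEq σ] [CommRing R] {r : R} {i : σ}
    {D : (σ →₀ ℕ) → ℕ} {W : MvPowerSeries σ R} (h : IsGeometricFrom r i D W) (T : Finset σ)
    (hi : i ∉ T) (hD : ∀ j ∈ T, ∀ e, D (e + Finsupp.single j 1) = D e) :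
    IsGeometricFrom r i D ((∏ j ∈ T, (1 - C r * X j)) * W) := by
  induction T using Finset.induction_on with
  | empty => simpa using h
  | insert j T hj ih =>
    rw [Finset.prod_insert hj, mul_assoc]
    simp only [Finset.mem_insert, not_or] at hi
    exact (ih hi.2 fun k hk => hD k (Finset.mem_insert_of_mem hk)).one_sub_mul hi.1
      (hD j (Finset.mem_insert_self _ _))

-- The factor 1 - r x_i annihilates a tail with ratio r, and the other factors keep the tail
-- geometric by `IsGeometricFrom.prod_mul`.
open MvPowerSeries in
theorem IsGeometricFrom.coeff_prod_mul_eq_zero {σ R : Type*} [DecidableEq σ] [CommRing R] {r : R}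
    {i : σ} {D : (σ →₀ ℕ) → ℕ} {W : MvPowerSeries σ R} (h : IsGeometricFrom r i D W)
    (T : Finset σ) (hi : i ∈ T) (hD : ∀ j ∈ T, ∀ e, D (e + Finsupp.single j 1) = D e)
    (e : σ →₀ ℕ) (he : D e < e i) : coeff e ((∏ j ∈ T, (1 - C r * X j)) * W) = 0 := by
  obtain ⟨e, rfl⟩ : ∃ e', e = e' + Finsupp.single i 1 :=
    ⟨e - Finsupp.single i 1, (tsub_add_cancel_of_le (by
      simp only [Finsupp.single_le_iff]; omega)).symm⟩
  rw [← Finset.mul_prod_erase T _ hi, mul_assoc, coeff_add_single_one_sub_C_mul_X_mul,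
    h.prod_mul (T.erase i) (by simp) fun j hj => hD j (Finset.mem_of_mem_erase hj), sub_self]
  rw [hD i hi] at he
  simpa using he

/-- Telescoping: clearing the denominators `1 - r x_i` for `i ∈ T` and summing the values at
`x_i = 1 / r` over a box gives the value at the far corner of the box. -/
theorem sum_Icc_coeff_prod_mul {σ K : Type*} [DecidableEq σ] [Field K] {r : K} (hr : r ≠ 0)
    (O T : Finset σ) (hTO : T ⊆ O) (W : MvPowerSeries σ K) (b : σ →₀ ℕ) :
    ∑ e ∈ Finset.Icc (b.filter (· ∉ T)) b,
      MvPowerSeries.coeff e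
        ((∏ j ∈ T, (1 - MvPowerSeries.C r * MvPowerSeries.X j)) * W) * r⁻¹ ^ (∑ i ∈ O, e i) =
    MvPowerSeries.coeff b W * r⁻¹ ^ (∑ i ∈ O, b i) := by
  induction T using Finset.induction_on with
  | empty =>
    have : b.filter (· ∉ (∅ : Finset σ)) = b := by ext; simp
    rw [this, Finset.Icc_self]
    simp
  | insert j T hj ih =>
    rw [← ih ((Finset.subset_insert _ _).trans hTO)]
    have hjO : j ∈ O := hTO (Finset.mem_insert_self _ _)
    set V := (∏ j ∈ T, (1 - MvPowerSeries.C r * MvPowerSeries.X j)) * W with hV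
    have hmem : ∀ (S : Finset σ) (e : σ →₀ ℕ), e ∈ Finset.Icc (b.filter (· ∉ S)) b ↔
        (∀ i ∈ S, e i ≤ b i) ∧ ∀ i ∉ S, e i = b i := by
      intro S e
      rw [Finset.mem_Icc, Finsupp.le_def, Finsupp.le_def]
      constructor
      · rintro ⟨h1, h2⟩
        refine ⟨fun i _ => h2 i, fun i hi => le_antisymm (h2 i) ?_⟩
        simpa [Finsupp.filter_apply, hi] using h1 i
      · rintro ⟨h1, h2⟩
        refine ⟨fun i => ?_, fun i => ?_⟩ <;> by_cases hi : i ∈ S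
        · simp [hi]
        · simp [hi, h2 i hi]
        · exact h1 i hi
        · exact (h2 i hi).le
    have key : ∀ e ∈ Finset.Icc (b.filter (· ∉ T)) b,
        ∑ k ∈ Finset.range (b j + 1), MvPowerSeries.coeff (e.update j k)
          ((1 - MvPowerSeries.C r * MvPowerSeries.X j) * V) *
          r⁻¹ ^ (∑ i ∈ O, (e.update j k) i) =
        MvPowerSeries.coeff e V * r⁻¹ ^ (∑ i ∈ O, e i) := by
      intro e he
      have hsum : ∀ k, ∑ i ∈ O, (e.update j k) i = k + ∑ i ∈ O.erase j, e i := by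
        intro k
        rw [← Finset.add_sum_erase _ _ hjO]
        congr 1
        · simp
        · exact Finset.sum_congr rfl fun i hi => by
            simp [Finsupp.update_apply, Finset.ne_of_mem_erase hi]
      -- In one variable, the sum of (V_k - r V_{k-1}) r^{-k} over k ≤ K collapses to V_K r^{-K}.
      have htel : ∀ K, ∑ k ∈ Finset.range (K + 1), MvPowerSeries.coeff (e.update j k)
          ((1 - MvPowerSeries.C r * MvPowerSeries.X j) * V) *
          r⁻¹ ^ (∑ i ∈ O, (e.update j k) i) =
          MvPowerSeries.coeff (e.update j K) V * r⁻¹ ^ (∑ i ∈ O, (e.update j K) i) := by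
        intro K
        induction K with
        | zero =>
          rw [Finset.sum_range_one, coeff_one_sub_C_mul_X_mul]
          simp
        | succ K ihK =>
          have hup : e.update j (K + 1) = e.update j K + Finsupp.single j 1 := by
            ext i
            by_cases h : i = j
            · subst h; simp
            · simp [Finsupp.update_apply, h]
          rw [Finset.sum_range_succ, ihK, hup, coeff_add_single_one_sub_C_mul_X_mul, ← hup,
            hsum, hsum, pow_add, pow_add, pow_succ]
          field_simp
          ring
      have hej : e j = b j := ((hmem T e).1 he).2 j hj
      rw [htel, ← hej, Finsupp.update_self]
    rw [← Finset.sum_congr rfl key, ← Finset.sum_product']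
    -- A point of the larger box is a point of the smaller one, with the j-th entry at the corner
    -- value, together with a free j-th entry.
    refine Finset.sum_nbij' (fun e => (e.update j (b j), e j)) (fun p => p.1.update j p.2)
      ?_ ?_ ?_ ?_ ?_
    · intro e he
      rw [hmem] at he
      rw [Finset.mem_product, hmem, Finset.mem_range]
      refine ⟨⟨fun i hi => ?_, fun i hi => ?_⟩, Nat.lt_succ_of_le (he.1 j (Finset.mem_insert_self _ _))⟩
      · have : i ≠ j := fun h => hj (h ▸ hi)
        simpa [Finsupp.update_apply, this] using he.1 i (Finset.mem_insert_of_mem hi)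
      · by_cases h : i = j
        · subst h; simp
        · simpa [Finsupp.update_apply, h] using he.2 i (by simp [h, hi])
    · rintro ⟨e, k⟩ he
      rw [Finset.mem_product, hmem, Finset.mem_range] at he
      rw [hmem]
      refine ⟨fun i hi => ?_, fun i hi => ?_⟩
      · by_cases h : i = j
        · subst h; simpa using Nat.lt_succ_iff.1 he.2
        · simpa [Finsupp.update_apply, h] using he.1.1 i ((Finset.mem_insert.1 hi).resolve_left h)
      · simp only [Finset.mem_insert, not_or] at hi
        simpa [Finsupp.update_apply, hi.1] using he.1.2 i hi.2
    · intro e _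
      simp
    · rintro ⟨e, k⟩ he
      rw [Finset.mem_product, hmem, Finset.mem_range] at he
      have : e j = b j := he.1.2 j hj
      refine Prod.ext ?_ (by simp)
      ext i
      by_cases h : i = j
      · subst h; simp [this]
      · simp [Finsupp.update_apply, h]
    · intro e _
      have : (e.update j (b j)).update j (e j) = e := by
        simp
      rw [this, Finset.prod_insert hj, mul_assoc]

/-! ### Neighbours in the cyclic index set -/

theorem Fin.add_one_ne_self {n : ℕ} (hn : 1 ≤ n) (i : Fin (n + 1)) : i + 1 ≠ i := by
  obtain ⟨m, rfl⟩ : ∃ m, n = m + 1 := ⟨n - 1, by omega⟩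
  simp

theorem Fin.sub_one_ne_self {n : ℕ} (hn : 1 ≤ n) (i : Fin (n + 1)) : i - 1 ≠ i := by
  obtain ⟨m, rfl⟩ : ∃ m, n = m + 1 := ⟨n - 1, by omega⟩
  simp

theorem Fin.val_add_one_cases {n : ℕ} (i : Fin (n + 1)) :
    ((i : ℕ) = n ∧ i + 1 = 0) ∨ ((i : ℕ) < n ∧ ((i + 1 : Fin (n + 1)) : ℕ) = i + 1) := by
  rcases eq_or_ne i (Fin.last n) with rfl | h
  · left; simp
  · right
    have : (i : ℕ) < n := Fin.val_lt_last h
    exact ⟨this, Fin.val_add_one_of_lt this⟩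

theorem Fin.val_sub_one_cases {n : ℕ} (i : Fin (n + 1)) :
    (i = 0 ∧ ((i - 1 : Fin (n + 1)) : ℕ) = n) ∨
      (0 < (i : ℕ) ∧ ((i - 1 : Fin (n + 1)) : ℕ) = i - 1) := by
  rcases eq_or_ne i 0 with rfl | h
  · left; simp
  · right
    refine ⟨Nat.pos_of_ne_zero fun h' => h (Fin.ext h'), ?_⟩
    rw [Fin.val_sub_one_of_ne_zero h]

theorem Fin.even_add_one_of_odd {n : ℕ} {i : Fin (n + 1)} (hi : Odd (i : ℕ)) :
    Even ((i + 1 : Fin (n + 1)) : ℕ) := by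
  rcases Fin.val_add_one_cases i with ⟨_, h⟩ | ⟨_, h⟩
  · simp [h]
  · rw [h]; exact hi.add_one

theorem Fin.even_sub_one_of_odd {n : ℕ} {i : Fin (n + 1)} (hi : Odd (i : ℕ)) :
    Even ((i - 1 : Fin (n + 1)) : ℕ) := by
  rcases Fin.val_sub_one_cases i with ⟨h, _⟩ | ⟨_, h⟩
  · simp [h] at hi
  · rw [h]; exact Nat.Odd.sub_odd hi odd_one

/-! ### Tails of the coefficients under the functional equations -/

theorem coeffAt_natCast {n : ℕ} (Z : MvPowerSeries (Fin (n + 1)) ℂ) (i : Fin (n + 1))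
    (e : Fin (n + 1) →₀ ℕ) (k : ℕ) :
    coeffAt Z i e k = MvPowerSeries.coeff (e.update i k) Z := by
  simp [coeffAt]

theorem coeffAt_of_neg {n : ℕ} (Z : MvPowerSeries (Fin (n + 1)) ℂ) (i : Fin (n + 1))
    (e : Fin (n + 1) →₀ ℕ) {k : ℤ} (hk : k < 0) : coeffAt Z i e k = 0 := by
  simp [coeffAt, hk]

/-- The reflection k ↦ d - 1 - k sends every k ≥ d to a negative index. -/
theorem SatisfiesFunctionalEquations.coeff_eq_zero {n q : ℕ}
    {Z : MvPowerSeries (Fin (n + 1)) ℂ} (hZ : SatisfiesFunctionalEquations n q Z)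
    (i : Fin (n + 1)) (e : Fin (n + 1) →₀ ℕ) (hodd : Odd (e (i - 1) + e (i + 1)))
    (he : e (i - 1) + e (i + 1) ≤ e i) : MvPowerSeries.coeff e Z = 0 := by
  obtain ⟨m, hm⟩ := hodd
  have := hZ.odd_eq i e m (by exact_mod_cast hm) (e i)
  rw [coeffAt_of_neg Z i e (k := 2 * m - e i) (by omega), mul_zero, coeffAt_natCast,
    Finsupp.update_self] at this
  exact this

theorem SatisfiesFunctionalEquations.isGeometricFrom {n q : ℕ}
    {Z : MvPowerSeries (Fin (n + 1)) ℂ} (hZ : SatisfiesFunctionalEquations n q Z) (hn : 1 ≤ n)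
    (i : Fin (n + 1)) :
    IsGeometricFrom (q : ℂ) i (fun e => e (i - 1) + e (i + 1)) Z := by
  intro e he
  replace he : e (i - 1) + e (i + 1) ≤ e i := he
  have h1 : ∀ f : Fin (n + 1) →₀ ℕ, (f + Finsupp.single i 1 : Fin (n + 1) →₀ ℕ) (i - 1) = f (i - 1) := fun f => by
    simp [(Fin.sub_one_ne_self hn i).symm]
  have h2 : ∀ f : Fin (n + 1) →₀ ℕ, (f + Finsupp.single i 1 : Fin (n + 1) →₀ ℕ) (i + 1) = f (i + 1) := fun f => by
    simp [(Fin.add_one_ne_self hn i).symm]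
  rcases Nat.even_or_odd' (e (i - 1) + e (i + 1)) with ⟨m, hm | hm⟩
  -- At k = e_i + 1 both reflected indices, 2m - k and 2m - k - 1, are negative, so the right-hand
  -- side is 0.
  · have := hZ.even_eq i e m (by exact_mod_cast hm) ((e i + 1 : ℕ) : ℤ)
    rw [coeffAt_of_neg Z i e (k := 2 * m - ((e i + 1 : ℕ) : ℤ)) (by push_cast; omega),
      coeffAt_of_neg Z i e (k := 2 * m - ((e i + 1 : ℕ) : ℤ) - 1) (by push_cast; omega),
      coeffAt_natCast, show ((e i + 1 : ℕ) : ℤ) - 1 = (e i : ℕ) by push_cast; ring,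
      coeffAt_natCast, Finsupp.update_self, mul_zero, sub_zero, mul_zero, sub_eq_zero] at this
    rw [← this]
    congr 2
    ext j
    by_cases h : j = i
    · subst h; simp
    · simp [Finsupp.update_apply, h]
  · rw [hZ.coeff_eq_zero i e ⟨m, hm⟩ he, mul_zero]
    refine hZ.coeff_eq_zero i _ ⟨m, by rw [h1, h2, hm]⟩ ?_
    rw [h1, h2]
    simp only [Finsupp.add_apply, Finsupp.single_eq_same]
    exact he.trans (Nat.le_succ _)

theorem coeff_preResidue_of_odd {n q : ℕ} (hn : Odd n) (Z : MvPowerSeries (Fin (n + 1)) ℂ)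
    (e : Fin (n + 1) →₀ ℕ) :
    MvPowerSeries.coeff e (preResidue q Z) = MvPowerSeries.coeff e Z := by
  rw [preResidue, if_neg (Nat.not_even_iff_odd.2 hn)]

theorem coeff_preResidue_of_even {n q : ℕ} (hn : Even n) (hn0 : n ≠ 0)
    (Z : MvPowerSeries (Fin (n + 1)) ℂ) (e : Fin (n + 1) →₀ ℕ) :
    MvPowerSeries.coeff e (preResidue q Z) =
      (((q : ℝ) ^ (-(1 / 4) : ℝ) : ℝ) : ℂ) ^ (e 0 + e (Fin.last n)) *
        MvPowerSeries.coeff e Z := by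
  rw [preResidue, if_pos hn, MvPowerSeries.coeff_rescale]
  congr 1
  rw [Finsupp.prod_fintype _ _ (by simp)]
  have h0 : (0 : Fin (n + 1)) ≠ Fin.last n := fun h => hn0 (by simpa using (congrArg Fin.val h).symm)
  rw [← Finset.prod_subset (Finset.subset_univ {0, Fin.last n})]
  · rw [Finset.prod_pair h0]
    simp [pow_add]
  · intro i _ hi
    simp only [Finset.mem_insert, Finset.mem_singleton] at hi
    simp [hi]

/-- The rescaled variables are x_0 and x_n with n even, so an odd variable is never rescaled. -/
theorem IsGeometricFrom.preResidue {n q : ℕ} (hn0 : n ≠ 0) {Z : MvPowerSeries (Fin (n + 1)) ℂ}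
    {D : (Fin (n + 1) →₀ ℕ) → ℕ} {i : Fin (n + 1)} (hi : Odd (i : ℕ))
    (h : IsGeometricFrom (q : ℂ) i D Z) : IsGeometricFrom (q : ℂ) i D (preResidue q Z) := by
  intro e he
  rcases Nat.even_or_odd n with hn | hn
  · have h0 : i ≠ 0 := by rintro rfl; simp at hi
    have hl : i ≠ Fin.last n := by
      rintro rfl; exact (Nat.not_even_iff_odd.2 hi) hn
    rw [coeff_preResidue_of_even hn hn0, coeff_preResidue_of_even hn hn0, h e he]
    simp only [Finsupp.add_apply, Finsupp.single_apply, h0, hl, if_false, add_zero]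
    ring
  · rw [coeff_preResidue_of_odd hn, coeff_preResidue_of_odd hn, h e he]

/-! ### The interleaved exponent -/

theorem interleaved_of_even {n : ℕ} (a : EvenIdx n →₀ ℕ) {i : Fin (n + 1)} (hi : Even (i : ℕ)) :
    interleaved a i = a ⟨i, hi⟩ := by
  simp [interleaved, evenEntry, hi]

theorem interleaved_of_odd {n : ℕ} (a : EvenIdx n →₀ ℕ) {i : Fin (n + 1)} (hi : Odd (i : ℕ)) :
    interleaved a i = interleaved a (i - 1) + interleaved a (i + 1) := by
  rw [interleaved_of_even a (Fin.even_sub_one_of_odd hi),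
    interleaved_of_even a (Fin.even_add_one_of_odd hi)]
  simp [interleaved, evenEntry, Nat.not_even_iff_odd.2 hi, Fin.even_sub_one_of_odd hi,
    Fin.even_add_one_of_odd hi]

theorem sum_evenEntry {n : ℕ} (a : EvenIdx n →₀ ℕ) :
    ∑ i : Fin (n + 1), evenEntry a i = ∑ i, a i := by
  rw [← Finset.sum_filter_of_ne (p := fun i : Fin (n + 1) => Even (i : ℕ)),
    Finset.sum_subtype _ (p := fun i : Fin (n + 1) => Even (i : ℕ)) (by simp)]
  · exact Finset.sum_congr rfl fun i _ => by simp [evenEntry, i.2]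
  · intro i _ hi
    by_contra h
    exact hi (by simp [evenEntry, h])

/-- Each even-numbered entry is counted once by each of its odd neighbours, hence twice. For n even
the indices 0 and n are adjacent, so each of them has only one odd neighbour; the extra term makes
up for this. -/
theorem sum_odd_interleaved {n : ℕ} (a : EvenIdx n →₀ ℕ) :
    ∑ i ∈ Finset.univ.filter (fun i : Fin (n + 1) => Odd (i : ℕ)), interleaved a i +
      (if Even n then evenEntry a 0 + evenEntry a (Fin.last n) else 0) = 2 * ∑ i, a i := by
  have hodd : ∀ i : Fin (n + 1), ¬ Even (i : ℕ) → evenEntry a i = 0 := fun i hi => by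
    simp [evenEntry, hi]
  have h1 : ∑ i : Fin (n + 1), evenEntry a (i - 1) = ∑ i, a i :=
    (Equiv.sum_comp (Equiv.subRight (1 : Fin (n + 1))) (evenEntry a)).trans (sum_evenEntry a)
  have h2 : ∑ i : Fin (n + 1), evenEntry a (i + 1) = ∑ i, a i :=
    (Equiv.sum_comp (Equiv.addRight (1 : Fin (n + 1))) (evenEntry a)).trans (sum_evenEntry a)
  rw [← Finset.sum_filter_add_sum_filter_not Finset.univ
    (fun i : Fin (n + 1) => Odd (i : ℕ))] at h1 h2
  have h3 : ∑ i ∈ Finset.univ.filter (fun i : Fin (n + 1) => ¬ Odd (i : ℕ)), evenEntry a (i - 1) =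
      if Even n then evenEntry a (Fin.last n) else 0 := by
    rw [Finset.sum_eq_single_of_mem 0 (by simp)]
    · have : (0 : Fin (n + 1)) - 1 = Fin.last n := by ext; simp
      rw [this]
      split_ifs with h
      · rfl
      · exact hodd _ (by simpa using h)
    · intro i hi h0
      simp only [Finset.mem_filter, Finset.mem_univ, true_and, Nat.not_odd_iff_even] at hi
      apply hodd
      rcases Fin.val_sub_one_cases i with h | ⟨h, h'⟩
      · exact absurd h.1 h0
      · rw [h']
        obtain ⟨k, hk⟩ := hi
        rw [Nat.not_even_iff_odd]
        exact ⟨k - 1, by omega⟩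
  have h4 : ∑ i ∈ Finset.univ.filter (fun i : Fin (n + 1) => ¬ Odd (i : ℕ)), evenEntry a (i + 1) =
      if Even n then evenEntry a 0 else 0 := by
    split_ifs with hn
    · rw [Finset.sum_eq_single_of_mem (Fin.last n) (by simpa using hn)]
      · simp
      · intro i hi h0
        simp only [Finset.mem_filter, Finset.mem_univ, true_and, Nat.not_odd_iff_even] at hi
        apply hodd
        rcases Fin.val_add_one_cases i with h | ⟨h, h'⟩
        · exact absurd (Fin.ext (by simpa using h.1)) h0
        · rw [h', Nat.not_even_iff_odd]; exact hi.add_one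
    · refine Finset.sum_eq_zero fun i hi => hodd _ ?_
      simp only [Finset.mem_filter, Finset.mem_univ, true_and, Nat.not_odd_iff_even] at hi
      rcases Fin.val_add_one_cases i with h | ⟨h, h'⟩
      · exact absurd (h.1 ▸ hi) hn
      · rw [h', Nat.not_even_iff_odd]; exact hi.add_one
  have h5 : ∀ i ∈ Finset.univ.filter (fun i : Fin (n + 1) => Odd (i : ℕ)),
      interleaved a i = evenEntry a (i - 1) + evenEntry a (i + 1) := by
    intro i hi
    simp only [Finset.mem_filter, Finset.mem_univ, true_and] at hi
    simp [interleaved, Nat.not_even_iff_odd.2 hi]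
  rw [Finset.sum_congr rfl h5, Finset.sum_add_distrib]
  rw [h3] at h1
  rw [h4] at h2
  split_ifs at * <;> omega

/-! ### Coefficients of the residue -/

section Residue

variable {n q : ℕ} {Z : MvPowerSeries (Fin (n + 1)) ℂ}

theorem eq_interleaved_of_mem {a : EvenIdx n →₀ ℕ} {e : Fin (n + 1) →₀ ℕ}
    (he : e ∈ exponentsOver a) {i : Fin (n + 1)} (hi : Even (i : ℕ)) : e i = interleaved a i := by
  rw [interleaved_of_even a hi]
  exact he ⟨i, hi⟩

/-- The tail in x_i starts at the sum of two even-numbered exponents, which the factors for the odd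
variables do not move. So `IsGeometricFrom.coeff_prod_mul_eq_zero` applies to all odd variables
together. -/
theorem coeff_clearedSeries_eq_zero (hZ : SatisfiesFunctionalEquations n q Z) (hn : 1 ≤ n)
    {a : EvenIdx n →₀ ℕ} {e : Fin (n + 1) →₀ ℕ} (he : e ∈ exponentsOver a) {i : Fin (n + 1)}
    (hi : Odd (i : ℕ)) (hei : interleaved a i < e i) :
    MvPowerSeries.coeff e (clearedSeries q Z) = 0 := by
  refine ((hZ.isGeometricFrom hn i).preResidue (by omega) hi).coeff_prod_mul_eq_zero _
    (by simpa using hi) ?_ e ?_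
  · intro j hj f
    simp only [Finset.mem_filter, Finset.mem_univ, true_and] at hj
    have h1 : j ≠ i - 1 := by
      rintro rfl; exact (Nat.not_even_iff_odd.2 hj) (Fin.even_sub_one_of_odd hi)
    have h2 : j ≠ i + 1 := by
      rintro rfl; exact (Nat.not_even_iff_odd.2 hj) (Fin.even_add_one_of_odd hi)
    simp [h1, h2]
  · rw [eq_interleaved_of_mem he (Fin.even_sub_one_of_odd hi),
      eq_interleaved_of_mem he (Fin.even_add_one_of_odd hi), ← interleaved_of_odd a hi]
    exact hei

theorem exponentsOver_support_subset (hZ : SatisfiesFunctionalEquations n q Z) (hn : 1 ≤ n)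
    (a : EvenIdx n →₀ ℕ) :
    {e ∈ exponentsOver a | MvPowerSeries.coeff e (clearedSeries q Z) ≠ 0} ⊆
      ↑(Finset.Icc ((interleaved a).filter
        (· ∉ Finset.univ.filter (fun i : Fin (n + 1) => Odd (i : ℕ)))) (interleaved a)) := by
  rintro e ⟨he, h0⟩
  rw [Finset.coe_Icc, Set.mem_Icc, Finsupp.le_def, Finsupp.le_def]
  refine ⟨fun i => ?_, fun i => ?_⟩ <;> rcases Nat.even_or_odd (i : ℕ) with hi | hi
  · simp [hi, eq_interleaved_of_mem he hi]
  · simp [hi]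
  · exact (eq_interleaved_of_mem he hi).le
  · by_contra! hlt
    exact h0 (coeff_clearedSeries_eq_zero hZ hn he hi hlt)

/-- All nonzero terms lie in the box whose far corner is the interleaved exponent, and the sum over
this box telescopes to its corner. -/
theorem coeff_residueSeries (hZ : SatisfiesFunctionalEquations n q Z) (hn : 1 ≤ n) (hq : q ≠ 0)
    (a : EvenIdx n →₀ ℕ) :
    MvPowerSeries.coeff a (residueSeries q Z) =
      MvPowerSeries.coeff (interleaved a) (preResidue q Z) * ((q : ℂ)⁻¹) ^
        (∑ i ∈ Finset.univ.filter (fun i : Fin (n + 1) => Odd (i : ℕ)), interleaved a i) := by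
  rw [← sum_Icc_coeff_prod_mul (Nat.cast_ne_zero.2 hq) _
    (Finset.univ.filter (fun i : Fin (n + 1) => Odd (i : ℕ))) subset_rfl]
  refine finsum_mem_eq_sum_of_subset _ ?_ ?_
  · rintro e ⟨he, h0⟩
    exact exponentsOver_support_subset hZ hn a ⟨he, left_ne_zero_of_mul h0⟩
  · intro e he i
    rw [Finset.coe_Icc, Set.mem_Icc, Finsupp.le_def, Finsupp.le_def] at he
    have h1 := he.1 i
    have h2 := he.2 i
    simp only [Finset.mem_filter, Finset.mem_univ, true_and, Finsupp.filter_apply,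
      Nat.not_odd_iff_even, i.2, if_true] at h1
    rw [← interleaved_of_even a i.2]
    exact le_antisymm h2 h1

theorem coeff_residueSeries_of_odd (hZ : SatisfiesFunctionalEquations n q Z) (hn : Odd n)
    (hq : q ≠ 0) (a : EvenIdx n →₀ ℕ) :
    MvPowerSeries.coeff a (residueSeries q Z) =
      (q : ℂ) ^ (-2 * ∑ i, (a i : ℤ)) * MvPowerSeries.coeff (interleaved a) Z := by
  rw [coeff_residueSeries hZ hn.pos hq, coeff_preResidue_of_odd hn, mul_comm]
  congr 1
  have := sum_odd_interleaved a
  rw [if_neg (Nat.not_even_iff_odd.2 hn), add_zero] at this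
  rw [this, neg_mul, zpow_neg, inv_pow, ← zpow_natCast]
  push_cast
  rfl

theorem coeff_residueSeries_of_even (hZ : SatisfiesFunctionalEquations n q Z) (hn : Even n)
    (hn1 : 1 ≤ n) (hq : q ≠ 0) (a : EvenIdx n →₀ ℕ) :
    MvPowerSeries.coeff a (residueSeries q Z) =
      (((q : ℝ) ^ (3 * ((evenEntry a 0 : ℝ) + evenEntry a (Fin.last n)) / 4
          - 2 * ∑ i, (a i : ℝ)) : ℝ) : ℂ) * MvPowerSeries.coeff (interleaved a) Z := by
  rw [coeff_residueSeries hZ hn1 hq, coeff_preResidue_of_even hn (by omega), mul_right_comm]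
  congr 1
  have h0 : interleaved a 0 = evenEntry a 0 := by simp [interleaved]
  have hl : interleaved a (Fin.last n) = evenEntry a (Fin.last n) := by simp [interleaved, hn]
  have := sum_odd_interleaved a
  rw [if_pos hn] at this
  have hq' : (0 : ℝ) < q := by exact_mod_cast Nat.pos_of_ne_zero hq
  rw [h0, hl, ← Complex.ofReal_natCast q, ← Complex.ofReal_inv, ← Complex.ofReal_pow,
    ← Complex.ofReal_pow, ← Complex.ofReal_mul]
  congr 1
  rw [← Real.rpow_natCast, ← Real.rpow_mul hq'.le, ← Real.rpow_neg_one, ← Real.rpow_natCast,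
    ← Real.rpow_mul hq'.le, ← Real.rpow_add hq']
  congr 1
  have h' := congrArg (Nat.cast (R := ℝ)) this
  push_cast at h' ⊢
  linarith

/-- At each odd i the interleaved exponent has k = d, where
`SatisfiesFunctionalEquations.coeff_eq_zero` rules out odd d. So consecutive even-numbered entries
have equal parity, and the chain from 0 upwards reaches all of them. -/
theorem parity_of_coeff_ne_zero (hZ : SatisfiesFunctionalEquations n q Z)
    (a : EvenIdx n →₀ ℕ) (h0 : MvPowerSeries.coeff (interleaved a) Z ≠ 0) :
    (∀ i, Even (a i)) ∨ ∀ i, Odd (a i) := by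
  have hodd : ∀ i : Fin (n + 1), Odd (i : ℕ) →
      Even (interleaved a (i - 1) + interleaved a (i + 1)) := by
    intro i hi
    by_contra h
    exact h0 (hZ.coeff_eq_zero i _ (Nat.not_even_iff_odd.1 h) (interleaved_of_odd a hi).ge)
  have key : ∀ k : ℕ, ∀ h : 2 * k < n + 1,
      (Even (interleaved a ⟨2 * k, h⟩) ↔ Even (interleaved a 0)) := by
    intro k
    induction k with
    | zero => intro h; rfl
    | succ k ih =>
      intro h
      have h1 := hodd ⟨2 * k + 1, by omega⟩ ⟨k, rfl⟩
      rw [← ih (by omega)]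
      have e1 : (⟨2 * k + 1, by omega⟩ : Fin (n + 1)) - 1 = ⟨2 * k, by omega⟩ := by
        ext
        rcases Fin.val_sub_one_cases (⟨2 * k + 1, by omega⟩ : Fin (n + 1)) with h | h
        · exact absurd (congrArg Fin.val h.1) (by simp)
        · rw [h.2]; simp
      have e2 : (⟨2 * k + 1, by omega⟩ : Fin (n + 1)) + 1 = ⟨2 * (k + 1), h⟩ := by
        ext
        rcases Fin.val_add_one_cases (⟨2 * k + 1, by omega⟩ : Fin (n + 1)) with h' | h'
        · exact absurd h'.1 (by simp only; omega)
        · rw [h'.2]; simp only; ring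
      rw [e1, e2, Nat.even_add] at h1
      exact h1.symm
  have hall : ∀ i : EvenIdx n, (Even (a i) ↔ Even (interleaved a 0)) := by
    rintro ⟨i, hi⟩
    rw [← interleaved_of_even a hi]
    obtain ⟨k, hk⟩ := hi
    have := key k (by omega)
    convert! this using 3
    ext
    simp only
    omega
  rcases Nat.even_or_odd (interleaved a 0) with h | h
  · exact Or.inl fun i => (hall i).2 h
  · exact Or.inr fun i => Nat.not_even_iff_odd.1 fun h' =>
      (Nat.not_even_iff_odd.2 h) ((hall i).1 h')

end Residue

/-! ### From the axioms to the functional equations: norms and resultants -/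

section AxiomsImplyFunctionalEquations

open Polynomial

/-- Both sides are the product of the values of f at the roots of p in an algebraic closure.
Separability makes these roots distinct, so they match the embeddings. -/
theorem Algebra.norm_mk_eq_resultant {F : Type*} [Field F] [PerfectField F] (p f : F[X])
    (hp : p.Monic) [hirr : Fact (Irreducible p)] :
    Algebra.norm F (AdjoinRoot.mk p f) = resultant p f := by
  have : FiniteDimensional F (AdjoinRoot p) := (AdjoinRoot.powerBasis hirr.1.ne_zero).finite
  set φ := algebraMap F (AlgebraicClosure F)
  apply φ.injective
  have hsplit : (p.map φ).Splits := IsAlgClosed.splits _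
  have hdeg : (p.map φ).natDegree = p.natDegree := natDegree_map _
  have h1 : φ (resultant p f) = ((p.map φ).roots.map (f.map φ).eval).prod := by
    have := resultant_eq_prod_eval (p.map φ) (f.map φ) f.natDegree natDegree_map_le hsplit
    rw [(hp.map _).leadingCoeff, one_pow, one_mul, hdeg, resultant_map_map] at this
    exact this
  have hnd : (p.map φ).roots.Nodup :=
    nodup_roots ((PerfectField.separable_of_irreducible hirr.1).map)
  classical
  rw [Algebra.norm_eq_prod_embeddings F (AlgebraicClosure F), h1]
  have h2 := Fintype.prod_equiv (AdjoinRoot.equiv (AlgebraicClosure F) F p hirr.1.ne_zero)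
    (fun σ => σ (AdjoinRoot.mk p f)) (fun x => (f.map φ).eval x.1) (fun σ => by
      have : (AdjoinRoot.equiv (AlgebraicClosure F) F p hirr.1.ne_zero σ : AlgebraicClosure F) =
        σ (AdjoinRoot.root p) := rfl
      rw [this, ← AdjoinRoot.aeval_eq, eval_map_algebraMap, ← aeval_algHom_apply])
  rw [h2, Finset.prod_mem_multiset _ _ (fun x => (f.map φ).eval x) (fun _ => rfl), Finset.prod_eq_multiset_prod, Multiset.toFinset_val,
    Multiset.dedup_eq_self.2 hnd]

/-- Euler's criterion in both fields: N(x) = x^{(|K|-1)/(|F|-1)}, hence N(x)^{(|F|-1)/2} =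
x^{(|K|-1)/2}. -/
theorem FiniteField.quadraticChar_norm {F K : Type*} [Field F] [Fintype F] [DecidableEq F]
    [Field K] [Fintype K] [DecidableEq K] [Algebra F K] (hF : ringChar F ≠ 2) (x : K) :
    quadraticChar F (Algebra.norm F x) = quadraticChar K x := by
  rcases eq_or_ne x 0 with rfl | hx
  · simp [Algebra.norm_zero]
  have hK : ringChar K ≠ 2 := by rwa [← Algebra.ringChar_eq F K]
  have hN : Algebra.norm F x ≠ 0 := (Algebra.norm_ne_zero_iff).2 hx
  have key : ((quadraticChar F (Algebra.norm F x) : ℤ) : K) = ((quadraticChar K x : ℤ) : K) := by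
    rw [quadraticChar_eq_pow_of_char_ne_two' hK]
    have := congrArg (algebraMap F K)
      (quadraticChar_eq_pow_of_char_ne_two' hF (Algebra.norm F x))
    rw [map_intCast, map_pow, FiniteField.algebraMap_norm_eq_pow, ← pow_mul] at this
    rw [this]
    congr 1
    have hq : 1 < Fintype.card F := Fintype.one_lt_card
    have hodd : Fintype.card F % 2 = 1 := FiniteField.odd_card_of_char_ne_two hF
    obtain ⟨m, hm⟩ : ∃ m, Fintype.card F = 2 * m + 1 := ⟨Fintype.card F / 2, by omega⟩
    have hdvd : Fintype.card F - 1 ∣ Fintype.card K - 1 := by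
      rw [Module.card_eq_pow_finrank (K := F) (V := K)]
      simpa using Nat.sub_dvd_pow_sub_pow (Fintype.card F) 1 (Module.finrank F K)
    obtain ⟨k, hk⟩ := hdvd
    have hKodd : Fintype.card K % 2 = 1 := FiniteField.odd_card_of_char_ne_two hK
    rw [Nat.card_eq_fintype_card, Nat.card_eq_fintype_card, hk,
      Nat.mul_div_cancel_left _ (by omega)]
    have h1 : Fintype.card F / 2 = m := by omega
    have h2 : Fintype.card K - 1 = 2 * (k * m) := by
      rw [hk, hm]; simp only [Nat.add_sub_cancel]; ring
    rw [h1]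
    omega
  rcases quadraticChar_dichotomy hN with h1 | h1 <;> rcases quadraticChar_dichotomy hx with h2 | h2
  · rw [h1, h2]
  · rw [h1, h2] at key
    exact absurd (by simpa using key.symm) (Ring.neg_one_ne_one_of_char_ne_two hK)
  · rw [h1, h2] at key
    exact absurd (by simpa using key) (Ring.neg_one_ne_one_of_char_ne_two hK)
  · rw [h1, h2]

theorem ringChar_ne_two_of_card_mod_four {F : Type*} [Field F] [Fintype F]
    (hF : Nat.card F % 4 = 1) : ringChar F ≠ 2 := by
  intro h
  have := FiniteField.even_card_of_char_two h
  rw [Nat.card_eq_fintype_card] at hF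
  omega

/-! ### The quadratic residue symbol and reciprocity -/

section Symbol

open scoped Classical

variable {F : Type} [Field F]

theorem AdjoinRoot.finite_of_monic [Finite F] {p : F[X]} (hp : p.Monic) :
    Finite (AdjoinRoot p) :=
  have := hp.finite_adjoinRoot
  Module.finite_of_finite F

theorem quadSymPrime_eq_quadraticChar (f p : F[X]) [hirr : Fact (Irreducible p)]
    [Fintype (AdjoinRoot p)] :
    quadSymPrime f p = quadraticChar (AdjoinRoot p) (AdjoinRoot.mk p f) := by
  have key : (∃ h : F[X], p ∣ f - h ^ 2) ↔ IsSquare (AdjoinRoot.mk p f) := by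
    rw [isSquare_iff_exists_sq]
    constructor
    · rintro ⟨h, hh⟩
      exact ⟨AdjoinRoot.mk p h, by rw [← map_pow]; exact AdjoinRoot.mk_eq_mk.2 hh⟩
    · rintro ⟨r, hr⟩
      obtain ⟨h, rfl⟩ := AdjoinRoot.mk_surjective r
      exact ⟨h, by rw [← map_pow] at hr; exact AdjoinRoot.mk_eq_mk.1 hr⟩
  simp only [quadSymPrime, quadraticChar_apply, quadraticCharFun, AdjoinRoot.mk_eq_zero, key]

theorem quadSymPrime_mul [Finite F] {p : F[X]} (hp : p.Monic) (hirr : Irreducible p)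
    (f g : F[X]) : quadSymPrime (f * g) p = quadSymPrime f p * quadSymPrime g p := by
  have : Fact (Irreducible p) := ⟨hirr⟩
  have := AdjoinRoot.finite_of_monic hp
  have := Fintype.ofFinite (AdjoinRoot p)
  simp only [quadSymPrime_eq_quadraticChar, map_mul]

theorem quadSymPrime_eq_resultant [Fintype F] (hF : ringChar F ≠ 2) {p : F[X]}
    (hp : p.Monic) (hirr : Irreducible p) (f : F[X]) :
    quadSymPrime f p = quadraticChar F (resultant p f) := by
  have : Fact (Irreducible p) := ⟨hirr⟩
  have := AdjoinRoot.finite_of_monic hp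
  have := Fintype.ofFinite (AdjoinRoot p)
  rw [quadSymPrime_eq_quadraticChar, ← FiniteField.quadraticChar_norm hF,
    Algebra.norm_mk_eq_resultant p f hp]

theorem quadSymPrime_congr {p f g : F[X]} (h : p ∣ f - g) :
    quadSymPrime f p = quadSymPrime g p := by
  have h1 : p ∣ f ↔ p ∣ g := (dvd_iff_dvd_of_dvd_sub h)
  have h2 : (∃ k : F[X], p ∣ f - k ^ 2) ↔ ∃ k : F[X], p ∣ g - k ^ 2 := by
    refine exists_congr fun k => dvd_iff_dvd_of_dvd_sub ?_
    simpa using h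
  unfold quadSymPrime
  congr 1
  · exact propext h1
  · congr 1
    exact propext h2

theorem quadSymPrime_eq_zero_iff {p f : F[X]} : quadSymPrime f p = 0 ↔ p ∣ f := by
  unfold quadSymPrime
  split_ifs <;> simp_all

theorem exists_quadSymPrime_eq_neg_one [Fintype F] (hF : ringChar F ≠ 2) {p : F[X]}
    (hp : p.Monic) (hirr : Irreducible p) : ∃ f, quadSymPrime f p = -1 := by
  have : Fact (Irreducible p) := ⟨hirr⟩
  have := AdjoinRoot.finite_of_monic hp
  have := Fintype.ofFinite (AdjoinRoot p)
  obtain ⟨x, hx⟩ := quadraticChar_exists_neg_one (F := AdjoinRoot p)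
    (by rwa [← Algebra.ringChar_eq F (AdjoinRoot p)])
  obtain ⟨f, rfl⟩ := AdjoinRoot.mk_surjective x
  exact ⟨f, by rw [quadSymPrime_eq_quadraticChar, hx]⟩

open UniqueFactorizationMonoid in
theorem monic_irreducible_of_mem_normalizedFactors {g p : F[X]} (h : p ∈ normalizedFactors g) :
    p.Monic ∧ Irreducible p := by
  have hirr := irreducible_of_normalized_factor p h
  refine ⟨?_, hirr⟩
  rw [← normalize_normalized_factor p h]
  exact monic_normalize hirr.ne_zero

open UniqueFactorizationMonoid in
theorem prod_normalizedFactors_of_monic {g : F[X]} (hg : g.Monic) :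
    (normalizedFactors g).prod = g := by
  rw [prod_normalizedFactors_eq hg.ne_zero, hg.normalize_eq_self]

@[simp]
theorem quadSym_one_right (f : F[X]) : quadSym f 1 = 1 := by
  simp [quadSym]

theorem quadSym_mul_right (f : F[X]) {g h : F[X]} (hg : g ≠ 0) (hh : h ≠ 0) :
    quadSym f (g * h) = quadSym f g * quadSym f h := by
  rw [quadSym, UniqueFactorizationMonoid.normalizedFactors_mul hg hh, Multiset.map_add,
    Multiset.prod_add]
  rfl

theorem quadSym_of_irreducible (f : F[X]) {p : F[X]} (hp : p.Monic) (hirr : Irreducible p) :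
    quadSym f p = quadSymPrime f p := by
  rw [quadSym, UniqueFactorizationMonoid.normalizedFactors_irreducible hirr,
    hp.normalize_eq_self]
  simp

theorem quadSym_mul_left [Finite F] (f g h : F[X]) :
    quadSym (f * g) h = quadSym f h * quadSym g h := by
  simp only [quadSym]
  rw [← Multiset.prod_map_mul]
  congr 1
  refine Multiset.map_congr rfl fun p hp => ?_
  obtain ⟨h1, h2⟩ := monic_irreducible_of_mem_normalizedFactors hp
  exact quadSymPrime_mul h1 h2 f g

theorem quadSym_congr {f g h : F[X]} (hfg : h ∣ f - g) : quadSym f h = quadSym g h := by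
  simp only [quadSym]
  congr 1
  refine Multiset.map_congr rfl fun p hp => quadSymPrime_congr ?_
  exact (UniqueFactorizationMonoid.dvd_of_mem_normalizedFactors hp).trans hfg

theorem quadSym_eq_zero_iff {f g : F[X]} (hg : g ≠ 0) :
    quadSym f g = 0 ↔ ¬ IsCoprime f g := by
  rw [quadSym, Multiset.prod_eq_zero_iff, Multiset.mem_map]
  constructor
  · rintro ⟨p, hp, h0⟩ hc
    have h1 := quadSymPrime_eq_zero_iff.1 h0
    have h2 := UniqueFactorizationMonoid.dvd_of_mem_normalizedFactors hp
    exact (monic_irreducible_of_mem_normalizedFactors hp).2.not_isUnit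
      (hc.isUnit_of_dvd' h1 h2)
  · intro hc
    obtain ⟨p, hp, h1, h2⟩ : ∃ p, Irreducible p ∧ p ∣ f ∧ p ∣ g := by
      by_contra! h
      refine hc (isCoprime_of_irreducible_dvd (fun h' => hg h'.2) fun p hp h1 => h p hp h1)
    obtain ⟨r, hr, hpr⟩ := UniqueFactorizationMonoid.exists_mem_normalizedFactors_of_dvd hg hp h2
    exact ⟨r, hr, quadSymPrime_eq_zero_iff.2 (hpr.dvd_iff_dvd_left.1 h1)⟩

theorem quadSym_zero_left {E : F[X]} (hE : E.Monic) (hd : E.natDegree ≠ 0) : quadSym 0 E = 0 := by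
  rw [quadSym_eq_zero_iff hE.ne_zero, isCoprime_zero_left]
  exact fun h => hd (natDegree_eq_zero_of_isUnit h)

theorem quadSym_one_left [Finite F] {g : F[X]} (hg : g ≠ 0) : quadSym 1 g = 1 := by
  have h := quadSym_mul_left 1 1 g
  rw [mul_one] at h
  exact (mul_eq_left₀ (mt (quadSym_eq_zero_iff hg).1 (not_not.2 isCoprime_one_left))).1 h.symm

theorem quadSym_sq {f g : F[X]} (hg : g ≠ 0) (h : IsCoprime f g) : quadSym f g ^ 2 = 1 := by
  have h0 : quadSym f g ≠ 0 := mt (quadSym_eq_zero_iff hg).1 (not_not.2 h)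
  rw [quadSym, ← Multiset.prod_map_pow]
  refine Multiset.prod_eq_one fun x hx => ?_
  obtain ⟨p, hp, rfl⟩ := Multiset.mem_map.1 hx
  have : quadSymPrime f p ≠ 0 := fun h' => h0 (Multiset.prod_eq_zero (Multiset.mem_map.2 ⟨p, hp, h'⟩))
  revert this
  unfold quadSymPrime
  split_ifs <;> simp

theorem quadSym_pow_left [Finite F] (f : F[X]) {g : F[X]} (hg : g ≠ 0) (k : ℕ) :
    quadSym (f ^ k) g = quadSym f g ^ k := by
  induction k with
  | zero => simp [quadSym_one_left hg]
  | succ k ih => rw [pow_succ, quadSym_mul_left, ih, pow_succ]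

theorem quadSym_pow_right (f : F[X]) {g : F[X]} (hg : g ≠ 0) (k : ℕ) :
    quadSym f (g ^ k) = quadSym f g ^ k := by
  induction k with
  | zero => simp
  | succ k ih => rw [pow_succ, quadSym_mul_right f (pow_ne_zero k hg) hg, ih, pow_succ]

/-- Both sides are multiplicative in g, and for g prime this is the norm formula in the residue
field. -/
theorem quadSym_eq_resultant [Fintype F] (hF : ringChar F ≠ 2) {g : F[X]}
    (hg : g.Monic) (f : F[X]) : quadSym f g = quadraticChar F (resultant g f) := by
  have key : ∀ s : Multiset F[X], (∀ p ∈ s, p.Monic ∧ Irreducible p) →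
      s.prod.Monic ∧ (s.map (quadSymPrime f)).prod = quadraticChar F (resultant s.prod f) := by
    intro s
    induction s using Multiset.induction_on with
    | empty => simp
    | cons p s ih =>
      intro hs
      obtain ⟨h1, h2⟩ := ih fun r hr => hs r (Multiset.mem_cons_of_mem hr)
      obtain ⟨h3, h4⟩ := hs p (Multiset.mem_cons_self p s)
      rw [Multiset.prod_cons, Multiset.map_cons, Multiset.prod_cons]
      refine ⟨h3.mul h1, ?_⟩
      rw [h2, h3.natDegree_mul h1, resultant_mul_left _ _ _ _ le_rfl, map_mul,
        quadSymPrime_eq_resultant hF h3 h4]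
  have := (key (UniqueFactorizationMonoid.normalizedFactors g)
    fun p hp => monic_irreducible_of_mem_normalizedFactors hp).2
  rw [prod_normalizedFactors_of_monic hg] at this
  exact this

/-- Exchanging the arguments of the resultant costs a power of -1, and -1 is a square because |F| ≡
1 mod 4. -/
theorem quadSym_comm [Finite F] (hF : Nat.card F % 4 = 1) {f g : F[X]} (hf : f.Monic)
    (hg : g.Monic) : quadSym f g = quadSym g f := by
  have := Fintype.ofFinite F
  have hF' := ringChar_ne_two_of_card_mod_four hF
  rw [quadSym_eq_resultant hF' hg, quadSym_eq_resultant hF' hf, resultant_comm, map_mul, map_pow]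
  have : quadraticChar F (-1) = 1 := by
    rw [quadraticChar_one_iff_isSquare (by simp), FiniteField.isSquare_neg_one_iff,
      ← Nat.card_eq_fintype_card]
    omega
  rw [this, one_pow, one_mul]

theorem quadSym_C [Fintype F] (hF : ringChar F ≠ 2) {g : F[X]}
    (hg : g.Monic) (c : F) : quadSym (C c) g = quadraticChar F c ^ g.natDegree := by
  rw [quadSym_eq_resultant hF hg, ← map_pow]
  simp [natDegree_C]

/-- Some prime p divides both y and E. Changing 1 to a nonresidue modulo p alone is invisible after
multiplication by y, and squarefreeness makes p coprime to E/p. -/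
theorem exists_quadSym_eq_neg_one [Finite F] (hF : Nat.card F % 4 = 1) {E y : F[X]}
    (hE : E.Monic) (hsq : Squarefree E) (hy : ¬ IsCoprime y E) :
    ∃ z, E ∣ (z - 1) * y ∧ quadSym z E = -1 := by
  have := Fintype.ofFinite F
  have hF' := ringChar_ne_two_of_card_mod_four hF
  obtain ⟨p, hp, h0⟩ := Multiset.mem_map.1 (Multiset.prod_eq_zero_iff.1
    ((quadSym_eq_zero_iff hE.ne_zero).2 hy))
  obtain ⟨hpm, hirr⟩ := monic_irreducible_of_mem_normalizedFactors hp
  obtain ⟨E', rfl⟩ := UniqueFactorizationMonoid.dvd_of_mem_normalizedFactors hp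
  have hE'0 : E' ≠ 0 := right_ne_zero_of_mul hE.ne_zero
  have hc : IsCoprime p E' := by
    rw [hirr.coprime_iff_not_dvd]
    rintro ⟨d, rfl⟩
    exact hirr.not_isUnit (hsq p ⟨d, by ring⟩)
  obtain ⟨u, v, huv⟩ := hc
  obtain ⟨w, hw⟩ := exists_quadSymPrime_eq_neg_one hF' hpm hirr
  -- Since u p + v E' = 1, this element is 1 modulo E' and w modulo p.
  refine ⟨1 + v * E' * (w - 1), ?_, ?_⟩
  · obtain ⟨t, ht⟩ := quadSymPrime_eq_zero_iff.1 h0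
    exact ⟨v * (w - 1) * t, by rw [ht]; ring⟩
  · rw [quadSym_mul_right _ hpm.ne_zero hE'0, quadSym_of_irreducible _ hpm hirr,
      quadSymPrime_congr (g := w), hw, quadSym_congr (g := 1), quadSym_one_left hE'0, mul_one]
    · exact ⟨v * (w - 1), by ring⟩
    · exact ⟨-u * (w - 1), by linear_combination (w - 1) * huv⟩

end Symbol

/-! ### Finite sets of polynomials of given degree -/

section FiniteSets

variable (F : Type) [Field F] [Finite F]

theorem finite_degree_lt (d : ℕ) : {x : F[X] | x.degree < d}.Finite := by
  have : Finite (degreeLT F d) := Finite.of_equiv _ (degreeLTEquiv F d).symm.toEquiv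
  refine (Set.toFinite (degreeLT F d : Set F[X])).subset fun x hx => ?_
  exact mem_degreeLT.2 hx

/-- The polynomials of degree less than `d` over a finite field. -/
noncomputable def lowDegree (d : ℕ) : Finset F[X] := (finite_degree_lt F d).toFinset

variable {F}

@[simp]
theorem mem_lowDegree {d : ℕ} {x : F[X]} : x ∈ lowDegree F d ↔ x.degree < d := by
  simp [lowDegree]

variable (F) in
/-- The monic polynomials of degree `k` over a finite field. -/
noncomputable def monics (k : ℕ) : Finset F[X] :=
  (lowDegree F k).map (addLeftEmbedding (X ^ k))

@[simp]
theorem mem_monics {k : ℕ} {g : F[X]} : g ∈ monics F k ↔ g.Monic ∧ g.natDegree = k := by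
  simp only [monics, Finset.mem_map, mem_lowDegree, addLeftEmbedding_apply]
  constructor
  · rintro ⟨y, hy, rfl⟩
    refine ⟨monic_X_pow_add hy, ?_⟩
    rw [natDegree_add_eq_left_of_degree_lt (by simpa using hy), natDegree_X_pow]
  · rintro ⟨hg, rfl⟩
    refine ⟨g - X ^ g.natDegree, ?_, by ring⟩
    rw [← degree_eq_natDegree hg.ne_zero]
    exact degree_sub_lt_left (by simp [degree_eq_natDegree hg.ne_zero]) hg.ne_zero (by simp [hg.leadingCoeff])

theorem sum_monics {M : Type*} [AddCommMonoid M] (k : ℕ) (f : F[X] → M) :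
    ∑ g ∈ monics F k, f g = ∑ y ∈ lowDegree F k, f (X ^ k + y) := by
  simp [monics]

theorem lowDegree_zero : lowDegree F 0 = {0} := by
  ext x
  rw [mem_lowDegree, Finset.mem_singleton, degree_lt_iff_coeff_zero]
  exact ⟨fun h => ext fun m => h m (Nat.zero_le m), fun h => by simp [h]⟩

theorem sum_lowDegree_succ {M : Type*} [AddCommMonoid M] [Fintype F] (d : ℕ) (f : F[X] → M) :
    ∑ x ∈ lowDegree F (d + 1), f x = ∑ c : F, ∑ y ∈ lowDegree F d, f (C c * X ^ d + y) := by
  rw [← Finset.sum_product']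
  refine Finset.sum_nbij' (fun x => (x.coeff d, x - C (x.coeff d) * X ^ d))
    (fun p => C p.1 * X ^ d + p.2) ?_ ?_ ?_ ?_ ?_
  · intro x hx
    rw [mem_lowDegree, degree_lt_iff_coeff_zero] at hx
    simp only [Finset.mem_product, Finset.mem_univ, true_and, mem_lowDegree]
    rw [degree_lt_iff_coeff_zero]
    intro m hm
    rw [coeff_sub, coeff_C_mul_X_pow]
    split_ifs with h
    · rw [h, sub_self]
    · rw [hx m (by omega), sub_zero]
  · rintro ⟨c, y⟩ h
    simp only [Finset.mem_product, Finset.mem_univ, true_and, mem_lowDegree] at h ⊢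
    rw [degree_lt_iff_coeff_zero] at h ⊢
    intro m hm
    rw [coeff_add, coeff_C_mul_X_pow, if_neg (by omega), h m (by omega), add_zero]
  · intro x _
    simp
  · rintro ⟨c, y⟩ h
    simp only [Finset.mem_product, Finset.mem_univ, true_and, mem_lowDegree] at h
    have : y.coeff d = 0 := coeff_eq_zero_of_degree_lt h
    simp [this]
  · intro x _
    simp

theorem sum_lowDegree_succ' {M : Type*} [AddCommMonoid M] [Fintype F] (d : ℕ) (f : F[X] → M) :
    ∑ x ∈ lowDegree F (d + 1), f x = ∑ c : F, ∑ y ∈ lowDegree F d, f (C c + X * y) := by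
  rw [← Finset.sum_product']
  have hdeg : ∀ (c : F) (y : F[X]), (C c + X * y).degree < ((d + 1 : ℕ) : WithBot ℕ) ↔
      y.degree < (d : WithBot ℕ) := by
    intro c y
    rw [degree_lt_iff_coeff_zero, degree_lt_iff_coeff_zero]
    constructor
    · intro h m hm
      simpa [coeff_C] using h (m + 1) (by omega)
    · intro h m hm
      obtain ⟨m, rfl⟩ : ∃ m', m = m' + 1 := ⟨m - 1, by omega⟩
      simpa [coeff_C] using h m (by omega)
  refine Finset.sum_nbij' (fun x => (x.coeff 0, x.divX))
    (fun p => C p.1 + X * p.2) ?_ ?_ ?_ ?_ ?_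
  · intro x hx
    simp only [Finset.mem_product, Finset.mem_univ, true_and, mem_lowDegree] at hx ⊢
    rw [← hdeg (x.coeff 0), add_comm, X_mul_divX_add]
    exact hx
  · rintro ⟨c, y⟩ h
    simp only [Finset.mem_product, Finset.mem_univ, true_and, mem_lowDegree] at h ⊢
    exact (hdeg c y).2 h
  · intro x _
    simp only
    rw [add_comm, X_mul_divX_add]
  · rintro ⟨c, y⟩ _
    simp only [Prod.mk.injEq]
    refine ⟨by simp, ?_⟩
    ext m
    simp [coeff_divX]
  · intro x _
    simp only
    rw [add_comm, X_mul_divX_add]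

theorem card_lowDegree (d : ℕ) : (lowDegree F d).card = Nat.card F ^ d := by
  have := Fintype.ofFinite F
  induction d with
  | zero => simp [lowDegree_zero]
  | succ d ih =>
    rw [Finset.card_eq_sum_ones, sum_lowDegree_succ]
    simp [ih, pow_succ, mul_comm]

theorem card_monics (k : ℕ) : (monics F k).card = Nat.card F ^ k := by
  rw [monics, Finset.card_map, card_lowDegree]

end FiniteSets

/-! ### Gauss sums over the finite field and Hankel forms -/

section GaussSums

/-- An element a has 1 + χ(a) square roots, and the contribution of the 1 vanishes by `he`. -/
theorem sum_sq_eq_sum_quadraticChar {K : Type*} [Field K] [Fintype K] [DecidableEq K]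
    (hK : ringChar K ≠ 2) (e : K → ℂ) (he : ∑ x, e x = 0) :
    ∑ x, e (x ^ 2) = ∑ x, (quadraticChar K x : ℂ) * e x := by
  have h1 : ∑ x, e (x ^ 2) = ∑ a, ∑ x with x ^ 2 = a, e a := by
    rw [← Finset.sum_fiberwise (Finset.univ) (fun x : K => x ^ 2)]
    refine Finset.sum_congr rfl fun a _ => Finset.sum_congr rfl fun x hx => ?_
    rw [(Finset.mem_filter.1 hx).2]
  have h2 : ∀ a : K, ∑ x with x ^ 2 = a, e a = (quadraticChar K a : ℂ) * e a + e a := by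
    intro a
    have := quadraticChar_card_sqrts hK a
    rw [Finset.sum_const, nsmul_eq_mul, ← add_one_mul]
    congr 1
    rw [Set.toFinset_ofPred] at this
    exact_mod_cast this
  rw [h1, Finset.sum_congr rfl fun a _ => h2 a, Finset.sum_add_distrib, he, add_zero]

variable {F : Type} [Field F] [Fintype F] {ψ : AddChar F ℂ}

theorem AddChar.sum_mul_eq_ite [DecidableEq F] (hψ : ψ.IsPrimitive) (a : F) :
    ∑ c, ψ (c * a) = if a = 0 then (Nat.card F : ℂ) else 0 := by
  rw [AddChar.sum_mulShift a hψ, Nat.card_eq_fintype_card]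
  simp

open scoped Classical in
theorem gaussSum_quadraticChar_sq (hF : Nat.card F % 4 = 1) (hψ : ψ.IsPrimitive) :
    (∑ c, ψ (c ^ 2)) ^ 2 = Nat.card F := by
  have hF' := ringChar_ne_two_of_card_mod_four hF
  have hψ1 : ∑ x, ψ x = 0 := by simpa using AddChar.sum_mul_eq_ite hψ 1
  rw [sum_sq_eq_sum_quadraticChar hF' ψ hψ1]
  have hχ : ((quadraticChar F).ringHomComp (Int.castRingHom ℂ)) ≠ 1 :=
    (MulChar.ringHomComp_ne_one_iff Int.cast_injective).2 (quadraticChar_ne_one hF')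
  have := gaussSum_sq hχ ((quadraticChar_isQuadratic F).comp _) hψ
  rw [gaussSum] at this
  simp only [MulChar.ringHomComp_apply, eq_intCast] at this
  rw [this, Nat.card_eq_fintype_card]
  have : quadraticChar F (-1) = 1 := by
    rw [quadraticChar_one_iff_isSquare (by simp), FiniteField.isSquare_neg_one_iff,
      ← Nat.card_eq_fintype_card]
    omega
  rw [this]
  simp

/-- The Gauss sum of a Hankel form whose matrix is triangular with respect to the antidiagonal. -/
theorem sum_hankel (hF : Nat.card F % 4 = 1) (hψ : ψ.IsPrimitive) (d : ℕ) (Λ : F[X] →ₗ[F] F)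
    (h0 : ∀ k, k + 1 < d → Λ (X ^ k) = 0) (h1 : ∀ k, k + 1 = d → Λ (X ^ k) = 1) :
    ∑ x ∈ lowDegree F d, ψ (Λ (x ^ 2)) = (∑ c, ψ (c ^ 2)) ^ d := by
  induction d using Nat.twoStepInduction generalizing Λ with
  | zero => simp [lowDegree_zero]
  | one =>
    rw [sum_lowDegree_succ]
    have h : ∀ c : F, Λ (C c ^ 2) = c ^ 2 := fun c => by
      rw [← C_pow, ← mul_one (C (c ^ 2)), ← smul_eq_C_mul, map_smul, ← pow_zero X, h1 0 rfl]
      simp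
    simp [lowDegree_zero, h]
  | more d ih _ =>
    classical
    have hlow : ∀ y : F[X], y.degree < ((d + 1 : ℕ) : WithBot ℕ) → Λ y = 0 := by
      intro y hy
      rw [as_sum_range' y (d + 1) (by
        by_cases h : y = 0
        · simp [h]
        · exact (natDegree_lt_iff_degree_lt h).2 hy), map_sum]
      refine Finset.sum_eq_zero fun k hk => ?_
      rw [← C_mul_X_pow_eq_monomial, ← smul_eq_C_mul, map_smul,
        h0 k (by have := Finset.mem_range.1 hk; omega), smul_zero]
    have hval : ∀ (a c : F) (y : F[X]), y ∈ lowDegree F d →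
        Λ ((C a + X * (C c * X ^ d + y)) ^ 2) =
          a * (2 * c) + Λ ((X * (C c * X ^ d + y)) ^ 2) := by
      intro a c y hy
      have e1 : (C a + X * (C c * X ^ d + y)) ^ 2 =
          (C (a ^ 2) + C (2 * a) * (X * y)) + (a * (2 * c)) • X ^ (d + 1) +
            (X * (C c * X ^ d + y)) ^ 2 := by
        rw [smul_eq_C_mul]
        simp only [C_mul, C_pow, map_ofNat]
        ring
      rw [e1, map_add, map_add, map_smul, h1 (d + 1) rfl, hlow, zero_add, smul_eq_mul, mul_one]
      rw [mem_lowDegree, degree_lt_iff_coeff_zero] at hy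
      rw [degree_lt_iff_coeff_zero]
      intro m hm
      obtain ⟨m, rfl⟩ : ∃ m', m = m' + 1 := ⟨m - 1, by omega⟩
      simp only [coeff_add, coeff_C_succ, coeff_C_mul, coeff_X_mul, hy m (by omega), mul_zero,
        add_zero]
    rw [sum_lowDegree_succ']
    simp_rw [sum_lowDegree_succ]
    have e2 : ∑ a : F, ∑ c : F, ∑ y ∈ lowDegree F d,
        ψ (Λ ((C a + X * (C c * X ^ d + y)) ^ 2)) =
        ∑ c : F, ∑ y ∈ lowDegree F d, (∑ a : F, ψ (a * (2 * c))) *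
          ψ (Λ ((X * (C c * X ^ d + y)) ^ 2)) := by
      rw [Finset.sum_comm]
      refine Finset.sum_congr rfl fun c _ => ?_
      rw [Finset.sum_comm]
      refine Finset.sum_congr rfl fun y hy => ?_
      rw [Finset.sum_mul]
      refine Finset.sum_congr rfl fun a _ => ?_
      rw [hval a c y hy, AddChar.map_add_eq_mul]
    have h2 : (2 : F) ≠ 0 := Ring.two_ne_zero (ringChar_ne_two_of_card_mod_four hF)
    -- The constant coefficient a enters only through the cross term 2ac with the top coefficient c,
    -- so the sum over a vanishes unless c = 0 and is |F| = g^2 for c = 0.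
    rw [e2, Finset.sum_eq_single_of_mem (0 : F) (Finset.mem_univ _)]
    · have h3 : ∑ a : F, ψ (a * (2 * 0)) = (∑ c, ψ (c ^ 2)) ^ 2 := by
        rw [AddChar.sum_mul_eq_ite hψ, if_pos (mul_zero _), gaussSum_quadraticChar_sq hF hψ]
      simp only [h3, C_0, zero_mul, zero_add]
      rw [← Finset.mul_sum]
      -- With both end coefficients removed, the remaining form is y ↦ Λ(X^2 y^2), which has the
      -- same antitriangular shape with d in place of d + 2.
      have := ih (Λ ∘ₗ LinearMap.mulLeft F (X ^ 2)) (fun k hk => by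
          simp only [LinearMap.comp_apply, LinearMap.mulLeft_apply, ← pow_add]
          exact h0 _ (by omega)) (fun k hk => by
          simp only [LinearMap.comp_apply, LinearMap.mulLeft_apply, ← pow_add]
          exact h1 _ (by omega))
      simp only [LinearMap.comp_apply, LinearMap.mulLeft_apply, ← mul_pow] at this
      rw [this, ← pow_add, add_comm]
    · intro c _ hc
      refine Finset.sum_eq_zero fun y _ => ?_
      rw [AddChar.sum_mul_eq_ite hψ, if_neg (mul_ne_zero h2 hc), zero_mul]

end GaussSums

/-! ### Gauss sums modulo a squarefree polynomial -/

section PolynomialGaussSums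

variable {F : Type} [Field F] {ψ : AddChar F ℂ} {E : F[X]}

variable (ψ E) in
/-- The additive character `x ↦ ψ(res_∞(x / E))` of polynomials modulo `E`. -/
noncomputable def residueChar (x : F[X]) : ℂ := ψ ((x %ₘ E).coeff (E.natDegree - 1))

theorem residueChar_add (x y : F[X]) :
    residueChar ψ E (x + y) = residueChar ψ E x * residueChar ψ E y := by
  rw [residueChar, add_modByMonic, coeff_add, AddChar.map_add_eq_mul]
  rfl

theorem residueChar_congr (hE : E.Monic) {x y : F[X]} (h : E ∣ x - y) :
    residueChar ψ E x = residueChar ψ E y := by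
  rw [residueChar, residueChar, (modByMonic_eq_of_dvd_sub hE h)]

theorem residueChar_of_degree_lt (hE : E.Monic) {x : F[X]}
    (hx : x.degree < (E.natDegree : WithBot ℕ)) :
    residueChar ψ E x = ψ (x.coeff (E.natDegree - 1)) := by
  rw [residueChar, (modByMonic_eq_self_iff hE).2]
  rwa [degree_eq_natDegree hE.ne_zero]

theorem dvd_modByMonic_sub (hE : E.Monic) (x : F[X]) : E ∣ x %ₘ E - x := by
  rw [← modByMonic_eq_zero_iff_dvd hE, sub_modByMonic, sub_eq_zero]
  exact (modByMonic_eq_self_iff hE).2 (degree_modByMonic_lt _ hE)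

variable [Fintype F]

/-- A unit modulo E permutes the reduced residues. -/
theorem sum_lowDegree_mul_modByMonic (hE : E.Monic) {y : F[X]} (hy : IsCoprime y E)
    (f : F[X] → ℂ) :
    ∑ x ∈ lowDegree F E.natDegree, f ((x * y) %ₘ E) = ∑ x ∈ lowDegree F E.natDegree, f x := by
  have hmaps : Set.MapsTo (fun x => (x * y) %ₘ E) (lowDegree F E.natDegree : Set F[X])
      (lowDegree F E.natDegree) := fun x _ => by
    simp only [SetLike.mem_coe, mem_lowDegree]
    rw [← degree_eq_natDegree hE.ne_zero]
    exact degree_modByMonic_lt _ hE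
  have hinj : Set.InjOn (fun x => (x * y) %ₘ E) (lowDegree F E.natDegree : Set F[X]) := by
    intro a ha b hb hab
    simp only [SetLike.mem_coe, mem_lowDegree, ← degree_eq_natDegree hE.ne_zero] at ha hb hab
    have h1 : E ∣ (a - b) * y := by
      rw [sub_mul, ← modByMonic_eq_zero_iff_dvd hE, sub_modByMonic, hab, sub_self]
    have h2 : E ∣ a - b := hy.symm.dvd_of_dvd_mul_right h1
    exact sub_eq_zero.1 (eq_zero_of_dvd_of_degree_lt h2
      ((degree_sub_le a b).trans_lt (max_lt ha hb)))
  exact Finset.sum_nbij _ hmaps hinj (Finset.surjOn_of_injOn_of_card_le _ hmaps hinj le_rfl)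
    fun _ _ => rfl

variable (ψ E) in
/-- The Gauss sum of the quadratic character modulo `E`. -/
noncomputable def polyGaussSum : ℂ :=
  ∑ x ∈ lowDegree F E.natDegree, (quadSym x E : ℂ) * ψ (x.coeff (E.natDegree - 1))

/-- For y coprime to E, substitute x ↦ x y. Otherwise take z with χ(z) = -1 and z y ≡ y modulo E:
the substitution x ↦ x z negates the sum, so it is 0, as is the symbol of y. Squarefreeness of E
provides z. -/
theorem sum_quadSym_mul_residueChar (hF : Nat.card F % 4 = 1) (hE : E.Monic)
    (hsq : Squarefree E) (y : F[X]) :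
    ∑ x ∈ lowDegree F E.natDegree, (quadSym x E : ℂ) * residueChar ψ E (x * y) =
      quadSym y E * polyGaussSum ψ E := by
  have hsub : ∀ z, IsCoprime z E → ∑ x ∈ lowDegree F E.natDegree,
      (quadSym (x * z) E : ℂ) * residueChar ψ E (x * z * y) =
      ∑ x ∈ lowDegree F E.natDegree, (quadSym x E : ℂ) * residueChar ψ E (x * y) := by
    intro z hz
    rw [← sum_lowDegree_mul_modByMonic hE hz
      (fun x => (quadSym x E : ℂ) * residueChar ψ E (x * y))]
    refine Finset.sum_congr rfl fun x _ => ?_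
    rw [quadSym_congr (dvd_modByMonic_sub hE (x * z)), residueChar_congr hE
      (x := (x * z) %ₘ E * y) (y := x * z * y)]
    rw [← sub_mul]
    exact (dvd_modByMonic_sub hE (x * z)).mul_right y
  by_cases hy : IsCoprime y E
  · have h1 : (quadSym y E : ℂ) * ∑ x ∈ lowDegree F E.natDegree,
        (quadSym x E : ℂ) * residueChar ψ E (x * y) = polyGaussSum ψ E := by
      rw [polyGaussSum, ← sum_lowDegree_mul_modByMonic hE hy
        (fun x => (quadSym x E : ℂ) * ψ (x.coeff (E.natDegree - 1))), Finset.mul_sum]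
      refine Finset.sum_congr rfl fun x _ => ?_
      rw [quadSym_congr (dvd_modByMonic_sub hE (x * y)), quadSym_mul_left, residueChar]
      push_cast
      ring
    have h2 : (quadSym y E : ℂ) ^ 2 = 1 := by exact_mod_cast quadSym_sq hE.ne_zero hy
    rw [← h1, ← mul_assoc, ← sq, h2, one_mul]
  · obtain ⟨z, hz, hz1⟩ := exists_quadSym_eq_neg_one hF hE hsq hy
    have hzc : IsCoprime z E := by
      by_contra h
      rw [(quadSym_eq_zero_iff hE.ne_zero).2 h] at hz1
      norm_num at hz1
    have h1 := hsub z hzc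
    have h2 : ∀ x, residueChar ψ E (x * z * y) = residueChar ψ E (x * y) := fun x =>
      residueChar_congr hE (by
        obtain ⟨t, ht⟩ := hz
        exact ⟨x * t, by linear_combination x * ht⟩)
    simp only [quadSym_mul_left, hz1, h2] at h1
    rw [(quadSym_eq_zero_iff hE.ne_zero).2 hy]
    push_cast at h1 ⊢
    rw [zero_mul]
    simp only [mul_neg, mul_one, neg_mul, Finset.sum_neg_distrib] at h1
    linear_combination -(1 / 2 : ℂ) * h1

theorem sum_lowDegree_char (hψ : ψ.IsPrimitive) {d : ℕ} (hd : d ≠ 0) :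
    ∑ x ∈ lowDegree F d, ψ (x.coeff (d - 1)) = 0 := by
  classical
  obtain ⟨d, rfl⟩ := Nat.exists_eq_succ_of_ne_zero hd
  rw [Nat.succ_eq_add_one, sum_lowDegree_succ, Finset.sum_comm]
  refine Finset.sum_eq_zero fun y hy => ?_
  rw [mem_lowDegree] at hy
  simpa [coeff_eq_zero_of_degree_lt hy] using AddChar.sum_mul_eq_ite hψ 1

/-- In the residue field the Gauss sum equals the sum of the additive character over squares. Its
quadratic form is Hankel, and the functional reading off the top coefficient vanishes on X^k for k +
1 < deg E, so `sum_hankel` evaluates it. -/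
theorem polyGaussSum_of_irreducible (hF : Nat.card F % 4 = 1) (hψ : ψ.IsPrimitive)
    (hE : E.Monic) (hirr : Irreducible E) :
    polyGaussSum ψ E = (∑ c, ψ (c ^ 2)) ^ E.natDegree := by
  have : Fact (Irreducible E) := ⟨hirr⟩
  have := AdjoinRoot.finite_of_monic hE
  have := Fintype.ofFinite (AdjoinRoot E)
  have hd : E.natDegree ≠ 0 := hirr.natDegree_pos.ne'
  classical
  have hK : ringChar (AdjoinRoot E) ≠ 2 := by
    rw [← Algebra.ringChar_eq F (AdjoinRoot E)]
    exact ringChar_ne_two_of_card_mod_four hF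
  have hmod : ∀ x ∈ lowDegree F E.natDegree, x %ₘ E = x := fun x hx => by
    rw [modByMonic_eq_self_iff hE, degree_eq_natDegree hE.ne_zero]
    exact mem_lowDegree.1 hx
  have htrans : ∀ f : AdjoinRoot E → ℂ,
      ∑ x ∈ lowDegree F E.natDegree, f (AdjoinRoot.mk E x) = ∑ k, f k := by
    intro f
    refine Finset.sum_nbij' (AdjoinRoot.mk E) (AdjoinRoot.modByMonicHom hE)
      (fun _ _ => Finset.mem_univ _) ?_ ?_ ?_ (fun _ _ => rfl)
    · intro k _
      obtain ⟨x, rfl⟩ := AdjoinRoot.mk_surjective k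
      rw [AdjoinRoot.modByMonicHom_mk, mem_lowDegree, ← degree_eq_natDegree hE.ne_zero]
      exact degree_modByMonic_lt _ hE
    · intro x hx
      rw [AdjoinRoot.modByMonicHom_mk, hmod x hx]
    · intro k _
      exact AdjoinRoot.mk_leftInverse hE k
  set e : AdjoinRoot E → ℂ :=
    fun k => ψ ((AdjoinRoot.modByMonicHom hE k).coeff (E.natDegree - 1)) with he
  have he0 : ∑ k, e k = 0 := by
    rw [← htrans e, ← sum_lowDegree_char hψ hd]
    refine Finset.sum_congr rfl fun x hx => ?_
    rw [he]
    simp only [AdjoinRoot.modByMonicHom_mk, hmod x hx]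
  have h1 := sum_sq_eq_sum_quadraticChar hK e he0
  rw [← htrans, ← htrans] at h1
  have h2 := sum_hankel hF hψ E.natDegree
    (lcoeff F (E.natDegree - 1) ∘ₗ modByMonicHom E) (fun k hk => by
      simp only [LinearMap.comp_apply, modByMonicHom_apply, lcoeff_apply]
      rw [hmod _ (by rw [mem_lowDegree, degree_X_pow]; exact_mod_cast (by omega)),
        coeff_X_pow, if_neg (by omega)])
    (fun k hk => by
      simp only [LinearMap.comp_apply, modByMonicHom_apply, lcoeff_apply]
      rw [hmod _ (by rw [mem_lowDegree, degree_X_pow]; exact_mod_cast (by omega)),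
        coeff_X_pow, if_pos (by omega)])
  rw [← h2, polyGaussSum]
  refine Eq.trans (Finset.sum_congr rfl fun x hx => ?_) (h1.symm.trans
    (Finset.sum_congr rfl fun x _ => ?_))
  · rw [quadSym_of_irreducible x hE hirr, quadSymPrime_eq_quadraticChar]
    simp only [he, AdjoinRoot.modByMonicHom_mk, hmod x hx]
  · simp only [he, ← map_pow, AdjoinRoot.modByMonicHom_mk]
    rfl

/-- Write x = a E₁' + b E₁ by the Chinese remainder theorem, with E₁' = E₂. The additive character
splits because both moduli are monic, and the two cross symbols of E₁ and E₂ cancel by reciprocity.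
-/
theorem polyGaussSum_mul (hF : Nat.card F % 4 = 1) {E₁ E₂ : F[X]} (h1 : E₁.Monic)
    (h2 : E₂.Monic) (hc : IsCoprime E₁ E₂) (hd : E₁.natDegree ≠ 0) :
    polyGaussSum ψ (E₁ * E₂) = polyGaussSum ψ E₁ * polyGaussSum ψ E₂ := by
  have hdeg := h1.natDegree_mul h2
  have hmul : ∀ {a : F[X]} {d : ℕ} {b : F[X]}, a.degree < (d : WithBot ℕ) → b.Monic →
      (a * b).degree < ((d + b.natDegree : ℕ) : WithBot ℕ) := by
    intro a d b ha hb
    by_cases h0 : a = 0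
    · simp [h0]
    rw [← natDegree_lt_iff_degree_lt (mul_ne_zero h0 hb.ne_zero), mul_comm a b,
      hb.natDegree_mul' h0]
    have := (natDegree_lt_iff_degree_lt h0).2 ha
    omega
  have hmaps : Set.MapsTo (fun p : F[X] × F[X] => p.1 * E₂ + p.2 * E₁)
      (lowDegree F E₁.natDegree ×ˢ lowDegree F E₂.natDegree : Finset (F[X] × F[X]))
      (lowDegree F (E₁ * E₂).natDegree) := by
    rintro ⟨a, b⟩ hab
    simp only [SetLike.mem_coe, Finset.mem_product, mem_lowDegree] at hab ⊢
    rw [hdeg]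
    refine (degree_add_le _ _).trans_lt (max_lt (hmul hab.1 h2) ?_)
    rw [add_comm]
    exact hmul hab.2 h1
  have hinj : Set.InjOn (fun p : F[X] × F[X] => p.1 * E₂ + p.2 * E₁)
      (lowDegree F E₁.natDegree ×ˢ lowDegree F E₂.natDegree : Finset (F[X] × F[X])) := by
    rintro ⟨a, b⟩ hab ⟨a', b'⟩ hab' h
    simp only [SetLike.mem_coe, Finset.mem_product, mem_lowDegree,
      ← degree_eq_natDegree h1.ne_zero, ← degree_eq_natDegree h2.ne_zero] at hab hab' h
    have e1 : E₁ ∣ a - a' := by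
      refine hc.dvd_of_dvd_mul_right (z := E₂) ⟨b' - b, by linear_combination h⟩
    have e2 : E₂ ∣ b - b' := by
      refine hc.symm.dvd_of_dvd_mul_right (z := E₁) ⟨a' - a, by linear_combination h⟩
    have e3 := eq_zero_of_dvd_of_degree_lt e1 ((degree_sub_le _ _).trans_lt (max_lt hab.1 hab'.1))
    have e4 := eq_zero_of_dvd_of_degree_lt e2 ((degree_sub_le _ _).trans_lt (max_lt hab.2 hab'.2))
    rw [sub_eq_zero.1 e3, sub_eq_zero.1 e4]
  have hcard : (lowDegree F (E₁ * E₂).natDegree).card ≤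
      (lowDegree F E₁.natDegree ×ˢ lowDegree F E₂.natDegree).card := by
    rw [Finset.card_product, card_lowDegree, card_lowDegree, card_lowDegree, hdeg, pow_add]
  rw [polyGaussSum, polyGaussSum, polyGaussSum, Finset.sum_mul_sum, ← Finset.sum_product']
  symm
  refine Finset.sum_nbij _ hmaps hinj (Finset.surjOn_of_injOn_of_card_le _ hmaps hinj hcard) ?_
  rintro ⟨a, b⟩ hab
  simp only [Finset.mem_product, mem_lowDegree] at hab
  simp only
  have e1 : quadSym (a * E₂ + b * E₁) (E₁ * E₂) = quadSym a E₁ * quadSym b E₂ := by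
    rw [quadSym_mul_right _ h1.ne_zero h2.ne_zero, quadSym_congr (g := a * E₂) (h := E₁) ⟨b, by ring⟩,
      quadSym_congr (g := b * E₁) (h := E₂) ⟨a, by ring⟩, quadSym_mul_left, quadSym_mul_left,
      quadSym_comm hF h2 h1]
    have := quadSym_sq h2.ne_zero hc
    linear_combination (quadSym a E₁ * quadSym b E₂) * this
  have hnd : ∀ {x : F[X]} {d : ℕ}, x.degree < (d : WithBot ℕ) → x.natDegree ≤ d - 1 := by
    intro x d hx
    by_cases h0 : x = 0
    · simp [h0]
    · have := (natDegree_lt_iff_degree_lt h0).2 hx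
      omega
  have e2 : (a * E₂ + b * E₁).coeff ((E₁ * E₂).natDegree - 1) =
      a.coeff (E₁.natDegree - 1) + b.coeff (E₂.natDegree - 1) := by
    rw [coeff_add, hdeg]
    congr 1
    · rw [show E₁.natDegree + E₂.natDegree - 1 = (E₁.natDegree - 1) + E₂.natDegree by omega,
        coeff_mul_add_eq_of_natDegree_le (hnd hab.1) le_rfl, h2.coeff_natDegree, mul_one]
    · by_cases h0 : E₂.natDegree = 0
      · have : b = 0 := by
          have := hab.2
          rw [h0, ← mem_lowDegree, lowDegree_zero, Finset.mem_singleton] at this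
          exact this
        simp [this]
      · rw [show E₁.natDegree + E₂.natDegree - 1 = (E₂.natDegree - 1) + E₁.natDegree by omega,
          coeff_mul_add_eq_of_natDegree_le (hnd hab.2) le_rfl, h1.coeff_natDegree, mul_one]
  rw [e1, e2, AddChar.map_add_eq_mul]
  push_cast
  ring

theorem polyGaussSum_eq (hF : Nat.card F % 4 = 1) (hψ : ψ.IsPrimitive) (hE : E.Monic)
    (hsq : Squarefree E) : polyGaussSum ψ E = (∑ c, ψ (c ^ 2)) ^ E.natDegree := by
  induction hd : E.natDegree using Nat.strong_induction_on generalizing E with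
  | _ d ih =>
    by_cases h0 : E.natDegree = 0
    · obtain rfl := eq_one_of_monic_natDegree_zero hE h0
      simp [polyGaussSum, lowDegree_zero, ← hd]
    · obtain ⟨p, hp, hirr, E', rfl⟩ := exists_monic_irreducible_factor E
        (fun h => h0 (natDegree_eq_zero_of_isUnit h))
      have hE' : E'.Monic := hp.of_mul_monic_left hE
      have hdeg := hp.natDegree_mul hE'
      have hpos := hirr.natDegree_pos
      have hc : IsCoprime p E' := by
        rw [hirr.coprime_iff_not_dvd]
        rintro ⟨t, rfl⟩
        exact hirr.not_isUnit (hsq p ⟨t, by ring⟩)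
      rw [polyGaussSum_mul hF hp hE' hc hpos.ne', polyGaussSum_of_irreducible hF hψ hp hirr,
        ih E'.natDegree (by omega) hE' (hsq.squarefree_of_dvd (dvd_mul_left _ _)) rfl, ← pow_add,
        ← hdeg, hd]

end PolynomialGaussSums

/-- `N` is a polynomial of degree at most `2 m` with `q^m x^{2m} N(1 / (q x)) = N(x)`. -/
def IsReflexive (q : ℂ) (m : ℕ) (N : PowerSeries ℂ) : Prop :=
  (∀ k, 2 * m < k → PowerSeries.coeff k N = 0) ∧
    ∀ i j, i + j = 2 * m → q ^ m * PowerSeries.coeff i N = q ^ i * PowerSeries.coeff j N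

/-- The generating series, by degree, of a function on monic polynomials. -/
noncomputable def genSeries {F : Type} [Field F] [Finite F] (w : F[X] → ℂ) : PowerSeries ℂ :=
  PowerSeries.mk fun k => ∑ g ∈ monics F k, w g

/-! ### The functional equation of quadratic L-series -/

section LFunction

variable {F : Type} [Field F] [Fintype F] {ψ : AddChar F ℂ} {E : F[X]}

-- If deg x ≤ m, only the leading term of the monic factor reaches the coefficient read by the
-- character, so the summand is constant. If deg x is larger, translating y by c X^t with t = deg E
-- - 1 - deg x multiplies the sum by ψ(lc(x) c); a c for which this value is not 1 forces the sum to
-- be 0.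
open scoped Classical in
theorem sum_residueChar_mul_monic (hψ : ψ.IsPrimitive) (hE : E.Monic) {k m : ℕ}
    (hkm : k + 1 + m = E.natDegree) {x : F[X]} (hx : x ∈ lowDegree F E.natDegree) :
    ∑ y ∈ lowDegree F k, residueChar ψ E (x * (X ^ k + y)) =
      if x ∈ lowDegree F (m + 1) then (Nat.card F : ℂ) ^ k * ψ (x.coeff m) else 0 := by
  split_ifs with hxm
  · have hterm : ∀ y ∈ lowDegree F k, residueChar ψ E (x * (X ^ k + y)) = ψ (x.coeff m) := by
      intro y hy
      rw [mem_lowDegree] at hxm hy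
      have hmon : (X ^ k + y).Monic := monic_X_pow_add hy
      have hnd : (X ^ k + y).natDegree = k := by
        rw [natDegree_add_eq_left_of_degree_lt (by simpa using hy), natDegree_X_pow]
      have hxn : x.natDegree ≤ m := by
        by_cases h0 : x = 0
        · simp [h0]
        · exact Nat.lt_succ_iff.1 ((natDegree_lt_iff_degree_lt h0).2 hxm)
      have hcoeff : (x * (X ^ k + y)).coeff (E.natDegree - 1) = x.coeff m := by
        rw [show E.natDegree - 1 = m + k by omega, coeff_mul_add_eq_of_natDegree_le hxn hnd.le]
        have h1 := hmon.coeff_natDegree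
        rw [hnd] at h1
        rw [h1, mul_one]
      rw [residueChar_of_degree_lt hE, hcoeff]
      refine (degree_le_natDegree).trans_lt ?_
      have : (x * (X ^ k + y)).natDegree ≤ x.natDegree + k := natDegree_mul_le.trans (by rw [hnd])
      exact_mod_cast (by omega : (x * (X ^ k + y)).natDegree < E.natDegree)
    rw [Finset.sum_congr rfl hterm, Finset.sum_const, card_lowDegree, nsmul_eq_mul]
    push_cast
    ring
  · have hx0 : x ≠ 0 := by
      rintro rfl
      simp at hxm
    have hj1 : m + 1 ≤ x.natDegree := by
      by_contra! h
      exact hxm (mem_lowDegree.2 ((natDegree_lt_iff_degree_lt hx0).1 h))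
    have hj2 : x.natDegree < E.natDegree :=
      (natDegree_lt_iff_degree_lt hx0).2 (mem_lowDegree.1 hx)
    obtain ⟨c, hc⟩ := AddChar.ne_one_iff.1 (hψ (leadingCoeff_ne_zero.2 hx0))
    rw [AddChar.mulShift_apply] at hc
    set t := E.natDegree - 1 - x.natDegree with ht
    have hy0 : C c * X ^ t ∈ lowDegree F k := by
      rw [mem_lowDegree]
      exact (degree_C_mul_X_pow_le t c).trans_lt (by exact_mod_cast (by omega))
    have hval : residueChar ψ E (x * (C c * X ^ t)) = ψ (x.leadingCoeff * c) := by
      rw [residueChar_of_degree_lt hE]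
      · rw [show E.natDegree - 1 = x.natDegree + t by omega,
          coeff_mul_add_eq_of_natDegree_le le_rfl (natDegree_C_mul_X_pow_le c t)]
        simp
      · refine (degree_le_natDegree).trans_lt ?_
        have : (x * (C c * X ^ t)).natDegree ≤ x.natDegree + t :=
          natDegree_mul_le.trans (Nat.add_le_add_left (natDegree_C_mul_X_pow_le c t) _)
        exact_mod_cast (by omega : (x * (C c * X ^ t)).natDegree < E.natDegree)
    have hshift : ∑ y ∈ lowDegree F k, residueChar ψ E (x * (X ^ k + y)) =
        ∑ y ∈ lowDegree F k,
          residueChar ψ E (x * (X ^ k + y)) * residueChar ψ E (x * (C c * X ^ t)) := by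
      refine Finset.sum_nbij' (fun y => y - C c * X ^ t) (fun y => y + C c * X ^ t) ?_ ?_ ?_ ?_ ?_
      · intro y hy
        rw [mem_lowDegree] at *
        exact (degree_sub_le _ _).trans_lt (max_lt hy hy0)
      · intro y hy
        rw [mem_lowDegree] at *
        exact (degree_add_le _ _).trans_lt (max_lt hy hy0)
      · intro y _; ring
      · intro y _; ring
      · intro y _
        rw [← residueChar_add]
        congr 1
        ring
    rw [← Finset.sum_mul, hval] at hshift
    have h0 : (∑ y ∈ lowDegree F k, residueChar ψ E (x * (X ^ k + y))) *
        (1 - ψ (x.leadingCoeff * c)) = 0 := by linear_combination hshift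
    exact (mul_eq_zero.1 h0).resolve_right (sub_ne_zero.2 (Ne.symm hc))

/-- Poisson summation: expand the symbol of g by `sum_quadSym_mul_residueChar`, exchange the sums
and sum the additive character over monic g. -/
theorem polyGaussSum_mul_sum_monics (hF : Nat.card F % 4 = 1) (hψ : ψ.IsPrimitive)
    (hE : E.Monic) (hsq : Squarefree E) {k m : ℕ} (hkm : k + 1 + m = E.natDegree) :
    polyGaussSum ψ E * ∑ g ∈ monics F k, (quadSym g E : ℂ) =
      (Nat.card F : ℂ) ^ k * ∑ x ∈ lowDegree F (m + 1), (quadSym x E : ℂ) * ψ (x.coeff m) := by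
  have h1 : polyGaussSum ψ E * ∑ g ∈ monics F k, (quadSym g E : ℂ) =
      ∑ x ∈ lowDegree F E.natDegree, (quadSym x E : ℂ) *
        ∑ y ∈ lowDegree F k, residueChar ψ E (x * (X ^ k + y)) := by
    rw [sum_monics, Finset.mul_sum]
    simp_rw [Finset.mul_sum]
    rw [Finset.sum_comm]
    refine Finset.sum_congr rfl fun y _ => ?_
    rw [sum_quadSym_mul_residueChar hF hE hsq, mul_comm]
  have hsub : lowDegree F (m + 1) ⊆ lowDegree F E.natDegree := fun x hx => by
    rw [mem_lowDegree] at *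
    exact hx.trans_le (by exact_mod_cast (by omega))
  rw [h1, Finset.mul_sum, ← Finset.sum_subset hsub]
  · refine Finset.sum_congr rfl fun x hx => ?_
    rw [sum_residueChar_mul_monic hψ hE hkm (hsub hx), if_pos hx]
    ring
  · intro x hx hxm
    rw [sum_residueChar_mul_monic hψ hE hkm hx, if_neg hxm, mul_zero]

open scoped Classical in
theorem sum_quadSym_C_mul_X_pow_add (hF : Nat.card F % 4 = 1) (hE : E.Monic) (m : ℕ) {c : F}
    (hc : c ≠ 0) :
    ∑ y ∈ lowDegree F m, (quadSym (C c * X ^ m + y) E : ℂ) =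
      (quadraticChar F c : ℂ) ^ E.natDegree * ∑ g ∈ monics F m, (quadSym g E : ℂ) := by
  rw [sum_monics, Finset.mul_sum]
  have hdeg : ∀ {a : F} (y : F[X]), a ≠ 0 → y ∈ lowDegree F m → C a * y ∈ lowDegree F m := by
    intro a y ha hy
    rw [mem_lowDegree] at *
    rwa [degree_C_mul ha]
  refine Finset.sum_nbij' (fun y => C c⁻¹ * y) (fun y => C c * y) ?_ ?_ ?_ ?_ ?_
  · exact fun y hy => hdeg y (inv_ne_zero hc) hy
  · exact fun y hy => hdeg y hc hy
  · intro y _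
    rw [← mul_assoc, ← C_mul, mul_inv_cancel₀ hc, C_1, one_mul]
  · intro y _
    rw [← mul_assoc, ← C_mul, inv_mul_cancel₀ hc, C_1, one_mul]
  · intro y _
    have : C c * X ^ m + y = C c * (X ^ m + C c⁻¹ * y) := by
      rw [mul_add, ← mul_assoc (C c) (C c⁻¹), ← C_mul, mul_inv_cancel₀ hc, C_1, one_mul]
    rw [this, quadSym_mul_left, quadSym_C (ringChar_ne_two_of_card_mod_four hF) hE]
    push_cast
    ring

-- The polynomials are grouped by their coefficient of degree m. A nonzero coefficient c can be
-- scaled to 1 at the cost of χ(c)^{deg E}.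
open scoped Classical in
theorem sum_lowDegree_succ_quadSym (hF : Nat.card F % 4 = 1) (hE : E.Monic) (m : ℕ)
    (u : F → ℂ) :
    ∑ x ∈ lowDegree F (m + 1), (quadSym x E : ℂ) * u (x.coeff m) =
      u 0 * ∑ x ∈ lowDegree F m, (quadSym x E : ℂ) +
        (∑ c ∈ Finset.univ.erase (0 : F), (quadraticChar F c : ℂ) ^ E.natDegree * u c) *
          ∑ g ∈ monics F m, (quadSym g E : ℂ) := by
  rw [sum_lowDegree_succ, ← Finset.add_sum_erase _ _ (Finset.mem_univ (0 : F)), Finset.sum_mul]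
  have hcoeff : ∀ (c : F), ∀ y ∈ lowDegree F m, (C c * X ^ m + y).coeff m = c := by
    intro c y hy
    rw [coeff_add, coeff_C_mul_X_pow, if_pos rfl, coeff_eq_zero_of_degree_lt (mem_lowDegree.1 hy),
      add_zero]
  congr 1
  · rw [Finset.mul_sum]
    refine Finset.sum_congr rfl fun y hy => ?_
    rw [hcoeff 0 y hy, C_0, zero_mul, zero_add, mul_comm]
  · refine Finset.sum_congr rfl fun c hc => ?_
    rw [mul_right_comm, ← sum_quadSym_C_mul_X_pow_add hF hE m (Finset.ne_of_mem_erase hc),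
      Finset.sum_mul]
    refine Finset.sum_congr rfl fun y hy => ?_
    rw [hcoeff c y hy]

theorem sum_lowDegree_quadSym (hF : Nat.card F % 4 = 1) (hE : E.Monic) (hsq : Squarefree E)
    (hd : E.natDegree ≠ 0) : ∑ x ∈ lowDegree F E.natDegree, (quadSym x E : ℂ) = 0 := by
  have h0 : ¬ IsCoprime 0 E := by
    rw [isCoprime_zero_left]
    exact fun h => hd (natDegree_eq_zero_of_isUnit h)
  obtain ⟨z, -, hz⟩ := exists_quadSym_eq_neg_one hF hE hsq h0
  have hzc : IsCoprime z E := by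
    by_contra h
    rw [(quadSym_eq_zero_iff hE.ne_zero).2 h] at hz
    norm_num at hz
  have h1 := sum_lowDegree_mul_modByMonic hE hzc (fun x => (quadSym x E : ℂ))
  have h2 : ∀ x, quadSym ((x * z) %ₘ E) E = - quadSym x E := fun x => by
    rw [quadSym_congr (dvd_modByMonic_sub hE (x * z)), quadSym_mul_left, hz, mul_neg_one]
  simp only [h2] at h1
  push_cast at h1
  rw [Finset.sum_neg_distrib] at h1
  linear_combination -(1 / 2 : ℂ) * h1

/-- For k ≥ deg E, translation by any residue modulo E permutes the monic polynomials of degree k.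
Averaging over these translations gives complete character sums, which vanish. -/
theorem sum_monics_quadSym_of_le (hF : Nat.card F % 4 = 1) (hE : E.Monic) (hsq : Squarefree E)
    (hd : E.natDegree ≠ 0) {k : ℕ} (hk : E.natDegree ≤ k) :
    ∑ g ∈ monics F k, (quadSym g E : ℂ) = 0 := by
  have h1 : ∀ r ∈ lowDegree F E.natDegree, ∑ g ∈ monics F k, (quadSym g E : ℂ) =
      ∑ g ∈ monics F k, (quadSym (g + r) E : ℂ) := by
    intro r hr
    have hr' : r.degree < (k : WithBot ℕ) :=
      (mem_lowDegree.1 hr).trans_le (by exact_mod_cast hk)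
    rw [sum_monics, sum_monics]
    refine Finset.sum_nbij' (fun y => y - r) (fun y => y + r) ?_ ?_ ?_ ?_ ?_
    · intro y hy
      rw [mem_lowDegree] at *
      exact (degree_sub_le _ _).trans_lt (max_lt hy hr')
    · intro y hy
      rw [mem_lowDegree] at *
      exact (degree_add_le _ _).trans_lt (max_lt hy hr')
    · intro y _; ring
    · intro y _; ring
    · intro y _
      congr 2
      ring
  have hsum : ∑ r ∈ lowDegree F E.natDegree, ∑ g ∈ monics F k, (quadSym g E : ℂ) =
      ∑ r ∈ lowDegree F E.natDegree, ∑ g ∈ monics F k, (quadSym (g + r) E : ℂ) :=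
    Finset.sum_congr rfl h1
  have hzero : ∑ r ∈ lowDegree F E.natDegree, ∑ g ∈ monics F k, (quadSym (g + r) E : ℂ) = 0 := by
    rw [Finset.sum_comm]
    refine Finset.sum_eq_zero fun g _ => ?_
    rw [← sum_lowDegree_quadSym hF hE hsq hd]
    have hg : (g %ₘ E).degree < (E.natDegree : WithBot ℕ) := by
      rw [← degree_eq_natDegree hE.ne_zero]
      exact degree_modByMonic_lt _ hE
    refine Finset.sum_nbij' (fun y => y + g %ₘ E) (fun y => y - g %ₘ E) ?_ ?_ ?_ ?_ ?_
    · intro y hy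
      rw [mem_lowDegree] at *
      exact (degree_add_le _ _).trans_lt (max_lt hy hg)
    · intro y hy
      rw [mem_lowDegree] at *
      exact (degree_sub_le _ _).trans_lt (max_lt hy hg)
    · intro y _; ring
    · intro y _; ring
    · intro y _
      congr 1
      refine quadSym_congr ?_
      rw [show g + y - (y + g %ₘ E) = -(g %ₘ E - g) by ring]
      exact (dvd_modByMonic_sub hE g).neg_right
  rw [hzero, Finset.sum_const, nsmul_eq_mul, card_lowDegree] at hsum
  have : ((Nat.card F ^ E.natDegree : ℕ) : ℂ) ≠ 0 := by
    exact_mod_cast pow_ne_zero _ Nat.card_pos.ne'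
  exact (mul_eq_zero.1 hsum).resolve_left this

open scoped Classical in
theorem sum_erase_quadraticChar_pow_of_odd {d : ℕ} (hd : Odd d)
    (u : F → ℂ) :
    ∑ c ∈ Finset.univ.erase (0 : F), (quadraticChar F c : ℂ) ^ d * u c =
      ∑ c, (quadraticChar F c : ℂ) * u c := by
  rw [← Finset.add_sum_erase Finset.univ (fun c => (quadraticChar F c : ℂ) * u c)
    (Finset.mem_univ (0 : F))]
  simp only [MulChar.map_zero, Int.cast_zero, zero_mul, zero_add]
  refine Finset.sum_congr rfl fun c hc => ?_
  rcases quadraticChar_dichotomy (Finset.ne_of_mem_erase hc) with h | h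
  · simp [h]
  · simp [h, hd.neg_one_pow]

open scoped Classical in
theorem sum_erase_quadraticChar_pow_of_even {d : ℕ} (hd : Even d) (u : F → ℂ) :
    ∑ c ∈ Finset.univ.erase (0 : F), (quadraticChar F c : ℂ) ^ d * u c = ∑ c, u c - u 0 := by
  rw [← Finset.add_sum_erase Finset.univ u (Finset.mem_univ (0 : F)), add_sub_cancel_left]
  refine Finset.sum_congr rfl fun c hc => ?_
  rcases quadraticChar_dichotomy (Finset.ne_of_mem_erase hc) with h | h
  · simp [h]
  · simp [h, hd.neg_one_pow]

/-- For odd degree the scalars carry the nontrivial character. So the sums over all polynomials of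
bounded degree vanish, and only the Gauss sum g of F remains beside the monic sums. Cancelling it
against g^{2m+1} leaves g^{2m} = q^m. -/
theorem isReflexive_genSeries_quadSym_of_odd (hF : Nat.card F % 4 = 1) (hE : E.Monic)
    (hsq : Squarefree E) {m : ℕ} (hm : E.natDegree = 2 * m + 1) :
    IsReflexive (Nat.card F) m (genSeries fun g : F[X] => (quadSym g E : ℂ)) := by
  classical
  have hF' := ringChar_ne_two_of_card_mod_four hF
  have hd : E.natDegree ≠ 0 := by omega
  have hodd : Odd E.natDegree := ⟨m, hm⟩
  refine ⟨fun k hk => ?_, fun i j hij => ?_⟩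
  · rw [genSeries, PowerSeries.coeff_mk]
    exact sum_monics_quadSym_of_le hF hE hsq hd (by omega)
  simp only [genSeries, PowerSeries.coeff_mk]
  obtain ⟨ψ, hψ⟩ : ∃ ψ : AddChar F ℂ, ψ.IsPrimitive :=
    ⟨_, AddChar.FiniteField.primitiveChar_to_Complex_isPrimitive F⟩
  have hχ : ∑ c : F, (quadraticChar F c : ℂ) = 0 := by exact_mod_cast quadraticChar_sum_zero hF'
  have hA : ∀ k, ∑ x ∈ lowDegree F k, (quadSym x E : ℂ) = 0 := by
    intro k
    induction k with
    | zero => simp [lowDegree_zero, quadSym_zero_left hE hd]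
    | succ k ih =>
      have := sum_lowDegree_succ_quadSym hF hE k fun _ => 1
      rw [sum_erase_quadraticChar_pow_of_odd hodd] at this
      simp only [mul_one] at this
      rw [this, ih, hχ, mul_zero, zero_mul, zero_add]
  have h1 := polyGaussSum_mul_sum_monics hF hψ hE hsq (k := i) (m := j) (by omega)
  rw [sum_lowDegree_succ_quadSym hF hE j ψ, hA, mul_zero, zero_add,
    sum_erase_quadraticChar_pow_of_odd hodd, ← sum_sq_eq_sum_quadraticChar hF' ψ
      (by simpa using AddChar.sum_mul_eq_ite hψ 1), polyGaussSum_eq hF hψ hE hsq, hm] at h1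
  have hg := gaussSum_quadraticChar_sq hF hψ
  set g := ∑ c, ψ (c ^ 2)
  have hq0 : (Nat.card F : ℂ) ≠ 0 := Nat.cast_ne_zero.2 Nat.card_pos.ne'
  have hg0 : g ≠ 0 := fun h => hq0 (by rw [← hg, h]; ring)
  apply mul_left_cancel₀ hg0
  rw [pow_succ, pow_mul, hg] at h1
  linear_combination h1

/-- For even degree the scalars act trivially, and Poisson summation relates L to the sums A over
all polynomials of bounded degree. The step A_{k+1} = A_k + (q - 1) L_k eliminates A precisely in
the differences L_{k+1} - q L_k. -/
theorem isReflexive_genSeries_quadSym_of_even (hF : Nat.card F % 4 = 1) (hE : E.Monic)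
    (hsq : Squarefree E) {m : ℕ} (hm : E.natDegree = 2 * m) :
    IsReflexive (Nat.card F) m ((1 - PowerSeries.C (Nat.card F : ℂ) * PowerSeries.X) *
      genSeries fun g : F[X] => (quadSym g E : ℂ)) := by
  classical
  set q : ℂ := (Nat.card F : ℂ) with hq
  set L : ℕ → ℂ := fun k => ∑ g ∈ monics F k, (quadSym g E : ℂ) with hL
  set N := (1 - PowerSeries.C q * PowerSeries.X) *
      genSeries fun g : F[X] => (quadSym g E : ℂ) with hN
  have hN0 : PowerSeries.coeff 0 N = L 0 := by
    simp [hN, genSeries, hL]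
  have hNs : ∀ k, PowerSeries.coeff (k + 1) N = L (k + 1) - q * L k := by
    intro k
    rw [hN, sub_mul, one_mul, map_sub, mul_assoc, PowerSeries.coeff_C_mul,
      PowerSeries.coeff_succ_X_mul, genSeries, PowerSeries.coeff_mk, PowerSeries.coeff_mk]
  have hF' := ringChar_ne_two_of_card_mod_four hF
  have hq0 : q ≠ 0 := Nat.cast_ne_zero.2 Nat.card_pos.ne'
  by_cases hm0 : m = 0
  · subst hm0
    obtain rfl := eq_one_of_monic_natDegree_zero hE hm
    have hLk : ∀ k, L k = q ^ k := by simp [hL, card_monics, hq]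
    refine ⟨fun k hk => ?_, fun i j hij => ?_⟩
    · obtain ⟨k, rfl⟩ : ∃ k', k = k' + 1 := ⟨k - 1, by omega⟩
      rw [hNs, hLk, hLk]
      ring
    · obtain ⟨rfl, rfl⟩ : i = 0 ∧ j = 0 := by omega
      rfl
  have hd : E.natDegree ≠ 0 := by omega
  have heven : Even E.natDegree := ⟨m, by omega⟩
  have hLz : ∀ k, 2 * m ≤ k → L k = 0 := fun k hk =>
    sum_monics_quadSym_of_le hF hE hsq hd (by omega)
  obtain ⟨ψ, hψ⟩ : ∃ ψ : AddChar F ℂ, ψ.IsPrimitive :=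
    ⟨_, AddChar.FiniteField.primitiveChar_to_Complex_isPrimitive F⟩
  set A : ℕ → ℂ := fun k => ∑ x ∈ lowDegree F k, (quadSym x E : ℂ) with hA
  have hAs : ∀ k, A (k + 1) = A k + (q - 1) * L k := by
    intro k
    have := sum_lowDegree_succ_quadSym hF hE k fun _ => 1
    rw [sum_erase_quadraticChar_pow_of_even heven] at this
    simpa [hA, hL, hq, Nat.card_eq_fintype_card] using this
  have hAd : A (2 * m) = 0 := by
    rw [← hm]
    exact sum_lowDegree_quadSym hF hE hsq hd
  have key : ∀ i j, i + j + 1 = 2 * m → q ^ m * L i = q ^ i * (A j - L j) := by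
    intro i j hij
    have h1 := polyGaussSum_mul_sum_monics hF hψ hE hsq (k := i) (m := j) (by omega)
    have hψ0 : ∑ c, ψ c = 0 := by simpa using AddChar.sum_mul_eq_ite hψ 1
    rw [sum_lowDegree_succ_quadSym hF hE j ψ, sum_erase_quadraticChar_pow_of_even heven,
      hψ0, polyGaussSum_eq hF hψ hE hsq, hm, pow_mul, gaussSum_quadraticChar_sq hF hψ,
      AddChar.map_zero_eq_one] at h1
    linear_combination h1
  refine ⟨fun k hk => ?_, fun i j hij => ?_⟩
  · obtain ⟨k, rfl⟩ : ∃ k', k = k' + 1 := ⟨k - 1, by omega⟩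
    rw [hNs, hLz k (by omega), hLz (k + 1) (by omega)]
    ring
  -- The boundary case, where the difference has a single term, uses that A vanishes over a complete
  -- residue system.
  · have hend : q ^ m * L 0 = - q * L (2 * m - 1) := by
      have h1 := key 0 (2 * m - 1) (by omega)
      have h2 := hAs (2 * m - 1)
      rw [show 2 * m - 1 + 1 = 2 * m by omega, hAd] at h2
      linear_combination h1 - h2
    rcases Nat.eq_zero_or_pos i with rfl | hi
    · obtain rfl : j = (2 * m - 1) + 1 := by omega
      rw [hN0, hNs, hLz (2 * m - 1 + 1) (by omega), hend]
      ring
    rcases Nat.eq_zero_or_pos j with rfl | hj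
    · obtain rfl : i = (2 * m - 1) + 1 := by omega
      rw [hN0, hNs, hLz (2 * m - 1 + 1) (by omega)]
      have : q ^ (2 * m - 1 + 1) = q ^ m * q ^ m := by
        rw [← pow_add]; congr 1; omega
      rw [this]
      linear_combination -q ^ m * hend
    · obtain ⟨i, rfl⟩ : ∃ i', i = i' + 1 := ⟨i - 1, by omega⟩
      obtain ⟨j, rfl⟩ : ∃ j', j = j' + 1 := ⟨j - 1, by omega⟩
      rw [hNs, hNs]
      have h1 := key (i + 1) j (by omega)
      have h2 := key i (j + 1) (by omega)
      rw [hAs] at h2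
      rw [pow_succ] at *
      linear_combination h1 - q * h2

end LFunction

/-! ### Operations on reflexive series and Euler factors -/

section Reflexive

theorem IsReflexive.zero (q : ℂ) (m : ℕ) : IsReflexive q m 0 := by
  constructor <;> simp

theorem IsReflexive.add {q : ℂ} {m : ℕ} {M N : PowerSeries ℂ} (hM : IsReflexive q m M)
    (hN : IsReflexive q m N) : IsReflexive q m (M + N) := by
  refine ⟨fun k hk => ?_, fun i j hij => ?_⟩
  · rw [map_add, hM.1 k hk, hN.1 k hk, add_zero]
  · rw [map_add, map_add, mul_add, mul_add, hM.2 i j hij, hN.2 i j hij]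

theorem IsReflexive.C_mul {q : ℂ} {m : ℕ} {N : PowerSeries ℂ} (hN : IsReflexive q m N) (c : ℂ) :
    IsReflexive q m (PowerSeries.C c * N) := by
  refine ⟨fun k hk => ?_, fun i j hij => ?_⟩
  · rw [PowerSeries.coeff_C_mul, hN.1 k hk, mul_zero]
  · rw [PowerSeries.coeff_C_mul, PowerSeries.coeff_C_mul]
    linear_combination c * hN.2 i j hij

theorem IsReflexive.sum {ι : Type*} {q : ℂ} {m : ℕ} {s : Finset ι} {N : ι → PowerSeries ℂ}
    (hN : ∀ a ∈ s, IsReflexive q m (N a)) : IsReflexive q m (∑ a ∈ s, N a) :=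
  Finset.sum_induction _ _ (fun _ _ => IsReflexive.add) (IsReflexive.zero q m) hN

theorem IsReflexive.mul {q : ℂ} {l m : ℕ} {M N : PowerSeries ℂ} (hM : IsReflexive q l M)
    (hN : IsReflexive q m N) : IsReflexive q (l + m) (M * N) := by
  refine ⟨fun k hk => ?_, fun i j hij => ?_⟩
  · rw [PowerSeries.coeff_mul]
    refine Finset.sum_eq_zero fun x hx => ?_
    rw [Finset.HasAntidiagonal.mem_antidiagonal] at hx
    by_cases h : 2 * l < x.1
    · rw [hM.1 _ h, zero_mul]
    · rw [hN.1 x.2 (by omega), mul_zero]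
  · have key : ∀ a b, a + b = 2 * (l + m) → PowerSeries.coeff a (M * N) =
        ∑ x ∈ (Finset.HasAntidiagonal.antidiagonal a).filter (fun x => x.1 ≤ 2 * l ∧ x.2 ≤ 2 * m),
          PowerSeries.coeff x.1 M * PowerSeries.coeff x.2 N := by
      intro a b _
      rw [PowerSeries.coeff_mul]
      symm
      refine Finset.sum_filter_of_ne fun x _ hne => ?_
      by_contra h
      rw [not_and_or, not_le, not_le] at h
      rcases h with h | h
      · exact hne (by rw [hM.1 _ h, zero_mul])
      · exact hne (by rw [hN.1 _ h, mul_zero])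
    rw [key i j hij, key j i (by omega), Finset.mul_sum, Finset.mul_sum]
    refine Finset.sum_nbij' (fun x => (2 * l - x.1, 2 * m - x.2))
      (fun x => (2 * l - x.1, 2 * m - x.2)) ?_ ?_ ?_ ?_ ?_
    · intro x hx
      simp only [Finset.mem_filter, Finset.HasAntidiagonal.mem_antidiagonal] at hx ⊢
      omega
    · intro x hx
      simp only [Finset.mem_filter, Finset.HasAntidiagonal.mem_antidiagonal] at hx ⊢
      omega
    · intro x hx
      simp only [Finset.mem_filter, Finset.HasAntidiagonal.mem_antidiagonal] at hx
      ext <;> simp only <;> omega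
    · intro x hx
      simp only [Finset.mem_filter, Finset.HasAntidiagonal.mem_antidiagonal] at hx
      ext <;> simp only <;> omega
    · intro x hx
      simp only [Finset.mem_filter, Finset.HasAntidiagonal.mem_antidiagonal] at hx
      have h1 := hM.2 x.1 (2 * l - x.1) (by omega)
      have h2 := hN.2 x.2 (2 * m - x.2) (by omega)
      rw [pow_add, ← hx.1, pow_add]
      linear_combination (q ^ m * PowerSeries.coeff x.2 N) * h1 +
        (q ^ x.1 * PowerSeries.coeff (2 * l - x.1) M) * h2

/-- This is the substitution x ↦ ε x^d up to the order of the two maps. The sign ε causes no change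
because reflected exponents i and j, with i + j = 2m, have equal parity. -/
theorem IsReflexive.expand {q : ℂ} {m : ℕ} {N : PowerSeries ℂ} {d : ℕ} (hd : d ≠ 0)
    (hN : IsReflexive (q ^ d) m N) {ε : ℂ} (hε : ε ^ 2 = 1) :
    IsReflexive q (d * m) (PowerSeries.expand d hd (PowerSeries.rescale ε N)) := by
  refine ⟨fun k hk => ?_, fun i j hij => ?_⟩
  · by_cases h : d ∣ k
    · obtain ⟨k, rfl⟩ := h
      rw [PowerSeries.coeff_expand_mul, PowerSeries.coeff_rescale, hN.1, mul_zero]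
      rw [mul_left_comm] at hk
      exact lt_of_mul_lt_mul_left hk (Nat.zero_le d)
    · exact PowerSeries.coeff_expand_of_not_dvd _ _ _ h
  · have hsum : d ∣ i + j := by rw [hij]; exact ⟨2 * m, by ring⟩
    by_cases h : d ∣ i
    · obtain ⟨i, rfl⟩ := h
      obtain ⟨j, rfl⟩ := (Nat.dvd_add_right (dvd_mul_right d i)).1 hsum
      have hij' : i + j = 2 * m := by
        apply Nat.eq_of_mul_eq_mul_left (Nat.pos_of_ne_zero hd)
        linarith
      rw [PowerSeries.coeff_expand_mul, PowerSeries.coeff_expand_mul, PowerSeries.coeff_rescale,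
        PowerSeries.coeff_rescale]
      have h1 := hN.2 i j hij'
      rw [← pow_mul, ← pow_mul] at h1
      have h2 : ε ^ i = ε ^ j := by
        have h3 : ε ^ i * ε ^ j = 1 := by rw [← pow_add, hij', pow_mul, hε, one_pow]
        have h4 : ε ^ j * ε ^ j = 1 := by rw [← sq, ← pow_mul, mul_comm, pow_mul, hε, one_pow]
        linear_combination ε ^ j * h3 - ε ^ i * h4
      rw [h2]
      linear_combination ε ^ j * h1
    · have h' : ¬ d ∣ j := fun hj => h ((Nat.dvd_add_left hj).1 hsum)
      rw [PowerSeries.coeff_expand_of_not_dvd _ _ _ h, PowerSeries.coeff_expand_of_not_dvd _ _ _ h',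
        mul_zero, mul_zero]

theorem IsReflexive.eq_one {q : ℂ} {N : PowerSeries ℂ} (hN : IsReflexive q 0 N)
    (h0 : PowerSeries.coeff 0 N = 1) : N = 1 := by
  ext k
  rcases Nat.eq_zero_or_pos k with rfl | hk
  · rw [h0]; simp
  · rw [hN.1 k (by omega), PowerSeries.coeff_one, if_neg hk.ne']

/-- The series multiplied by `1 - r x` if `d` is even, and unchanged if `d` is odd. -/
noncomputable def clearPole (r : ℂ) (d : ℕ) (W : PowerSeries ℂ) : PowerSeries ℂ :=
  if Even d then (1 - PowerSeries.C r * PowerSeries.X) * W else W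

theorem clearPole_congr {r : ℂ} {d d' : ℕ} (h : Even d ↔ Even d') (W : PowerSeries ℂ) :
    clearPole r d W = clearPole r d' W := by
  simp only [clearPole, h]

theorem clearPole_mul (r : ℂ) (d : ℕ) (V W : PowerSeries ℂ) :
    clearPole r d (V * W) = V * clearPole r d W := by
  unfold clearPole
  split_ifs <;> ring

theorem clearPole_sum {ι : Type*} (r : ℂ) (d : ℕ) (s : Finset ι) (W : ι → PowerSeries ℂ) :
    clearPole r d (∑ a ∈ s, W a) = ∑ a ∈ s, clearPole r d (W a) := by
  unfold clearPole
  split_ifs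
  · rw [Finset.mul_sum]
  · rfl

/-- The generating series `W` has the functional equation, with a possible pole at `x = 1 / r`,
of an `L`-function whose conductor has degree `d`. -/
def HasFunctionalEquation (r q : ℂ) (d : ℕ) (W : PowerSeries ℂ) : Prop :=
  IsReflexive q (d / 2) (clearPole r d W)

theorem hasFunctionalEquation_quadSym {F : Type} [Field F] [Finite F] (hF : Nat.card F % 4 = 1)
    {E : F[X]} (hE : E.Monic) (hsq : Squarefree E) :
    HasFunctionalEquation (Nat.card F) (Nat.card F) E.natDegree
      (genSeries fun g : F[X] => (quadSym g E : ℂ)) := by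
  have := Fintype.ofFinite F
  unfold HasFunctionalEquation clearPole
  rcases Nat.even_or_odd' E.natDegree with ⟨m, hm | hm⟩
  · rw [if_pos (by rw [hm]; simp), hm, Nat.mul_div_cancel_left _ two_pos]
    exact isReflexive_genSeries_quadSym_of_even hF hE hsq hm
  · rw [if_neg (by rw [hm]; simp), hm, show (2 * m + 1) / 2 = m by omega]
    exact isReflexive_genSeries_quadSym_of_odd hF hE hsq hm

/-- Every monic polynomial is uniquely p^k g with g monic and prime to p, and degrees add. -/
theorem genSeries_eq_expand_mul {F : Type} [Field F] [Finite F] {p : F[X]} (hp : p.Monic)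
    (hirr : Irreducible p) {w w' : F[X] → ℂ} {b : ℕ → ℂ}
    (hw : ∀ k g, g.Monic → ¬ p ∣ g → w (p ^ k * g) = b k * w' g) (hw' : ∀ g, p ∣ g → w' g = 0) :
    genSeries w =
      PowerSeries.expand p.natDegree hirr.natDegree_pos.ne' (PowerSeries.mk b) * genSeries w' := by
  classical
  have hδ := hirr.natDegree_pos
  ext N
  rw [PowerSeries.coeff_mul, genSeries, genSeries, PowerSeries.coeff_mk]
  simp only [PowerSeries.coeff_mk, Finset.mul_sum]
  rw [Finset.sum_sigma', ← Finset.sum_filter_of_ne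
    (p := fun x : (_ : ℕ × ℕ) × F[X] => p.natDegree ∣ x.1.1 ∧ ¬ p ∣ x.2)]
  · symm
    refine Finset.sum_bij (fun x _ => p ^ (x.1.1 / p.natDegree) * x.2) ?_ ?_ ?_ ?_
    · rintro ⟨⟨i, j⟩, g⟩ hx
      simp only [Finset.mem_filter, Finset.mem_sigma, Finset.HasAntidiagonal.mem_antidiagonal, mem_monics] at hx
      obtain ⟨⟨hij, hg, rfl⟩, ⟨k, rfl⟩, -⟩ := hx
      rw [mem_monics]
      refine ⟨(hp.pow _).mul hg, ?_⟩
      simp only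
      rw [(hp.pow _).natDegree_mul hg, hp.natDegree_pow, Nat.mul_div_cancel_left _ hδ, ← hij]
      ring
    · rintro ⟨⟨i, j⟩, g⟩ hx ⟨⟨i', j'⟩, g'⟩ hx' heq
      simp only [Finset.mem_filter, Finset.mem_sigma, Finset.HasAntidiagonal.mem_antidiagonal, mem_monics]
        at hx hx' heq
      obtain ⟨⟨hij, hg, rfl⟩, ⟨k, rfl⟩, h⟩ := hx
      obtain ⟨⟨hij', hg', rfl⟩, ⟨k', rfl⟩, h'⟩ := hx'
      rw [Nat.mul_div_cancel_left _ hδ, Nat.mul_div_cancel_left _ hδ] at heq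
      have hkk : k = k' := by
        rcases lt_trichotomy k k' with hlt | heq' | hlt
        · exfalso
          obtain ⟨t, rfl⟩ := Nat.exists_eq_add_of_lt hlt
          rw [pow_succ, pow_add, mul_assoc, mul_assoc] at heq
          have := mul_left_cancel₀ (pow_ne_zero k hp.ne_zero) heq
          exact h ⟨p ^ t * g', by rw [this]; ring⟩
        · exact heq'
        · exfalso
          obtain ⟨t, rfl⟩ := Nat.exists_eq_add_of_lt hlt
          rw [pow_succ, pow_add, mul_assoc, mul_assoc] at heq
          have := mul_left_cancel₀ (pow_ne_zero k' hp.ne_zero) heq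
          exact h' ⟨p ^ t * g, by rw [← this]; ring⟩
      subst hkk
      have := mul_left_cancel₀ (pow_ne_zero k hp.ne_zero) heq
      subst this
      rfl
    · intro g hg
      rw [mem_monics] at hg
      obtain ⟨k, g', hg', rfl⟩ := WfDvdMonoid.max_power_factor hg.1.ne_zero hirr
      have hm : g'.Monic := (hp.pow k).of_mul_monic_left hg.1
      refine ⟨⟨(p.natDegree * k, g'.natDegree), g'⟩, ?_, ?_⟩
      · simp only [Finset.mem_filter, Finset.mem_sigma, Finset.HasAntidiagonal.mem_antidiagonal, mem_monics]
        refine ⟨⟨?_, hm, trivial⟩, dvd_mul_right _ _, hg'⟩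
        rw [← hg.2, (hp.pow _).natDegree_mul hm, hp.natDegree_pow]
        ring
      · simp only
        rw [Nat.mul_div_cancel_left _ hδ]
    · rintro ⟨⟨i, j⟩, g⟩ hx
      simp only [Finset.mem_filter, Finset.mem_sigma, Finset.HasAntidiagonal.mem_antidiagonal, mem_monics] at hx
      obtain ⟨⟨hij, hg, rfl⟩, ⟨k, rfl⟩, h⟩ := hx
      simp only
      rw [Nat.mul_div_cancel_left _ hδ, hw k g hg h, PowerSeries.coeff_expand_mul,
        PowerSeries.coeff_mk]
  · rintro ⟨⟨i, j⟩, g⟩ - hne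
    refine ⟨?_, fun h => hne ?_⟩
    · by_contra h
      exact hne (by rw [PowerSeries.coeff_expand_of_not_dvd _ _ _ h, zero_mul])
    · rw [hw' g h, mul_zero]

end Reflexive

/-- Twisted multiplicativity and normalization of weights over a fixed finite field. -/
structure IsTwistedMultiplicative {F : Type} [Field F] {n : ℕ}
    (H : (Fin (n + 1) → F[X]) → ℂ) : Prop where
  mul : ∀ f g : Fin (n + 1) → F[X], (∀ i, (f i).Monic) → (∀ i, (g i).Monic) →
    IsCoprime (∏ i, f i) (∏ i, g i) →
    H (fun i => f i * g i) =
      H f * H g * ∏ i, ((quadSym (f i) (g (i + 1)) * quadSym (g i) (f (i + 1)) : ℤ) : ℂ)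
  update_one : ∀ (i : Fin (n + 1)) (f : F[X]), f.Monic →
    H (Function.update (fun _ => 1) i f) = 1

/-! ### Splitting off the powers of one prime -/

section Twisted

variable {F : Type} [Field F] {n : ℕ}

/-- The weight as a function of the `i`-th polynomial, twisted by the quadratic character
modulo `E`. -/
noncomputable def twistedWeight (H : (Fin (n + 1) → F[X]) → ℂ) (i : Fin (n + 1))
    (f : Fin (n + 1) → F[X]) (E g : F[X]) : ℂ :=
  H (Function.update f i g) * (quadSym g E : ℂ)

/-- The generating series of the weights of powers of `p`, in the `i`-th exponent. -/
noncomputable def localSeries (H : (Fin (n + 1) → F[X]) → ℂ) (i : Fin (n + 1)) (p : F[X])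
    (v : Fin (n + 1) → ℕ) : PowerSeries ℂ :=
  PowerSeries.mk fun k => H fun j => p ^ Function.update v i k j

/-- The product of symbols that appears when the powers `p ^ v j` are split off. -/
noncomputable def splitSign (p : F[X]) (v : Fin (n + 1) → ℕ) (f : Fin (n + 1) → F[X]) : ℤ :=
  ∏ j, quadSym p (f (j + 1)) ^ v j * quadSym p (f j) ^ v (j + 1)

/-- The varying entry occurs only in the factors j = i and j = i - 1, which are distinct because n ≥
1. Reciprocity moves p to the numerator of every symbol. -/
theorem prod_splitSign_update [Finite F] (hn : 1 ≤ n) (hF : Nat.card F % 4 = 1)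
    (i : Fin (n + 1)) {p : F[X]} (hp : p.Monic) {v : Fin (n + 1) → ℕ} (hv : v i = 0)
    {f : Fin (n + 1) → F[X]} (hfi : f i = 1) (hf : ∀ j, (f j).Monic) {g : F[X]}
    (hg : g.Monic) (k : ℕ) :
    ∏ j, (quadSym (p ^ Function.update v i k j) (Function.update f i g (j + 1)) *
      quadSym (Function.update f i g j) (p ^ Function.update v i k (j + 1))) =
    splitSign p v f * (quadSym p (f (i + 1)) * quadSym p (f (i - 1))) ^ k *
      quadSym p g ^ (v (i - 1) + v (i + 1)) := by
  have hfm : ∀ j, (Function.update f i g j).Monic := by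
    intro j
    by_cases h : j = i
    · subst h; simpa using hg
    · simpa [h] using hf j
  have hS : ∀ j, quadSym p (Function.update f i g j) =
      quadSym p (f j) * if j = i then quadSym p g else 1 := by
    intro j
    by_cases h : j = i
    · subst h; simp [hfi]
    · simp [h]
  have hV : ∀ j, Function.update v i k j = v j + if j = i then k else 0 := by
    intro j
    by_cases h : j = i
    · subst h; simp [hv]
    · simp [h]
  have hterm : ∀ j, quadSym (p ^ Function.update v i k j) (Function.update f i g (j + 1)) *
      quadSym (Function.update f i g j) (p ^ Function.update v i k (j + 1)) =
      (quadSym p (f (j + 1)) ^ v j * quadSym p (f j) ^ v (j + 1)) *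
        ((if j = i then quadSym p (f (i + 1)) ^ k else 1) *
         (if j = i - 1 then quadSym p (f (i - 1)) ^ k else 1)) *
        ((if j = i - 1 then quadSym p g ^ v (i - 1) else 1) *
         (if j = i then quadSym p g ^ v (i + 1) else 1)) := by
    intro j
    rw [quadSym_pow_left _ (hfm _).ne_zero, quadSym_pow_right _ hp.ne_zero,
      quadSym_comm hF (hfm j) hp, hS, hS, hV, hV]
    have e1 : j + 1 = i ↔ j = i - 1 := by rw [eq_sub_iff_add_eq]
    simp only [e1]
    by_cases h1 : j = i
    · subst h1
      have h2 : j ≠ j - 1 := (Fin.sub_one_ne_self hn j).symm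
      simp only [if_true, h2, if_false, hv, add_zero, mul_one]
      ring
    · by_cases h2 : j = i - 1
      · subst h2
        simp only [if_true, h1, if_false, sub_add_cancel, hv, add_zero, mul_one]
        ring
      · simp only [h1, h2, if_false]
        ring
  rw [Finset.prod_congr rfl fun j _ => hterm j]
  simp only [Finset.prod_mul_distrib, Finset.prod_ite_eq', Finset.mem_univ, if_true]
  rw [splitSign, Finset.prod_mul_distrib]
  ring

theorem IsTwistedMultiplicative.pow_mul [Finite F] (hn : 1 ≤ n) (hF : Nat.card F % 4 = 1)
    {H : (Fin (n + 1) → F[X]) → ℂ} (hH : IsTwistedMultiplicative H)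
    (i : Fin (n + 1)) {p : F[X]} (hp : p.Monic) (hirr : Irreducible p)
    {v : Fin (n + 1) → ℕ} (hv : v i = 0)
    {f : Fin (n + 1) → F[X]} (hfi : f i = 1) (hf : ∀ j, (f j).Monic) (hpf : ∀ j, ¬ p ∣ f j)
    {g : F[X]} (hg : g.Monic) (hpg : ¬ p ∣ g) (k : ℕ) :
    H (Function.update (fun j => p ^ v j * f j) i (p ^ k * g)) =
      (splitSign p v f : ℂ) * H (fun j => p ^ Function.update v i k j) *
        ((quadSym p (f (i + 1)) * quadSym p (f (i - 1)) : ℤ) : ℂ) ^ k *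
        (H (Function.update f i g) * (quadSym p g : ℂ) ^ (v (i - 1) + v (i + 1))) := by
  have hfm : ∀ j, (Function.update f i g j).Monic ∧ ¬ p ∣ Function.update f i g j := by
    intro j
    by_cases h : j = i
    · subst h; simpa using ⟨hg, hpg⟩
    · simpa [h] using ⟨hf j, hpf j⟩
  have heq : Function.update (fun j => p ^ v j * f j) i (p ^ k * g) =
      fun j => p ^ Function.update v i k j * Function.update f i g j := by
    ext1 j
    by_cases h : j = i
    · subst h; simp
    · simp [h]
  rw [heq, hH.mul (fun j => p ^ Function.update v i k j) (Function.update f i g)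
    (fun j => hp.pow _) (fun j => (hfm j).1), ← Int.cast_prod,
    prod_splitSign_update hn hF i hp hv hfi hf hg k]
  · push_cast
    ring
  · refine IsCoprime.prod_left fun a _ => IsCoprime.prod_right fun b _ => ?_
    exact (hirr.coprime_iff_not_dvd.2 (hfm b).2).pow_left

/-- The modulus after the powers of `p` are split off. -/
noncomputable def nextModulus (p E : F[X]) (d : ℕ) : F[X] := if Odd d then E * p else E

theorem twistedWeight_pow_mul [Finite F] (hn : 1 ≤ n) (hF : Nat.card F % 4 = 1)
    {H : (Fin (n + 1) → F[X]) → ℂ} (hH : IsTwistedMultiplicative H)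
    (i : Fin (n + 1)) {p : F[X]} (hp : p.Monic) (hirr : Irreducible p)
    {v : Fin (n + 1) → ℕ} (hv : v i = 0)
    {f : Fin (n + 1) → F[X]} (hfi : f i = 1) (hf : ∀ j, (f j).Monic) (hpf : ∀ j, ¬ p ∣ f j)
    {E : F[X]} (hE : E.Monic) {g : F[X]} (hg : g.Monic) (hpg : ¬ p ∣ g) (k : ℕ) :
    twistedWeight H i (fun j => p ^ v j * f j) E (p ^ k * g) =
      (splitSign p v f : ℂ) * H (fun j => p ^ Function.update v i k j) *
        ((quadSym p (f (i + 1)) * quadSym p (f (i - 1)) * quadSym p E : ℤ) : ℂ) ^ k *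
        twistedWeight H i f (nextModulus p E (v (i - 1) + v (i + 1))) g := by
  have hs : quadSym g (nextModulus p E (v (i - 1) + v (i + 1))) =
      quadSym g E * quadSym p g ^ (v (i - 1) + v (i + 1)) := by
    have hsq := quadSym_sq hg.ne_zero (hirr.coprime_iff_not_dvd.2 hpg)
    unfold nextModulus
    split_ifs with hd
    · obtain ⟨t, ht⟩ := hd
      rw [quadSym_mul_right _ hE.ne_zero hp.ne_zero, ht, pow_succ, pow_mul, hsq, one_pow, one_mul,
        quadSym_comm hF hg hp]
    · obtain ⟨t, ht⟩ := Nat.not_odd_iff_even.1 hd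
      rw [ht, ← two_mul, pow_mul, hsq, one_pow, mul_one]
  rw [twistedWeight, twistedWeight, hH.pow_mul hn hF i hp hirr hv hfi hf hpf hg hpg k, hs,
    quadSym_mul_left, quadSym_pow_left _ hE.ne_zero]
  push_cast
  ring

theorem quadSym_sq_of_not_dvd {p g : F[X]} (hirr : Irreducible p) (hg : g.Monic)
    (h : ¬ p ∣ g) : quadSym p g ^ 2 = 1 :=
  quadSym_sq hg.ne_zero (hirr.coprime_iff_not_dvd.2 h)

theorem expand_mk_geom_mul {d : ℕ} (hd : d ≠ 0) (ε : ℂ) :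
    PowerSeries.expand d hd (PowerSeries.rescale ε (1 - PowerSeries.C 1 * PowerSeries.X)) *
      PowerSeries.expand d hd (PowerSeries.mk fun k => ε ^ k) = 1 := by
  have h1 : (PowerSeries.mk fun k => ε ^ k) = PowerSeries.rescale ε (PowerSeries.mk 1) := by
    ext k
    simp [PowerSeries.coeff_rescale]
  have h2 : (1 - PowerSeries.C 1 * PowerSeries.X : PowerSeries ℂ) * PowerSeries.mk 1 = 1 := by
    rw [map_one, one_mul, mul_comm, PowerSeries.mk_one_mul_one_sub_eq_one]
  rw [h1, ← map_mul, ← map_mul, h2, map_one, map_one]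

/-- Splitting off the powers of a prime `p` from the fixed polynomials. -/
theorem genSeries_twistedWeight [Finite F] (hn : 1 ≤ n) (hF : Nat.card F % 4 = 1)
    {H : (Fin (n + 1) → F[X]) → ℂ} (hH : IsTwistedMultiplicative H)
    (i : Fin (n + 1)) {p : F[X]} (hp : p.Monic) (hirr : Irreducible p)
    {v : Fin (n + 1) → ℕ} (hv : v i = 0)
    {f : Fin (n + 1) → F[X]} (hfi : f i = 1) (hf : ∀ j, (f j).Monic) (hpf : ∀ j, ¬ p ∣ f j)
    {E : F[X]} (hE : E.Monic) :
    genSeries (twistedWeight H i (fun j => p ^ v j * f j) E) =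
      PowerSeries.C (splitSign p v f : ℂ) *
        PowerSeries.expand p.natDegree hirr.natDegree_pos.ne'
          (PowerSeries.rescale
            ((quadSym p (f (i + 1)) * quadSym p (f (i - 1)) * quadSym p E : ℤ) : ℂ)
            (clearPole 1 (v (i - 1) + v (i + 1)) (localSeries H i p v))) *
        genSeries (twistedWeight H i f (nextModulus p E (v (i - 1) + v (i + 1)))) := by
  classical
  have hδ := hirr.natDegree_pos.ne'
  set ε : ℂ := ((quadSym p (f (i + 1)) * quadSym p (f (i - 1)) * quadSym p E : ℤ) : ℂ) with hε
  set E' := nextModulus p E (v (i - 1) + v (i + 1)) with hE'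
  have hmk : (PowerSeries.mk fun k => (splitSign p v f : ℂ) *
      H (fun j => p ^ Function.update v i k j) * ε ^ k) =
      PowerSeries.C (splitSign p v f : ℂ) * PowerSeries.rescale ε (localSeries H i p v) := by
    ext k
    rw [PowerSeries.coeff_mk, PowerSeries.coeff_C_mul, PowerSeries.coeff_rescale, localSeries,
      PowerSeries.coeff_mk]
    ring
  set w' : F[X] → ℂ := fun g => if p ∣ g then 0 else twistedWeight H i f E' g with hw'
  have h1 : genSeries (twistedWeight H i (fun j => p ^ v j * f j) E) =
      PowerSeries.expand p.natDegree hδ (PowerSeries.C (splitSign p v f : ℂ) *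
        PowerSeries.rescale ε (localSeries H i p v)) * genSeries w' := by
    rw [← hmk]
    refine genSeries_eq_expand_mul hp hirr (fun k g hg hpg => ?_) (fun g hpg => if_pos hpg)
    rw [twistedWeight_pow_mul hn hF hH i hp hirr hv hfi hf hpf hE hg hpg k, hw']
    simp only [if_neg hpg]
    rfl
  rw [h1, map_mul, PowerSeries.expand_C]
  by_cases hd : Odd (v (i - 1) + v (i + 1))
  · have hww : w' = twistedWeight H i f E' := by
      ext g
      simp only [hw']
      split_ifs with hpg
      · have : quadSym g E' = 0 := by
          rw [hE', nextModulus, if_pos hd, quadSym_eq_zero_iff (hE.mul hp).ne_zero]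
          exact fun h => hirr.not_isUnit (h.isUnit_of_dvd' hpg (dvd_mul_left p E))
        rw [twistedWeight, this, Int.cast_zero, mul_zero]
      · rfl
    rw [hww, clearPole, if_neg (Nat.not_even_iff_odd.2 hd)]
  -- For d even, w' omits the multiples of p. The splitting with v = 0 exhibits the missing Euler
  -- factor, whose inverse is the factor that `clearPole` puts into the local series.
  · have hEE : E' = E := by rw [hE', nextModulus, if_neg hd]
    have h2 : genSeries (twistedWeight H i f E) =
        PowerSeries.expand p.natDegree hδ (PowerSeries.mk fun k => ε ^ k) * genSeries w' := by
      refine genSeries_eq_expand_mul hp hirr (fun k g hg hpg => ?_) (fun g hpg => if_pos hpg)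
      have h3 := twistedWeight_pow_mul hn hF hH i hp hirr (v := fun _ => 0) rfl hfi hf hpf hE hg
        hpg k
      have h4 : (fun j => p ^ Function.update (fun _ : Fin (n + 1) => 0) i k j) =
          Function.update (fun _ => 1) i (p ^ k) := by
        ext1 j
        by_cases h : j = i
        · subst h; simp
        · simp [h]
      rw [h4, hH.update_one i _ (hp.pow k)] at h3
      simp only [splitSign, pow_zero, one_mul, mul_one, Finset.prod_const_one, Int.cast_one,
        nextModulus, add_zero, Nat.not_odd_zero, if_false] at h3
      rw [h3, hw']
      simp only [if_neg hpg, hEE]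
      rfl
    have h5 := expand_mk_geom_mul hδ ε
    rw [hEE, h2, clearPole, if_pos (Nat.not_odd_iff_even.1 hd), map_mul, map_mul]
    linear_combination (-(PowerSeries.C (splitSign p v f : ℂ) *
      PowerSeries.expand p.natDegree hδ (PowerSeries.rescale ε (localSeries H i p v)) *
      genSeries w')) * h5

end Twisted

/-! ### The functional equation for fixed polynomials -/

section TwistedFunctionalEquation

variable {F : Type} [Field F] {n : ℕ}

theorem exists_pow_mul_eq {p : F[X]} (hp : p.Monic) (hirr : Irreducible p) {i : Fin (n + 1)}
    {f : Fin (n + 1) → F[X]} (hf : ∀ j, (f j).Monic) (hfi : f i = 1) :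
    ∃ (v : Fin (n + 1) → ℕ) (f' : Fin (n + 1) → F[X]), v i = 0 ∧ f' i = 1 ∧
      (∀ j, (f' j).Monic) ∧ (∀ j, ¬ p ∣ f' j) ∧ f = fun j => p ^ v j * f' j := by
  choose v f' h1 h2 using fun j => WfDvdMonoid.max_power_factor (hf j).ne_zero hirr
  have hm : ∀ j, (f' j).Monic := fun j =>
    (hp.pow (v j)).of_mul_monic_left (by rw [← h2 j]; exact hf j)
  have hvi : v i = 0 := by
    by_contra h
    refine hirr.not_isUnit (isUnit_of_dvd_one ?_)
    rw [← hfi, h2 i]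
    exact (dvd_pow_self p h).mul_right _
  refine ⟨v, f', hvi, ?_, hm, h1, funext h2⟩
  have := h2 i
  rw [hvi, pow_zero, one_mul, hfi] at this
  exact this.symm

variable [Finite F]

theorem genSeries_congr {w w' : F[X] → ℂ} (h : ∀ g, g.Monic → w g = w' g) :
    genSeries w = genSeries w' := by
  ext k
  rw [genSeries, genSeries, PowerSeries.coeff_mk, PowerSeries.coeff_mk]
  exact Finset.sum_congr rfl fun g hg => h g (mem_monics.1 hg).1

theorem IsTwistedMultiplicative.genSeries_one {H : (Fin (n + 1) → F[X]) → ℂ}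
    (hH : IsTwistedMultiplicative H) (i : Fin (n + 1)) (E : F[X]) :
    genSeries (twistedWeight H i (fun _ => 1) E) = genSeries fun g => (quadSym g E : ℂ) :=
  genSeries_congr fun g hg => by rw [twistedWeight, hH.update_one i g hg, one_mul]

/-- One prime at a time, by induction on the total degree of f: reflexivity is multiplicative, and
what remains at the end is the L-series modulo E. Coprimality of E to the f_j keeps the modulus
squarefree when p enters it and makes ε a sign. -/
theorem hasFunctionalEquation_twistedWeight (hn : 1 ≤ n) (hF : Nat.card F % 4 = 1)
    {H : (Fin (n + 1) → F[X]) → ℂ} (hH : IsTwistedMultiplicative H) (i : Fin (n + 1))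
    {f : Fin (n + 1) → F[X]} (hf : ∀ j, (f j).Monic) (hfi : f i = 1) {E : F[X]} (hE : E.Monic)
    (hsq : Squarefree E) (hEf : ∀ j, IsCoprime E (f j))
    (hloc : ∀ p : F[X], p.Monic → Irreducible p → ∀ v : Fin (n + 1) → ℕ, v i = 0 → v ≠ 0 →
      (∀ j, p ^ v j ∣ f j) → HasFunctionalEquation 1 ((Nat.card F : ℂ) ^ p.natDegree)
        (v (i - 1) + v (i + 1)) (localSeries H i p v)) :
    HasFunctionalEquation (Nat.card F) (Nat.card F)
      (E.natDegree + (f (i - 1)).natDegree + (f (i + 1)).natDegree)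
      (genSeries (twistedWeight H i f E)) := by
  induction hN : ∑ j, (f j).natDegree using Nat.strong_induction_on generalizing f E with
  | _ N ih =>
    by_cases h0 : ∀ j, (f j).natDegree = 0
    · obtain rfl : f = fun _ => 1 := funext fun j => eq_one_of_monic_natDegree_zero (hf j) (h0 j)
      rw [hH.genSeries_one]
      simpa using hasFunctionalEquation_quadSym hF hE hsq
    · push Not at h0
      obtain ⟨j₀, hj₀⟩ := h0
      obtain ⟨p, hp, hirr, hpf⟩ := exists_monic_irreducible_factor (f j₀)
        (fun h => hj₀ (natDegree_eq_zero_of_isUnit h))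
      obtain ⟨v, f', hvi, hfi', hf', hpf', rfl⟩ := exists_pow_mul_eq hp hirr hf hfi
      beta_reduce at hf hfi hEf hloc hN hj₀ hpf ih ⊢
      have hδ := hirr.natDegree_pos
      have hvj : v j₀ ≠ 0 := by
        intro h
        rw [h, pow_zero, one_mul] at hpf
        exact hpf' j₀ hpf
      have hpE : ¬ p ∣ E := fun h => hirr.not_isUnit ((hEf j₀).isUnit_of_dvd' h hpf)
      have hdeg : ∀ j, (p ^ v j * f' j).natDegree = v j * p.natDegree + (f' j).natDegree :=
        fun j => by rw [(hp.pow _).natDegree_mul (hf' j), hp.natDegree_pow]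
      set d := v (i - 1) + v (i + 1) with hd
      have hEc : ∀ j, IsCoprime E (f' j) := fun j => (hEf j).of_isCoprime_of_dvd_right
        (dvd_mul_left _ _)
      have hpEc : IsCoprime p E := hirr.coprime_iff_not_dvd.2 hpE
      have hE'm : (nextModulus p E d).Monic := by
        unfold nextModulus; split_ifs
        exacts [hE.mul hp, hE]
      have hE'sq : Squarefree (nextModulus p E d) := by
        unfold nextModulus; split_ifs
        · exact (squarefree_mul_iff).2 ⟨hpEc.symm.isRelPrime, hsq, hirr.squarefree⟩
        · exact hsq
      have hE'c : ∀ j, IsCoprime (nextModulus p E d) (f' j) := by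
        intro j
        unfold nextModulus; split_ifs
        · exact (hEc j).mul_left (hirr.coprime_iff_not_dvd.2 (hpf' j))
        · exact hEc j
      have hlt : ∑ j, (f' j).natDegree < N := by
        rw [← hN]
        refine Finset.sum_lt_sum (fun j _ => by rw [hdeg]; omega) ⟨j₀, Finset.mem_univ _, ?_⟩
        rw [hdeg]
        have := Nat.mul_pos (Nat.pos_of_ne_zero hvj) hδ
        omega
      have hrec := ih _ hlt hf' hfi' hE'm hE'sq hE'c
        (fun r hr hrirr u hu hu0 hdvd => hloc r hr hrirr u hu hu0
          fun j => (hdvd j).mul_left _) rfl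
      have hl := hloc p hp hirr v hvi (fun h => hvj (by rw [h]; rfl)) fun j => dvd_mul_right _ _
      rw [genSeries_twistedWeight hn hF hH i hp hirr hvi hfi' hf' hpf' hE, hdeg, hdeg,
        HasFunctionalEquation, clearPole_mul]
      have hε : (((quadSym p (f' (i + 1)) * quadSym p (f' (i - 1)) * quadSym p E : ℤ) : ℂ)) ^ 2
          = 1 := by
        have h1 := quadSym_sq_of_not_dvd hirr (hf' (i + 1)) (hpf' (i + 1))
        have h2 := quadSym_sq_of_not_dvd hirr (hf' (i - 1)) (hpf' (i - 1))
        have h3 := quadSym_sq_of_not_dvd hirr hE hpE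
        rw [← Int.cast_pow, mul_pow, mul_pow, h1, h2, h3]
        norm_num
      have hdegE : (nextModulus p E d).natDegree = E.natDegree + (d % 2) * p.natDegree := by
        unfold nextModulus
        split_ifs with h
        · rw [hE.natDegree_mul hp, Nat.odd_iff.1 h, one_mul]
        · rw [Nat.even_iff.1 (Nat.not_odd_iff_even.1 h), zero_mul, add_zero]
      -- The conductor degree is twice the centre of the local factor plus the conductor degree that
      -- remains; the parity of d decides whether p moves into the modulus.
      have hD : E.natDegree + (v (i - 1) * p.natDegree + (f' (i - 1)).natDegree) +
          (v (i + 1) * p.natDegree + (f' (i + 1)).natDegree) =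
          2 * (p.natDegree * (d / 2)) + ((nextModulus p E d).natDegree +
            (f' (i - 1)).natDegree + (f' (i + 1)).natDegree) := by
        rw [hdegE]
        have : (v (i - 1) + v (i + 1)) * p.natDegree = (2 * (d / 2) + d % 2) * p.natDegree := by
          rw [Nat.div_add_mod, hd]
        linarith
      rw [hD, Nat.mul_add_div two_pos]
      refine IsReflexive.mul ?_ ?_
      · exact (IsReflexive.expand _ hl hε).C_mul _
      · rw [clearPole_congr (d' := (nextModulus p E d).natDegree +
          (f' (i - 1)).natDegree + (f' (i + 1)).natDegree) (by simp [Nat.even_add])]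
        exact hrec

/-- A conductor of degree at most 1 puts the centre at 0, so only the constant term survives. -/
theorem clearPole_genSeries_quadSym_eq_one (hF : Nat.card F % 4 = 1) {E : F[X]} (hE : E.Monic)
    (hsq : Squarefree E) (hdeg : E.natDegree ≤ 1) :
    clearPole (Nat.card F) E.natDegree (genSeries fun g : F[X] => (quadSym g E : ℂ)) = 1 := by
  have h := hasFunctionalEquation_quadSym hF hE hsq
  rw [HasFunctionalEquation, show E.natDegree / 2 = 0 by omega] at h
  refine h.eq_one ?_
  have h0 : PowerSeries.coeff 0 (genSeries fun g : F[X] => (quadSym g E : ℂ)) = 1 := by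
    rw [genSeries, PowerSeries.coeff_mk, sum_monics, lowDegree_zero]
    simp [quadSym_one_left hE.ne_zero]
  unfold clearPole
  split_ifs
  · rw [sub_mul, one_mul, map_sub, h0, mul_assoc, PowerSeries.coeff_C_mul,
      PowerSeries.coeff_zero_X_mul, mul_zero, sub_zero]
  · exact h0

/-- When all fixed polynomials are powers of one linear polynomial, the series is the local one. -/
theorem clearPole_genSeries_pow_linear (hn : 1 ≤ n) (hF : Nat.card F % 4 = 1)
    {H : (Fin (n + 1) → F[X]) → ℂ} (hH : IsTwistedMultiplicative H) (i : Fin (n + 1))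
    {p : F[X]} (hp : p.Monic) (hdeg : p.natDegree = 1) {v : Fin (n + 1) → ℕ} (hv : v i = 0) :
    clearPole (Nat.card F) (v (i - 1) + v (i + 1))
      (genSeries (twistedWeight H i (fun j => p ^ v j) 1)) =
      clearPole 1 (v (i - 1) + v (i + 1)) (localSeries H i p v) := by
  have hirr : Irreducible p := (irreducible_of_degree_eq_one (by
    rw [degree_eq_natDegree hp.ne_zero, hdeg]; rfl))
  have hp1 : ¬ p ∣ 1 := fun h => hirr.not_isUnit (isUnit_of_dvd_one h)
  have h1 := genSeries_twistedWeight hn hF hH i hp hirr hv (f := fun _ => 1) rfl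
    (fun _ => monic_one) (fun _ => hp1) (E := 1) monic_one
  simp only [mul_one, splitSign, quadSym_one_right, one_pow, Finset.prod_const_one, Int.cast_one,
    map_one, one_mul, PowerSeries.rescale_one, RingHom.id_apply, hH.genSeries_one] at h1
  have h2 : ∀ (δ : ℕ) (h : δ ≠ 0) (W : PowerSeries ℂ), δ = 1 → PowerSeries.expand δ h W = W := by
    rintro δ h W rfl
    exact PowerSeries.expand_one_apply W
  rw [h2 _ _ _ hdeg] at h1
  rw [h1, clearPole_mul]
  set d := v (i - 1) + v (i + 1)
  have h3 : clearPole (Nat.card F) d (genSeries fun g => (quadSym g (nextModulus p 1 d) : ℂ)) =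
      1 := by
    rcases Nat.even_or_odd d with hd | hd
    · rw [nextModulus, if_neg (Nat.not_odd_iff_even.2 hd),
        clearPole_congr (d' := (1 : F[X]).natDegree) (by simpa using hd)]
      exact clearPole_genSeries_quadSym_eq_one hF monic_one squarefree_one (by simp)
    · rw [nextModulus, if_pos hd, one_mul,
        clearPole_congr (d' := p.natDegree) (by simpa [hdeg] using hd)]
      exact clearPole_genSeries_quadSym_eq_one hF hp hirr.squarefree hdeg.le
  rw [h3, mul_one]

end TwistedFunctionalEquation

/-! ### Coefficient polynomials, dominance and local series -/

section CoefficientPolynomials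

variable {n : ℕ}

/-- The evaluations force E to equal its reflection t ↦ D + 1 - t, while all its terms have degree
above the fixed point (D + 1)/2. -/
theorem Polynomial.eq_zero_of_eval_inv_eq {E : ℂ[X]} {D : ℕ} (hdeg : E.natDegree ≤ D)
    (hdom : ∀ t, E.coeff t ≠ 0 → D + 1 < 2 * t)
    (hE : ∀ (F : Type) [Field F] [Finite F], Nat.card F % 4 = 1 →
      E.eval (Nat.card F : ℂ) = (Nat.card F : ℂ) ^ (D + 1) * E.eval (Nat.card F : ℂ)⁻¹) :
    E = 0 := by
  have hrefl : E = reflect (D + 1) E := by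
    -- The fields with 5^{j+1} elements supply infinitely many orders congruent to 1 modulo 4.
    refine eq_of_infinite_eval_eq _ _ (Set.infinite_of_injective_forall_mem
      (f := fun j : ℕ => ((5 ^ (j + 1) : ℕ) : ℂ)) (fun a b hab => ?_) fun j => ?_)
    · have h : 5 ^ (a + 1) = 5 ^ (b + 1) := Nat.cast_injective (R := ℂ) hab
      have := Nat.pow_right_injective (le_refl 2 |>.trans (by norm_num : 2 ≤ 5)) h
      omega
    · have : Fact (Nat.Prime 5) := ⟨by norm_num⟩
      have hcard := GaloisField.card 5 (j + 1) j.succ_ne_zero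
      have : Finite (GaloisField 5 (j + 1)) :=
        Nat.finite_of_card_ne_zero (by rw [hcard]; positivity)
      have h1 := hE (GaloisField 5 (j + 1)) (by
        rw [hcard, Nat.pow_mod]; norm_num)
      rw [hcard] at h1
      set Q : ℂ := ((5 ^ (j + 1) : ℕ) : ℂ) with hQ
      have hQ0 : Q ≠ 0 := by rw [hQ]; exact_mod_cast (by positivity : 5 ^ (j + 1) ≠ 0)
      let _ : Invertible Q := invertibleOfNonzero hQ0
      let _ : Invertible Q⁻¹ := invertibleOfNonzero (inv_ne_zero hQ0)
      have h2 := eval₂_reflect_mul_pow (RingHom.id ℂ) Q⁻¹ (D + 1) E (hdeg.trans D.le_succ)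
      rw [invOf_eq_inv, inv_inv, ← eval, ← eval] at h2
      change E.eval Q = (reflect (D + 1) E).eval Q
      rw [h1, ← h2, mul_left_comm, ← mul_pow, mul_inv_cancel₀ hQ0, one_pow, mul_one]
  ext t
  rw [coeff_zero]
  by_contra h
  have h1 := hdom t h
  have h2 : t ≤ D := (le_natDegree_of_ne_zero h).trans hdeg
  rw [hrefl, coeff_reflect, revAt_le (by omega)] at h
  have h3 := hdom _ h
  omega

theorem Function.sum_update_of_eq_zero {v : Fin (n + 1) → ℕ} {i : Fin (n + 1)} (hv : v i = 0)
    (k : ℕ) : ∑ j, Function.update v i k j = ∑ j, v j + k := by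
  have h : ∀ j, Function.update v i k j = v j + if j = i then k else 0 := by
    intro j
    by_cases h : j = i
    · subst h; simp [hv]
    · simp [h]
  simp [h, Finset.sum_add_distrib]

/-- The series with coefficients `c_a(x)`, where the `i`-th exponent of `a` varies. -/
noncomputable def coeffSeries (c : (Fin (n + 1) → ℕ) → ℂ[X]) (i : Fin (n + 1))
    (v : Fin (n + 1) → ℕ) (x : ℂ) : PowerSeries ℂ :=
  PowerSeries.mk fun k => (c (Function.update v i k)).eval x

/-- The coefficients of `coeffSeries`, after clearing the pole at `1 / x`, as polynomials
in `x`. -/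
noncomputable def clearedCoeff (c : (Fin (n + 1) → ℕ) → ℂ[X]) (i : Fin (n + 1))
    (v : Fin (n + 1) → ℕ) (k : ℕ) : ℂ[X] :=
  c (Function.update v i k) -
    if Even (v (i - 1) + v (i + 1)) ∧ k ≠ 0 then X * c (Function.update v i (k - 1)) else 0

theorem coeff_clearPole (r : ℂ) (d k : ℕ) (W : PowerSeries ℂ) :
    PowerSeries.coeff k (clearPole r d W) = PowerSeries.coeff k W -
      if Even d ∧ k ≠ 0 then r * PowerSeries.coeff (k - 1) W else 0 := by
  unfold clearPole
  by_cases hd : Even d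
  · rw [if_pos hd, sub_mul, one_mul, map_sub, mul_assoc, PowerSeries.coeff_C_mul]
    rcases k with _ | k
    · simp
    · rw [PowerSeries.coeff_succ_X_mul, if_pos ⟨hd, k.succ_ne_zero⟩, Nat.add_sub_cancel]
  · simp [hd]

theorem eval_clearedCoeff (c : (Fin (n + 1) → ℕ) → ℂ[X]) (i : Fin (n + 1))
    (v : Fin (n + 1) → ℕ) (k : ℕ) (x : ℂ) :
    (clearedCoeff c i v k).eval x =
      PowerSeries.coeff k (clearPole x (v (i - 1) + v (i + 1)) (coeffSeries c i v x)) := by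
  rw [coeff_clearPole, clearedCoeff, eval_sub, coeffSeries, PowerSeries.coeff_mk,
    PowerSeries.coeff_mk]
  split_ifs <;> simp

variable {H : LocalWeights n} {c : (Fin (n + 1) → ℕ) → ℂ[X]}

theorem SatisfiesAxioms.natDegree_clearedCoeff_le (hc : SatisfiesAxioms n H c)
    {i : Fin (n + 1)} {v : Fin (n + 1) → ℕ} (hv : v i = 0) (k : ℕ) :
    (clearedCoeff c i v k).natDegree ≤ ∑ j, v j + k := by
  refine (natDegree_sub_le _ _).trans (max_le ?_ ?_)
  · exact (hc.degree_le _).trans (Function.sum_update_of_eq_zero hv k).le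
  · split_ifs with h
    · refine natDegree_mul_le.trans ?_
      have := hc.degree_le (Function.update v i (k - 1))
      rw [Function.sum_update_of_eq_zero hv] at this
      have := natDegree_X_le (R := ℂ)
      have := h.2
      omega
    · simp

theorem SatisfiesAxioms.eq_X (hc : SatisfiesAxioms n H c) {v : Fin (n + 1) → ℕ}
    (hv : ∑ j, v j = 1) : c v = X := by
  obtain ⟨j, -, hj⟩ := Finset.exists_ne_zero_of_sum_ne_zero (hv ▸ one_ne_zero)
  have h1 := Finset.add_sum_erase Finset.univ v (Finset.mem_univ j)
  have h2 : ∑ x ∈ Finset.univ.erase j, v x = 0 := by omega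
  have h3 : v = Function.update (fun _ => 0) j 1 := by
    ext x
    by_cases hx : x = j
    · subst hx; simp; omega
    · rw [Function.update_of_ne hx]
      exact (Finset.sum_eq_zero_iff.1 h2) x (by simp [hx])
  rw [h3, hc.initial_coeff, pow_one]

/-- Clearing the pole preserves dominance: the factor X raises 2t by 2, while passing from k - 1 to
k raises the bound by 1. If the exponents for k - 1 have sum 1, outside the range of dominance, then
the term is X · X and is checked directly. -/
theorem SatisfiesAxioms.lt_of_coeff_clearedCoeff_ne_zero (hc : SatisfiesAxioms n H c)
    {i : Fin (n + 1)} {v : Fin (n + 1) → ℕ} (hv : v i = 0) {k : ℕ}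
    (hk : 2 ≤ ∑ j, v j + k) {t : ℕ} (ht : (clearedCoeff c i v k).coeff t ≠ 0) :
    ∑ j, v j + k + 1 < 2 * t := by
  have hs := Function.sum_update_of_eq_zero hv
  rw [clearedCoeff, coeff_sub] at ht
  by_cases h1 : (c (Function.update v i k)).coeff t = 0
  · rw [h1, zero_sub, neg_ne_zero] at ht
    split_ifs at ht with h
    · rcases t with _ | t
      · simp at ht
      rw [coeff_X_mul] at ht
      by_cases h2 : 2 ≤ ∑ j, v j + (k - 1)
      · have := hc.dominance _ (by rw [hs]; exact h2) t ht
        rw [hs] at this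
        omega
      · rw [hc.eq_X (by rw [hs]; omega), coeff_X] at ht
        have : 1 = t := by by_contra h; simp [h] at ht
        omega
    · simp at ht
  · have := hc.dominance _ (by rw [hs]; exact hk) t h1
    rwa [hs] at this

/-- The local coefficients are those of the global series, reflected. -/
theorem SatisfiesAxioms.coeff_clearPole_localSeries (hc : SatisfiesAxioms n H c) {F : Type}
    [Field F] [Finite F] (hF : Nat.card F % 4 = 1) {i : Fin (n + 1)} {v : Fin (n + 1) → ℕ}
    (hv : v i = 0) {p : F[X]} (hp : p.Monic) (hirr : Irreducible p) (k : ℕ) :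
    PowerSeries.coeff k (clearPole 1 (v (i - 1) + v (i + 1)) (localSeries (H F) i p v)) =
      ((Nat.card F : ℂ) ^ p.natDegree) ^ (∑ j, v j + k) *
        (clearedCoeff c i v k).eval ((Nat.card F : ℂ) ^ p.natDegree)⁻¹ := by
  have hP : (Nat.card F : ℂ) ^ p.natDegree ≠ 0 :=
    pow_ne_zero _ (Nat.cast_ne_zero.2 Nat.card_pos.ne')
  rw [eval_clearedCoeff, coeff_clearPole, coeff_clearPole, localSeries, coeffSeries]
  simp only [PowerSeries.coeff_mk]
  rw [hc.local_global F hF p hp hirr, hc.local_global F hF p hp hirr,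
    Function.sum_update_of_eq_zero hv, Function.sum_update_of_eq_zero hv]
  split_ifs with h
  · obtain ⟨k, rfl⟩ := Nat.exists_eq_succ_of_ne_zero h.2
    rw [Nat.succ_eq_add_one, Nat.add_sub_cancel, ← add_assoc, pow_succ]
    field_simp
  · ring

/-- The local series is the global one at x = 1/P with its k-th coefficient scaled by P^{s+k}. For a
+ b = 2m this scaling turns reflexivity with parameter 1/P into reflexivity with parameter P. -/
theorem SatisfiesAxioms.hasFunctionalEquation_localSeries (hc : SatisfiesAxioms n H c)
    {F : Type} [Field F] [Finite F] (hF : Nat.card F % 4 = 1) {i : Fin (n + 1)}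
    {v : Fin (n + 1) → ℕ} (hv : v i = 0)
    (h : ∀ x : ℂ, x ≠ 0 →
      HasFunctionalEquation x x (v (i - 1) + v (i + 1)) (coeffSeries c i v x))
    {p : F[X]} (hp : p.Monic) (hirr : Irreducible p) :
    HasFunctionalEquation 1 ((Nat.card F : ℂ) ^ p.natDegree) (v (i - 1) + v (i + 1))
      (localSeries (H F) i p v) := by
  have hP : (Nat.card F : ℂ) ^ p.natDegree ≠ 0 :=
    pow_ne_zero _ (Nat.cast_ne_zero.2 Nat.card_pos.ne')
  have hl := fun k => hc.coeff_clearPole_localSeries hF hv hp hirr k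
  have hx := h _ (inv_ne_zero hP)
  set P : ℂ := (Nat.card F : ℂ) ^ p.natDegree
  set m := (v (i - 1) + v (i + 1)) / 2 with hm
  simp only [eval_clearedCoeff] at hl
  refine ⟨fun k hk => ?_, fun a b hab => ?_⟩
  · rw [hl, hx.1 k hk, mul_zero]
  · rw [hl, hl]
    have h1 := hx.2 a b hab
    rw [← hm] at h1 hab ⊢
    rw [inv_pow, inv_pow, inv_mul_eq_div, inv_mul_eq_div,
      div_eq_div_iff (pow_ne_zero _ hP) (pow_ne_zero _ hP)] at h1
    have h2 : P ^ m * P ^ m = P ^ a * P ^ b := by rw [← pow_add, ← pow_add, hab, two_mul]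
    rw [pow_add, pow_add]
    linear_combination P ^ m * P ^ (∑ j, v j) * h1 + P ^ (∑ j, v j) * PowerSeries.coeff b
      (clearPole P⁻¹ (v (i - 1) + v (i + 1)) (coeffSeries c i v P⁻¹)) * h2

end CoefficientPolynomials

/-! ### Induction on the fixed exponents -/

section GlobalSeries

variable {n : ℕ} {H : LocalWeights n} {c : (Fin (n + 1) → ℕ) → ℂ[X]}

theorem SatisfiesAxioms.isTwistedMultiplicative (hc : SatisfiesAxioms n H c) {F : Type} [Field F]
    [Finite F] (hF : Nat.card F % 4 = 1) : IsTwistedMultiplicative (H F) :=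
  ⟨hc.twisted_mult F hF, hc.initial_weight F hF⟩

variable (F : Type) [Field F] [Finite F]

/-- The tuples of monic polynomials of prescribed degrees, as a finite set. -/
noncomputable def monicTuplesFinset (a : Fin (n + 1) → ℕ) : Finset (Fin (n + 1) → F[X]) :=
  Fintype.piFinset fun j => monics F (a j)

variable {F}

theorem mem_monicTuplesFinset {a : Fin (n + 1) → ℕ} {f : Fin (n + 1) → F[X]} :
    f ∈ monicTuplesFinset F a ↔ ∀ j, (f j).Monic ∧ (f j).natDegree = a j := by
  simp [monicTuplesFinset, mem_monics]

theorem eq_one_of_mem_monicTuplesFinset {v : Fin (n + 1) → ℕ} {i : Fin (n + 1)} (hv : v i = 0)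
    {f : Fin (n + 1) → F[X]} (hf : f ∈ monicTuplesFinset F v) : f i = 1 := by
  have h := mem_monicTuplesFinset.1 hf i
  exact eq_one_of_monic_natDegree_zero h.1 (h.2.trans hv)

theorem sum_monicTuplesFinset_update {v : Fin (n + 1) → ℕ} {i : Fin (n + 1)} (hv : v i = 0)
    (k : ℕ) (W : (Fin (n + 1) → F[X]) → ℂ) :
    ∑ f ∈ monicTuplesFinset F (Function.update v i k), W f =
      ∑ f ∈ monicTuplesFinset F v, ∑ g ∈ monics F k, W (Function.update f i g) := by
  rw [← Finset.sum_product']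
  symm
  refine Finset.sum_nbij' (fun x => Function.update x.1 i x.2)
    (fun f => (Function.update f i 1, f i)) ?_ ?_ ?_ ?_ fun _ _ => rfl
  · rintro ⟨f, g⟩ hx
    rw [Finset.mem_product, mem_monicTuplesFinset, mem_monics] at hx
    rw [mem_monicTuplesFinset]
    intro j
    by_cases h : j = i
    · subst h; simpa using hx.2
    · simpa [h] using hx.1 j
  · intro f hf
    rw [mem_monicTuplesFinset] at hf
    rw [Finset.mem_product, mem_monicTuplesFinset, mem_monics]
    refine ⟨fun j => ?_, by simpa using hf i⟩
    by_cases h : j = i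
    · subst h; simp [hv]
    · simpa [h] using hf j
  · rintro ⟨f, g⟩ hx
    rw [Finset.mem_product] at hx
    have := eq_one_of_mem_monicTuplesFinset hv hx.1
    ext1
    · simp [← this]
    · simp
  · intro f _
    simp

theorem SatisfiesAxioms.coeffSeries_eq_sum (hc : SatisfiesAxioms n H c)
    (hF : Nat.card F % 4 = 1) {i : Fin (n + 1)} {v : Fin (n + 1) → ℕ} (hv : v i = 0) :
    coeffSeries c i v (Nat.card F) =
      ∑ f ∈ monicTuplesFinset F v, genSeries (twistedWeight (H F) i f 1) := by
  ext k
  rw [coeffSeries, PowerSeries.coeff_mk, hc.global F hF, map_sum]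
  have hset : monicTuples F (Function.update v i k) =
      (monicTuplesFinset F (Function.update v i k) : Set (Fin (n + 1) → F[X])) := by
    ext f
    rw [Finset.mem_coe, mem_monicTuplesFinset]
    rfl
  rw [hset, finsum_mem_coe_finset, sum_monicTuplesFinset_update hv]
  refine Finset.sum_congr rfl fun f _ => ?_
  rw [genSeries, PowerSeries.coeff_mk]
  refine Finset.sum_congr rfl fun g _ => ?_
  rw [twistedWeight, quadSym_one_right, Int.cast_one, mul_one]

theorem irreducible_of_mem_monics_one {p : F[X]} (hp : p ∈ monics F 1) : Irreducible p := by
  obtain ⟨hp, hdeg⟩ := mem_monics.1 hp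
  exact irreducible_of_degree_eq_one (by rw [degree_eq_natDegree hp.ne_zero, hdeg]; rfl)

theorem injOn_pow_monics_one {v : Fin (n + 1) → ℕ} (hv : v ≠ 0) :
    Set.InjOn (fun (p : F[X]) j => p ^ v j) (monics F 1 : Set F[X]) := by
  obtain ⟨j, hj⟩ := Function.ne_iff.1 hv
  intro p hp p' hp' h
  have h1 : p ∣ p' ^ v j := by
    have h2 : p ^ v j = p' ^ v j := congrFun h j
    exact h2 ▸ dvd_pow_self p hj
  have hirr := irreducible_of_mem_monics_one hp
  have hirr' := irreducible_of_mem_monics_one hp'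
  exact eq_of_monic_of_associated (mem_monics.1 hp).1 (mem_monics.1 hp').1
    (hirr.associated_of_dvd hirr' (hirr.prime.dvd_of_dvd_pow h1))

/-- Equality would require p to use up the whole degree of every entry, hence p linear and every f_j
equal to p^{v_j}. -/
theorem sum_lt_of_pow_dvd {v : Fin (n + 1) → ℕ} (hv : v ≠ 0) {f : Fin (n + 1) → F[X]}
    (hf : f ∈ monicTuplesFinset F v) (hfp : ∀ p ∈ monics F 1, f ≠ fun j => p ^ v j)
    {p : F[X]} (hp : p.Monic) (hirr : Irreducible p) {u : Fin (n + 1) → ℕ}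
    (hu : ∀ j, p ^ u j ∣ f j) : ∑ j, u j < ∑ j, v j := by
  rw [mem_monicTuplesFinset] at hf
  have hle : ∀ j, u j * p.natDegree ≤ v j := fun j => by
    rw [← hp.natDegree_pow, ← (hf j).2]
    exact natDegree_le_of_dvd (hu j) (hf j).1.ne_zero
  have hδ := hirr.natDegree_pos
  have hle' : ∀ j, u j ≤ v j := fun j => (Nat.le_mul_of_pos_right _ hδ).trans (hle j)
  refine lt_of_le_of_ne (Finset.sum_le_sum fun j _ => hle' j) fun heq => ?_
  have huv : u = v := funext fun j =>
    (Finset.sum_eq_sum_iff_of_le fun j _ => hle' j).1 heq j (Finset.mem_univ j)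
  subst huv
  obtain ⟨j, hj⟩ := Function.ne_iff.1 hv
  have hdeg : p.natDegree = 1 := by
    have h1 : u j * p.natDegree ≤ u j * 1 := by simpa using hle j
    have := Nat.le_of_mul_le_mul_left h1 (Nat.pos_of_ne_zero hj)
    omega
  refine hfp p (mem_monics.2 ⟨hp, hdeg⟩) (funext fun j => ?_)
  refine (eq_of_monic_of_dvd_of_natDegree_le (hp.pow _) (hf j).1 (hu j) ?_)
  rw [hp.natDegree_pow, hdeg, mul_one, (hf j).2]

theorem IsReflexive.congr {q : ℂ} {m : ℕ} {M N : PowerSeries ℂ} (h : M = N)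
    (hM : IsReflexive q m M) : IsReflexive q m N := h ▸ hM

/-- The global series minus `q` copies of the local series has the functional equation, if the
functional equations hold for smaller exponents. -/
theorem SatisfiesAxioms.isReflexive_sub (hn : 1 ≤ n) (hc : SatisfiesAxioms n H c)
    (hF : Nat.card F % 4 = 1) {i : Fin (n + 1)} {v : Fin (n + 1) → ℕ} (hv : v i = 0)
    (hv0 : v ≠ 0)
    (ih : ∀ u : Fin (n + 1) → ℕ, u i = 0 → ∑ j, u j < ∑ j, v j → ∀ x : ℂ, x ≠ 0 →
      HasFunctionalEquation x x (u (i - 1) + u (i + 1)) (coeffSeries c i u x)) :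
    IsReflexive (Nat.card F) ((v (i - 1) + v (i + 1)) / 2)
      (PowerSeries.mk fun k => (clearedCoeff c i v k).eval (Nat.card F : ℂ) -
        (Nat.card F : ℂ) ^ (∑ j, v j + k + 1) *
          (clearedCoeff c i v k).eval (Nat.card F : ℂ)⁻¹) := by
  classical
  set d := v (i - 1) + v (i + 1) with hd
  have hH := hc.isTwistedMultiplicative hF
  -- The exceptional tuples: all entries are powers v_j of one linear polynomial. Only for these
  -- does the local factor have exponents as large as v.
  set B := (monics F 1).image fun (p : F[X]) (j : Fin (n + 1)) => p ^ v j with hB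
  have hBT : B ⊆ monicTuplesFinset F v := by
    intro f hf
    obtain ⟨p, hp, rfl⟩ := Finset.mem_image.1 hf
    rw [mem_monics] at hp
    rw [mem_monicTuplesFinset]
    exact fun j => ⟨hp.1.pow _, by rw [hp.1.natDegree_pow, hp.2, mul_one]⟩
  have hgood : IsReflexive (Nat.card F) (d / 2) (∑ f ∈ monicTuplesFinset F v \ B,
      clearPole (Nat.card F) d (genSeries (twistedWeight (H F) i f 1))) := by
    refine IsReflexive.sum fun f hf => ?_
    rw [Finset.mem_sdiff] at hf
    have hf' := mem_monicTuplesFinset.1 hf.1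
    have h := hasFunctionalEquation_twistedWeight hn hF hH i (fun j => (hf' j).1)
      (eq_one_of_mem_monicTuplesFinset hv hf.1) monic_one squarefree_one
      (fun j => isCoprime_one_left) (fun p hp hirr u hu _ hdvd =>
        hc.hasFunctionalEquation_localSeries hF hu (ih u hu
          (sum_lt_of_pow_dvd hv0 hf.1 (fun p hp h => hf.2 (Finset.mem_image.2 ⟨p, hp, h.symm⟩))
            hp hirr hdvd)) hp hirr)
    rw [natDegree_one, zero_add, (hf' _).2, (hf' _).2] at h
    exact h
  have hbad : ∀ k, PowerSeries.coeff k
      (∑ f ∈ B, clearPole (Nat.card F) d (genSeries (twistedWeight (H F) i f 1))) =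
      (Nat.card F : ℂ) ^ (∑ j, v j + k + 1) *
          (clearedCoeff c i v k).eval (Nat.card F : ℂ)⁻¹ := by
    intro k
    rw [Finset.sum_image (injOn_pow_monics_one hv0), map_sum, Finset.sum_congr rfl
      (g := fun _ => (Nat.card F : ℂ) ^ (∑ j, v j + k) *
          (clearedCoeff c i v k).eval (Nat.card F : ℂ)⁻¹), Finset.sum_const, card_monics, pow_one,
          nsmul_eq_mul, pow_succ]
    · ring
    · intro p hp
      have hirr := irreducible_of_mem_monics_one hp
      obtain ⟨hp, hdeg⟩ := mem_monics.1 hp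
      rw [clearPole_genSeries_pow_linear hn hF hH i hp hdeg hv,
        hc.coeff_clearPole_localSeries hF hv hp hirr, hdeg, pow_one]
  refine hgood.congr ?_
  ext k
  rw [PowerSeries.coeff_mk, eval_clearedCoeff, hc.coeffSeries_eq_sum hF hv, ← hd, clearPole_sum,
    ← Finset.sum_sdiff hBT, map_add, hbad, add_sub_cancel_right]

theorem coeffSeries_functionalEquation_zero (hc : SatisfiesAxioms n H c) (i : Fin (n + 1))
    (x : ℂ) : HasFunctionalEquation x x 0 (coeffSeries c i (fun _ => 0) x) := by
  have h : clearPole x 0 (coeffSeries c i (fun _ => 0) x) = 1 := by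
    ext k
    rw [coeff_clearPole, coeffSeries, PowerSeries.coeff_mk, PowerSeries.coeff_mk,
      hc.initial_coeff, hc.initial_coeff, PowerSeries.coeff_one]
    rcases k with _ | k
    · simp
    · simp [pow_succ']
  rw [HasFunctionalEquation, h]
  refine ⟨fun k hk => ?_, fun a b hab => ?_⟩
  · rw [PowerSeries.coeff_one, if_neg (by omega)]
  · obtain ⟨rfl, rfl⟩ : a = 0 ∧ b = 0 := by omega
    simp

/-- For n ≥ 2 the two neighbours of i are distinct, so no exponent is counted twice. -/
theorem add_le_sum_of_two_le (hn : 2 ≤ n) (v : Fin (n + 1) → ℕ) (i : Fin (n + 1)) :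
    v (i - 1) + v (i + 1) ≤ ∑ j, v j := by
  have hne : i - 1 ≠ i + 1 := by
    intro h
    have h1 : i + 1 + 1 = i := by rw [← h, sub_add_cancel]
    rw [add_assoc, add_eq_left] at h1
    have h2 := congrArg Fin.val h1
    rw [Fin.val_add, Fin.val_one', Nat.mod_eq_of_lt (by omega : 1 < n + 1), Fin.val_zero,
      Nat.mod_eq_of_lt (by omega)] at h2
    omega
  rw [← Finset.sum_pair hne]
  exact Finset.sum_le_univ_sum_of_nonneg fun _ => Nat.zero_le _

theorem SatisfiesAxioms.hasFunctionalEquation_coeffSeries (hn : 2 ≤ n)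
    (hc : SatisfiesAxioms n H c) (i : Fin (n + 1)) (v : Fin (n + 1) → ℕ) (hv : v i = 0) :
    ∀ x : ℂ, x ≠ 0 →
      HasFunctionalEquation x x (v (i - 1) + v (i + 1)) (coeffSeries c i v x) := by
  induction hN : ∑ j, v j using Nat.strong_induction_on generalizing v with
  | _ s ih =>
    by_cases hv0 : v = 0
    · subst hv0
      exact fun x _ => coeffSeries_functionalEquation_zero hc i x
    have hs0 : ∑ j, v j ≠ 0 := fun h => hv0 (funext fun j =>
      (Finset.sum_eq_zero_iff.1 h) j (Finset.mem_univ j))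
    have key := fun (F : Type) [Field F] [Finite F] (hF : Nat.card F % 4 = 1) =>
      hc.isReflexive_sub (by omega) hF hv hv0 fun u hu hlt => ih _ (hN ▸ hlt) u hu rfl
    have hcard : ∀ (F : Type) [Field F] [Finite F], (Nat.card F : ℂ) ≠ 0 :=
      fun F _ _ => Nat.cast_ne_zero.2 Nat.card_pos.ne'
    have hds := add_le_sum_of_two_le hn v i
    set m := (v (i - 1) + v (i + 1)) / 2 with hm
    have hvan : ∀ k, 2 * m < k → clearedCoeff c i v k = 0 := by
      intro k hk
      refine eq_zero_of_eval_inv_eq (hc.natDegree_clearedCoeff_le hv k)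
        (fun t ht => hc.lt_of_coeff_clearedCoeff_ne_zero hv (by omega) ht) ?_
      intro F _ _ hF
      have := (key F hF).1 k hk
      rw [PowerSeries.coeff_mk] at this
      exact sub_eq_zero.1 this
    have hle : ∀ a b, a + b = 2 * m → b ≤ a →
        clearedCoeff c i v a = X ^ (a - m) * clearedCoeff c i v b := by
      intro a b hab hba
      -- If m ≥ 1, the fixed exponents sum to at least 2, so dominance applies to b as well, even
      -- when b = 0.
      by_cases hm0 : m = 0
      · obtain ⟨rfl, rfl⟩ : a = 0 ∧ b = 0 := by omega
        simp
      rw [← sub_eq_zero]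
      -- Multiplication by X^{a-m} turns the dominance bound for b into the one for a, because b +
      -- 2(a - m) = a.
      refine eq_zero_of_eval_inv_eq (D := ∑ j, v j + a) ?_ (fun t ht => ?_) ?_
      · refine (natDegree_sub_le _ _).trans (max_le (hc.natDegree_clearedCoeff_le hv a) ?_)
        refine natDegree_mul_le.trans ?_
        have := hc.natDegree_clearedCoeff_le hv b
        rw [natDegree_X_pow]
        omega
      · rw [coeff_sub] at ht
        by_cases h1 : (clearedCoeff c i v a).coeff t = 0
        · rw [h1, zero_sub, neg_ne_zero, coeff_X_pow_mul'] at ht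
          split_ifs at ht with h2
          · have := hc.lt_of_coeff_clearedCoeff_ne_zero hv (by omega) ht
            omega
          · exact absurd rfl ht
        · exact hc.lt_of_coeff_clearedCoeff_ne_zero hv (by omega) h1
      · intro F _ _ hF
        have h := (key F hF).2 a b hab
        have hQ := hcard F
        rw [PowerSeries.coeff_mk, PowerSeries.coeff_mk] at h
        rw [eval_sub, eval_sub, eval_mul, eval_mul, eval_pow, eval_pow, eval_X, eval_X]
        obtain ⟨r, hr⟩ := Nat.exists_eq_add_of_le (show m ≤ a by omega)
        have hb : m = b + r := by omega
        generalize (Nat.card F : ℂ) = Q at *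
        generalize eval Q (clearedCoeff c i v a) = A at *
        generalize eval Q (clearedCoeff c i v b) = B at *
        generalize eval Q⁻¹ (clearedCoeff c i v a) = A' at *
        generalize eval Q⁻¹ (clearedCoeff c i v b) = B' at *
        rw [show a - m = r by omega]
        have hQm : Q ^ m ≠ 0 := pow_ne_zero _ hQ
        refine mul_left_cancel₀ hQm ?_
        have hinv : Q ^ r * Q⁻¹ ^ r = 1 := by rw [← mul_pow, mul_inv_cancel₀ hQ, one_pow]
        clear_value m
        subst hr
        subst hb
        simp only [pow_add] at h ⊢
        linear_combination h + Q ^ b * Q ^ r * Q ^ (∑ j, v j) * Q ^ b * Q ^ 1 * Q ^ r * B' * hinv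
    intro x hx
    refine ⟨fun k hk => ?_, fun a b hab => ?_⟩
    · rw [← eval_clearedCoeff, hvan k hk, eval_zero]
    · rw [← hm] at hab ⊢
      rw [← eval_clearedCoeff, ← eval_clearedCoeff]
      rcases le_total b a with h | h
      · rw [hle a b hab h, eval_mul, eval_pow, eval_X, ← mul_assoc, ← pow_add]
        congr 2; omega
      · rw [hle b a (by omega) h, eval_mul, eval_pow, eval_X, ← mul_assoc, ← pow_add]
        congr 2; omega

end GlobalSeries

/-! ### Recurrences with integer indices -/

section FunctionalEquations

variable {n : ℕ}

/-- Outside 0 ≤ k ≤ 2m both sides vanish; inside, this is reflexivity divided by q^m. -/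
theorem IsReflexive.zpow_eq {q : ℂ} (hq : q ≠ 0) {m : ℕ} {W : PowerSeries ℂ}
    (hW : IsReflexive q m W) {f : ℤ → ℂ} (hf : ∀ k : ℕ, f k = PowerSeries.coeff k W)
    (hneg : ∀ k < 0, f k = 0) (k : ℤ) : f k = q ^ (k - m) * f (2 * m - k) := by
  have hbig : ∀ k : ℤ, 2 * (m : ℤ) < k → f k = 0 := by
    intro k hk
    lift k to ℕ using by omega
    rw [hf, hW.1 k (by omega)]
  rcases lt_or_ge k 0 with h | h
  · rw [hneg k h, hbig _ (by omega), mul_zero]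
  rcases lt_or_ge (2 * (m : ℤ)) k with h' | h'
  · rw [hbig k h', hneg _ (by omega), mul_zero]
  · lift k to ℕ using h
    have h1 := hW.2 k (2 * m - k) (by omega)
    rw [← hf, ← hf, Nat.cast_sub (by omega)] at h1
    push_cast at h1
    rw [zpow_sub₀ hq, zpow_natCast, zpow_natCast, div_mul_eq_mul_div,
      eq_div_iff (pow_ne_zero _ hq), mul_comm, h1]

theorem IsAxiomaticSeries.satisfiesFunctionalEquations (hn : 2 ≤ n) {q : ℕ} (hq : q ≠ 0)
    {Z : MvPowerSeries (Fin (n + 1)) ℂ} (hZ : IsAxiomaticSeries n q Z) :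
    SatisfiesFunctionalEquations n q Z := by
  obtain ⟨H, c, hc, hZ⟩ := hZ
  have hq' : (q : ℂ) ≠ 0 := Nat.cast_ne_zero.2 hq
  have hfe : ∀ (i : Fin (n + 1)) (e : Fin (n + 1) →₀ ℕ),
      HasFunctionalEquation q q (e (i - 1) + e (i + 1))
        (coeffSeries c i (Function.update e i 0) q) := by
    intro i e
    have h := hc.hasFunctionalEquation_coeffSeries hn i (Function.update e i 0) (by simp) q hq'
    rwa [Function.update_of_ne (Fin.sub_one_ne_self (by omega) i),
      Function.update_of_ne (Fin.add_one_ne_self (by omega) i)] at h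
  have hcoeff : ∀ (i : Fin (n + 1)) (e : Fin (n + 1) →₀ ℕ) (k : ℕ),
      coeffAt Z i e k = PowerSeries.coeff k (coeffSeries c i (Function.update e i 0) q) := by
    intro i e k
    rw [coeffAt_natCast, hZ, coeffSeries, PowerSeries.coeff_mk, Function.update_idem,
      Finsupp.coe_update]
  have hneg : ∀ (i : Fin (n + 1)) (e : Fin (n + 1) →₀ ℕ) (k : ℤ), k < 0 → coeffAt Z i e k = 0 :=
    fun i e k hk => coeffAt_of_neg Z i e hk
  constructor
  · intro i e m hm k
    lift m to ℕ using by omega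
    have h := hfe i e
    rw [HasFunctionalEquation, show (e (i - 1) + e (i + 1)) / 2 = m by omega, clearPole,
      if_neg (by rw [Nat.not_even_iff_odd]; exact ⟨m, by omega⟩)] at h
    exact h.zpow_eq hq' (f := coeffAt Z i e) (hcoeff i e) (hneg i e) k
  · intro i e m hm k
    lift m to ℕ using by omega
    have h := hfe i e
    rw [HasFunctionalEquation, show (e (i - 1) + e (i + 1)) / 2 = m by omega] at h
    refine h.zpow_eq hq' (f := fun k => coeffAt Z i e k - q * coeffAt Z i e (k - 1)) ?_ ?_ k
    · intro k
      have hd : Even (e (i - 1) + e (i + 1)) := ⟨m, by omega⟩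
      rw [coeff_clearPole]
      simp only [hd, true_and]
      rw [hcoeff]
      split_ifs with hk
      · rw [← hcoeff i e (k - 1), Nat.cast_sub (by omega), Nat.cast_one]
      · rw [not_not] at hk
        subst hk
        rw [hneg i e _ (by simp), mul_zero]
    · intro k hk
      rw [hneg i e k hk, hneg i e (k - 1) (by omega), mul_zero, sub_zero]

end FunctionalEquations

end AxiomsImplyFunctionalEquations

/-! ### The residue of the multiple Dirichlet series -/

theorem mainTheorem6 (n : ℕ) (hn : 2 ≤ n) (q : ℕ) (hq : IsPrimePow q) (hq4 : q % 4 = 1)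
    (Z : MvPowerSeries (Fin (n + 1)) ℂ)
    (hZ : IsAxiomaticSeries n q Z ∨ SatisfiesFunctionalEquations n q Z) :
    -- the residue is well defined: each of its coefficients is a finite sum
    (∀ a : EvenIdx n →₀ ℕ,
      {e ∈ exponentsOver a | MvPowerSeries.coeff e (clearedSeries q Z) ≠ 0}.Finite) ∧
    (Odd n → ∀ a : EvenIdx n →₀ ℕ,
      MvPowerSeries.coeff a (residueSeries q Z) =
        (q : ℂ) ^ (-2 * ∑ i, (a i : ℤ)) * MvPowerSeries.coeff (interleaved a) Z) ∧
    (Even n → ∀ a : EvenIdx n →₀ ℕ,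
      MvPowerSeries.coeff a (residueSeries q Z) =
        (((q : ℝ) ^ (3 * ((evenEntry a 0 : ℝ) + evenEntry a (Fin.last n)) / 4
            - 2 * ∑ i, (a i : ℝ)) : ℝ) : ℂ) * MvPowerSeries.coeff (interleaved a) Z) ∧
    (∀ a : EvenIdx n →₀ ℕ, MvPowerSeries.coeff a (residueSeries q Z) ≠ 0 →
      (∀ i, Even (a i)) ∨ (∀ i, Odd (a i))) := by
  have hq0 : q ≠ 0 := hq.ne_zero
  have hZ' : SatisfiesFunctionalEquations n q Z :=
    hZ.elim (fun h => h.satisfiesFunctionalEquations hn hq0) id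
  refine ⟨fun a => (Finset.finite_toSet _).subset (exponentsOver_support_subset hZ' (by omega) a),
    fun h a => coeff_residueSeries_of_odd hZ' h hq0 a,
    fun h a => coeff_residueSeries_of_even hZ' h (by omega) hq0 a, fun a ha => ?_⟩
  refine parity_of_coeff_ne_zero hZ' a fun h0 => ha ?_
  rcases Nat.even_or_odd n with h | h
  · rw [coeff_residueSeries_of_even hZ' h (by omega) hq0 a, h0, mul_zero]
  · rw [coeff_residueSeries_of_odd hZ' h hq0 a, h0, mul_zero]
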